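/- All vector spaces are over $\mathbb C$; $\mathbb N=\{1,2,\dots\}$, $\mathbb Z_+=\{0,1,2,\dots\}$. **Setting.** Let $gl_{\infty|\infty}$ be the Lie superalgebra of matrices $A=(a_{mn})_{m,n\in\frac12\mathbb Z}$ with $a_{mn}=0$ for $|m-n|\gg0$, with the $\frac12\mathbb Z$-gradation $\deg E_{mn}=n-m$; elements of integral degree are even, those of degree in $\frac12+\mathbb Z$ are odd. Put $\mathrm{Str}(A)=\sum_{r\in\frac12\mathbb Z}(-1)^{2r}a_{rr}$ and $J=\sum_{r\le0}E_{rr}$. Let $\widehat{gl}_{\infty|\infty}=gl_{\infty|\infty}\oplus\mathbb C\mathbf 1$ be the central extension by the cocycle $\alpha(A,B)=\mathrm{Str}([J,A]B)$. On a space with basis $(e_a)_{a\in\frac12\mathbb Z}$ ($e_a$ even iff $a\in\mathbb Z$) put $(e_i|e_j)=(-1)^i\delta_{i,-j}$ for $i,j\in\mathbb Z$, $(e_r|e_s)=(-1)^{r+\frac12}\delta_{r,-s}$ for $r,s\in\frac12+\mathbb Z$, and $(e_i|e_r)=(e_r|e_i)=0$. Let $\mathcal B\subset gl_{\infty|\infty}$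 be spanned by the homogeneous $T$ with $(Tv|w)=-(-1)^{|T||v|}(v|Tw)$ for all homogeneous $v,w$, and let $\widehat{\mathcal B}=\mathcal B\oplus\mathbb C\mathbf 1\subset\widehat{gl}_{\infty|\infty}$. Let $\mathcal{SD}$ be the associative superalgebra of differential operators on the circle with one odd variable $\theta$: with $D=t\frac{d}{dt}$, its elements are the finite sums of $$t^kF(D)=t^k\bigl(f^0(D)\partial_\theta\theta+f^+(D)\partial_\theta+f^-(D)\theta+f^1(D)\theta\partial_\theta\bigr)=t^k\begin{pmatrix}f^0(D)&f^+(D)\\ f^-(D)&f^1(D)\end{pmatrix},\qquad k\in\mathbb Z,\ f^{\bullet}\in\mathbb C[w],$$ with product $t^kF(D)\cdot t^lG(D)=t^{k+l}F(D+l)G(D)$. It is regarded as a Lie superalgebra through the supercommutator, and is graded by giving $t^kf(D)\partial_\theta\theta$ and $t^kf(D)\theta\partial_\theta$ degree $k$, $t^kf(D)\partial_\theta$ degree $k-\frac12$, and $t^kf(D)\theta$ degree $k+\frac12$. Let $\widehat{\mathcal{SD}}=\mathcal{SD}\oplus\mathbb CC$ be its central extension by the cocycle $\Psi$ with $\Psi(t^kF,t^lG)=0$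 for $k+l\ne0$ and, for $k\ge0$, $$\Psi(t^kF(D),t^{-k}G(D))=\sum_{-k\le j\le-1}\mathrm{Str}\bigl(F(j)G(j+k)\bigr)$$ (super skew-symmetry gives the values for $k<0$), where $\mathrm{Str}$ of a $2\times2$ matrix is its upper left minus its lower right entry. Let $\sigma$ be the anti-involution of $\mathcal{SD}$ with $t\mapsto-t$, $D\mapsto-D-1+\partial_\theta\theta$, $\theta\mapsto t\partial_\theta$, $\partial_\theta\mapsto-t^{-1}\theta$ (an anti-involution in the super sense, $\sigma(xy)=(-1)^{|x||y|}\sigma(y)\sigma(x)$), let ${}^0\mathcal{SD}=\{x\in\mathcal{SD}:\sigma(x)=-x\}$, and let ${}^0\widehat{\mathcal{SD}}={}^0\mathcal{SD}\oplus\mathbb CC\subset\widehat{\mathcal{SD}}$. For $s\in\mathbb C$ let $\phi_s:\mathcal{SD}\to gl_{\infty|\infty}$ be given by the action on $t^s\mathbb C[t,t^{-1}]\oplus\theta t^s\mathbb C[t,t^{-1}]$ in the basis $v_i=t^{-i+s}$, $v_{i-\frac12}=t^{-i+s}\theta$ ($i\in\mathbb Z$). Thus $\phi_s$ sends $$t^kf(D)\partial_\theta\theta\mapsto\sum_{j}f(-j+s)E_{j-k,j},\qquad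 t^kf(D)\theta\partial_\theta\mapsto\sum_{j}f(-j+s)E_{j-k-\frac12,j-\frac12},$$ $$t^kf(D)\partial_\theta\mapsto\sum_{j}f(-j+s)E_{j-k,j-\frac12},\qquad t^kf(D)\theta\mapsto\sum_{j}f(-j+s)E_{j-k-\frac12,j},$$ all sums being over $j\in\mathbb Z$. Its extension $\hat\phi_s:\widehat{\mathcal{SD}}\to\widehat{gl}_{\infty|\infty}$ is $\hat\phi_s(C)=\mathbf 1$ and $\hat\phi_s(t^kF(D))=\phi_s(t^kF(D))+\delta_{k,0}\bigl(h^0(s)-h^0(0)-h^1(s)+h^1(0)\bigr)\mathbf 1$, where $h^a$ is a polynomial with $h^a(w)-h^a(w+1)=f^a(w)$. It restricts to $\hat\phi_s:{}^0\widehat{\mathcal{SD}}\to\widehat{gl}_{\infty|\infty}$, and $\hat\phi_0$ restricts to ${}^0\widehat{\mathcal{SD}}\to\widehat{\mathcal B}$. For each of these $\frac12\mathbb Z$-graded Lie superalgebras $\mathfrak g$ (central elements have degree $0$) and each $\xi\in\mathfrak g_0^*$, $L(\mathfrak g,\xi)$ denotes the irreducible highest weight module of highest weight $\xi$: the irreducible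 graded module with a nonzero vector $v$ of degree $0$ such that $\mathfrak g_jv=0$ for $j>0$ and $hv=\xi(h)v$ for $h\in\mathfrak g_0$. The highest weight $\Lambda$ of a $\widehat{gl}_{\infty|\infty}$-module is in the restricted dual: $\Lambda(\sum_ad_aE_{aa})=\sum_a\lambda_ad_a$ with only finitely many $\lambda_a=\Lambda(E_{aa})$ nonzero, $a\in\frac12\mathbb Z$; likewise for $\widehat{\mathcal B}$, with $\lambda_a=\Lambda(E_{aa}-E_{-a,-a})$, $a\in\frac12\mathbb N$. The central charge is $c=\Lambda(\mathbf 1)\in\mathbb C$. The generating functions of $\xi\in\widehat{\mathcal{SD}}_0^*$ are $$\Delta_0(x)=-\xi(e^{xD}\partial_\theta\theta),\qquad\Delta_1(x)=-\xi(e^{xD}\theta\partial_\theta),$$ and those of $\xi\in({}^0\widehat{\mathcal{SD}})_0^*$ are $${}^0\Delta_0(x)=-\xi(\sinh(xD)\,\partial_\theta\theta),\qquad{}^0\Delta_1(x)=-\xi(\sinh(x(D+\tfrac12))\,\theta\partial_\theta),$$ formal power series in $x$. Below, ``specified by'' means that $\xi$ is the unique weight with $\xi(C)=c$ and the given generating functions.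 **Proposition.** 1. For every $s\in\mathbb C$, the pullback of $L(\widehat{gl}_{\infty|\infty},\Lambda)$, of central charge $c$, via $\hat\phi_s$ is the irreducible highest weight module $L(\widehat{\mathcal{SD}},\xi)$, where $\xi$ is specified by $\xi(C)=c$ and $$\Delta_0(x)=\frac{\sum_{i\in\mathbb Z}(\lambda_i-\lambda_{i+1}+\delta_{i,0}c)\,e^{(-i+s)x}-c}{e^x-1},\qquad\Delta_1(x)=\frac{\sum_{i\in\mathbb Z}(\lambda_{i-\frac12}-\lambda_{i+\frac12}-\delta_{i,0}c)\,e^{(-i+s)x}+c}{e^x-1}.$$ 2. The pullback of $L(\widehat{\mathcal B},\Lambda)$, of central charge $c$, via $\hat\phi_0$ is the irreducible highest weight module $L({}^0\widehat{\mathcal{SD}},\xi)$, where $\xi$ is specified by $\xi(C)=c$ and $${}^0\Delta_0(x)=-\sum_{i\in\mathbb N}\lambda_i\sinh(-ix),\qquad{}^0\Delta_1(x)=-\sum_{r\in\frac12+\mathbb Z_+}\lambda_r\sinh(-rx).$$ 3. For every $s\in\mathbb C\setminus\frac12\mathbb Z$, the pullback of $L(\widehat{gl}_{\infty|\infty},\Lambda)$,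 of central charge $c$, via $\hat\phi_s$ is the irreducible highest weight module $L({}^0\widehat{\mathcal{SD}},\xi)$, where $\xi$ is specified by $\xi(C)=c$ and $${}^0\Delta_0(x)=-\sum_{i\in\mathbb Z}\lambda_i\sinh((-i+s)x)+\frac c2\cdot\frac{\cosh((s-\frac12)x)-\cosh(\frac x2)}{\sinh(\frac x2)},$$ $${}^0\Delta_1(x)=-\sum_{r\in\frac12+\mathbb Z}\lambda_r\sinh((-r+s)x)-\frac c2\cdot\frac{\cosh(sx)-1}{\sinh(\frac x2)}.$$ -/

import Mathlib

open Polynomial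

noncomputable section

namespace SuperCircle

/-! ## Lie superalgebras with a `½ℤ`-gradation

All gradations below are `½ℤ`-gradations whose integer degrees form the even part and whose
half-integer degrees form the odd part.  Half-integers are stored doubled: the index `n : ℤ`
stands for the half-integer `n / 2`.  In particular a homogeneous element of doubled degree `n` is
odd exactly when `n` is odd. -/

/-- The sign `(-1)^n`. -/
def parSign (n : ℤ) : ℂ := if Odd n then -1 else 1

/-- The Koszul sign `(-1)^{|x||y|}` of elements of (doubled) degrees `i` and `j`. -/
def superSign (i j : ℤ) : ℂ := if Odd i ∧ Odd j then -1 else 1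

/-- A `½ℤ`-gradation of a vector space, given by the projections `comp i` onto the component of
degree `i / 2`. -/
class HalfGraded (L : Type*) [AddCommGroup L] [Module ℂ L] where
  comp : ℤ → L →ₗ[ℂ] L
  comp_comp : ∀ i j x, comp i (comp j x) = if i = j then comp j x else 0
  exists_eq_sum : ∀ x, ∃ S : Finset ℤ, x = ∑ i ∈ S, comp i x

/-- The homogeneous component of degree `i / 2`. -/
def gr (L : Type*) [AddCommGroup L] [Module ℂ L] [HalfGraded L] (i : ℤ) : Submodule ℂ L :=
  LinearMap.range (HalfGraded.comp (L := L) i)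

theorem mem_gr {L : Type*} [AddCommGroup L] [Module ℂ L] [HalfGraded L] {i : ℤ} {x : L} :
    x ∈ gr L i ↔ HalfGraded.comp i x = x := by
  constructor
  · rintro ⟨y, rfl⟩
    simp [HalfGraded.comp_comp]
  · intro h
    exact ⟨x, h⟩

/-- A complex Lie superalgebra with a `½ℤ`-gradation compatible with the `ℤ₂`-gradation. -/
class LieSuperalgebra (L : Type*) [AddCommGroup L] [Module ℂ L] extends HalfGraded L where
  bracket : L →ₗ[ℂ] L →ₗ[ℂ] L
  bracket_mem : ∀ i j x y, x ∈ gr L i → y ∈ gr L j → bracket x y ∈ gr L (i + j)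
  skew : ∀ i j x y, x ∈ gr L i → y ∈ gr L j → bracket x y = -(superSign i j • bracket y x)
  jacobi : ∀ i j k x y z, x ∈ gr L i → y ∈ gr L j → z ∈ gr L k →
    bracket x (bracket y z) =
      bracket (bracket x y) z + superSign i j • bracket y (bracket x z)


/-- `ρ` is the action map of an irreducible highest weight module over `L`, of highest weight `ξ`:
the module is `½ℤ`-graded, has a nonzero vector of degree `0` that is annihilated by all elements of
positive degree and on which the degree zero part `L₀` acts through `ξ`, and has no invariant
subspaces apart from `0` and the whole space. -/
structure IsIrreducibleHighestWeight {L : Type*} [AddCommGroup L] [Module ℂ L] [LieSuperalgebra L]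
    {V : Type*} [AddCommGroup V] [Module ℂ V] (ρ : L →ₗ[ℂ] Module.End ℂ V)
    (ξ : Module.Dual ℂ (gr L 0)) : Prop where
  map_bracket : ∀ i j x y, x ∈ gr L i → y ∈ gr L j →
    ρ (LieSuperalgebra.bracket x y) = ρ x * ρ y - superSign i j • (ρ y * ρ x)
  exists_highest_weight_vector : ∃ 𝒱 : ℤ → Submodule ℂ V, DirectSum.IsInternal 𝒱 ∧
    (∀ i j x m, x ∈ gr L i → m ∈ 𝒱 j → ρ x m ∈ 𝒱 (i + j)) ∧
    ∃ v ∈ 𝒱 0, v ≠ 0 ∧ (∀ i x, 0 < i → x ∈ gr L i → ρ x v = 0) ∧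
      ∀ h : gr L 0, ρ h v = ξ h • v
  irreducible : ∀ W : Submodule ℂ V, (∀ x, ∀ w ∈ W, ρ x w ∈ W) → W = ⊥ ∨ W = ⊤

/-- A subspace closed under the bracket and spanned by homogeneous elements. -/
structure GradedSubalgebra (L : Type*) [AddCommGroup L] [Module ℂ L] [LieSuperalgebra L] where
  carrier : Submodule ℂ L
  comp_mem : ∀ i x, x ∈ carrier → HalfGraded.comp i x ∈ carrier
  bracket_mem : ∀ x y, x ∈ carrier → y ∈ carrier → LieSuperalgebra.bracket x y ∈ carrier

theorem mem_gr_sub_iff {L : Type*} [AddCommGroup L] [Module ℂ L] [HalfGraded L]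
    (S : Submodule ℂ L) [HalfGraded S]
    (h : ∀ i (x : S), ((HalfGraded.comp i x : S) : L) = HalfGraded.comp i (x : L))
    {i : ℤ} {x : S} : x ∈ gr S i ↔ (x : L) ∈ gr L i := by
  rw [mem_gr, mem_gr, ← h, Subtype.ext_iff]

instance GradedSubalgebra.halfGraded {L : Type*} [AddCommGroup L] [Module ℂ L] [LieSuperalgebra L]
    (S : GradedSubalgebra L) : HalfGraded S.carrier where
  comp i := (HalfGraded.comp i).restrict (S.comp_mem i)
  comp_comp i j x := by
    apply Subtype.ext
    have := HalfGraded.comp_comp i j (x : L)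
    simp only [LinearMap.restrict_apply, this]
    split_ifs <;> rfl
  exists_eq_sum x := by
    obtain ⟨T, hT⟩ := HalfGraded.exists_eq_sum (x : L)
    refine ⟨T, Subtype.ext ?_⟩
    rw [Submodule.coe_sum]
    simpa [LinearMap.restrict_apply] using hT

instance GradedSubalgebra.lieSuperalgebra {L : Type*} [AddCommGroup L] [Module ℂ L]
    [LieSuperalgebra L] (S : GradedSubalgebra L) : LieSuperalgebra S.carrier where
  bracket := LinearMap.mk₂ ℂ
    (fun x y => ⟨LieSuperalgebra.bracket (x : L) (y : L), S.bracket_mem x y x.2 y.2⟩)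
    (fun x y z => Subtype.ext (by simp)) (fun a x y => Subtype.ext (by simp))
    (fun x y z => Subtype.ext (by simp)) (fun a x y => Subtype.ext (by simp))
  bracket_mem i j x y hx hy := by
    rw [mem_gr_sub_iff S.carrier (fun _ _ => rfl)] at *
    exact LieSuperalgebra.bracket_mem i j _ _ hx hy
  skew i j x y hx hy := by
    rw [mem_gr_sub_iff S.carrier (fun _ _ => rfl)] at *
    exact Subtype.ext (LieSuperalgebra.skew i j _ _ hx hy)
  jacobi i j k x y z hx hy hz := by
    rw [mem_gr_sub_iff S.carrier (fun _ _ => rfl)] at *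
    exact Subtype.ext (LieSuperalgebra.jacobi i j k _ _ _ hx hy hz)

theorem bracket_mem_of_homogeneous {L : Type*} [AddCommGroup L] [Module ℂ L] [LieSuperalgebra L]
    {S : Submodule ℂ L} (hS : ∀ i x, x ∈ S → HalfGraded.comp i x ∈ S)
    (h : ∀ i j x y, x ∈ S → y ∈ S → x ∈ gr L i → y ∈ gr L j → LieSuperalgebra.bracket x y ∈ S)
    (x y : L) (hx : x ∈ S) (hy : y ∈ S) : LieSuperalgebra.bracket x y ∈ S := by
  obtain ⟨T, hT⟩ := HalfGraded.exists_eq_sum x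
  obtain ⟨U, hU⟩ := HalfGraded.exists_eq_sum y
  rw [hU, map_sum]
  refine Submodule.sum_mem _ fun j _ => ?_
  rw [hT, map_sum, LinearMap.sum_apply]
  refine Submodule.sum_mem _ fun i _ => ?_
  exact h i j _ _ (hS i x hx) (hS j y hy) ⟨x, rfl⟩ ⟨y, rfl⟩

/-! ## Associative superalgebras, the super commutator and central extensions -/

/-- An associative superalgebra with a `½ℤ`-gradation; `odd` is the projection onto the odd part. -/
class GradedSuperring (A : Type*) [NonUnitalRing A] [Module ℂ A] extends HalfGraded A where
  odd : A →ₗ[ℂ] A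
  odd_apply : ∀ i x, x ∈ gr A i → odd x = if Odd i then x else 0
  mul_mem : ∀ i j x y, x ∈ gr A i → y ∈ gr A j → x * y ∈ gr A (i + j)

section Associative

variable {A : Type*} [NonUnitalRing A] [Module ℂ A] [IsScalarTower ℂ A A] [SMulCommClass ℂ A A]
  [GradedSuperring A]

/-- The super commutator: the bilinear map with `[x, y] = x y - (-1)^{|x||y|} y x` on homogeneous
elements. -/
def superComm : A →ₗ[ℂ] A →ₗ[ℂ] A :=
  LinearMap.mul ℂ A - (LinearMap.mul ℂ A).flip +
    (2 : ℂ) • ((LinearMap.mul ℂ A).flip.compl₁₂ GradedSuperring.odd GradedSuperring.odd)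

theorem superComm_apply {i j : ℤ} {x y : A} (hx : x ∈ gr A i) (hy : y ∈ gr A j) :
    superComm x y = x * y - superSign i j • (y * x) := by
  simp only [superComm, LinearMap.add_apply, LinearMap.sub_apply, LinearMap.mul_apply',
    LinearMap.flip_apply, LinearMap.smul_apply, LinearMap.compl₁₂_apply,
    GradedSuperring.odd_apply i x hx, GradedSuperring.odd_apply j y hy, superSign]
  by_cases h1 : Odd i <;> by_cases h2 : Odd j <;> simp [h1, h2]
  rw [two_smul]; abel

theorem superComm_mem {i j : ℤ} {x y : A} (hx : x ∈ gr A i) (hy : y ∈ gr A j) :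
    superComm x y ∈ gr A (i + j) := by
  rw [superComm_apply hx hy]
  exact Submodule.sub_mem _ (GradedSuperring.mul_mem _ _ _ _ hx hy)
    (Submodule.smul_mem _ _ (add_comm j i ▸ GradedSuperring.mul_mem _ _ _ _ hy hx))

theorem superSign_mul_self (i j : ℤ) : superSign i j * superSign j i = 1 := by
  unfold superSign; by_cases h1 : Odd i <;> by_cases h2 : Odd j <;> simp [h1, h2]

theorem superSign_comm (i j : ℤ) : superSign i j = superSign j i := by
  unfold superSign; simp only [and_comm]

theorem superSign_add_right (i j k : ℤ) :
    superSign i (j + k) = superSign i j * superSign i k := by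
  unfold superSign
  by_cases h1 : Odd i <;> by_cases h2 : Odd j <;> by_cases h3 : Odd k <;>
    simp [h1, h2, h3, Int.odd_add, ← Int.not_odd_iff_even]

theorem superSign_add_left (i j k : ℤ) :
    superSign (i + j) k = superSign i k * superSign j k := by
  rw [superSign_comm, superSign_add_right, superSign_comm k i, superSign_comm k j]

theorem superComm_skew {i j : ℤ} {x y : A} (hx : x ∈ gr A i) (hy : y ∈ gr A j) :
    superComm x y = -(superSign i j • superComm y x) := by
  rw [superComm_apply hx hy, superComm_apply hy hx, smul_sub, smul_smul, superSign_mul_self,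
    one_smul, neg_sub]

theorem superComm_jacobi {i j k : ℤ} {x y z : A} (hx : x ∈ gr A i) (hy : y ∈ gr A j)
    (hz : z ∈ gr A k) :
    superComm x (superComm y z) =
      superComm (superComm x y) z + superSign i j • superComm y (superComm x z) := by
  rw [superComm_apply hx (superComm_mem hy hz), superComm_apply (superComm_mem hx hy) hz,
    superComm_apply hy (superComm_mem hx hz), superComm_apply hx hy, superComm_apply hy hz,
    superComm_apply hx hz, superSign_add_right, superSign_add_right, superSign_add_left,
    superSign_comm j i]
  have h1 : superSign i j * superSign i j = 1 := by
    conv_lhs => rw [superSign_comm i j]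
    rw [superSign_comm j i]; nth_rewrite 2 [superSign_comm]; exact superSign_mul_self i j
  simp only [mul_sub, sub_mul, smul_sub, mul_smul_comm, smul_mul_assoc, smul_smul, mul_assoc]
  have h2 : superSign i j * (superSign i j * superSign j k) = superSign j k := by
    rw [← mul_assoc, h1, one_mul]
  have h3 : superSign i j * (superSign i j * (superSign j k * superSign i k))
      = superSign j k * superSign i k := by
    rw [← mul_assoc, h1, one_mul]
  rw [h2, h3]
  have h4 : superSign i k * superSign j k = superSign j k * superSign i k := mul_comm _ _
  have h6 : superSign i k * (superSign j k * superSign i j)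
     = superSign j k * (superSign i j * superSign i k) := by ring
  have h7 : superSign i j * (superSign j k * superSign i k)
     = superSign j k * (superSign i j * superSign i k) := by ring
  simp only [h4, h6, h7]
  abel

end Associative

/-- An even two-cocycle of degree zero on the Lie superalgebra attached to `A`. -/
structure SuperCocycle (A : Type*) [NonUnitalRing A] [Module ℂ A] [IsScalarTower ℂ A A]
    [SMulCommClass ℂ A A] [GradedSuperring A] where
  toFun : A →ₗ[ℂ] A →ₗ[ℂ] ℂ
  degree : ∀ i j x y, x ∈ gr A i → y ∈ gr A j → i + j ≠ 0 → toFun x y = 0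
  skew : ∀ i j x y, x ∈ gr A i → y ∈ gr A j → toFun x y = -(superSign i j * toFun y x)
  cocycle : ∀ i j k x y z, x ∈ gr A i → y ∈ gr A j → z ∈ gr A k →
    toFun x (superComm y z) =
      toFun (superComm x y) z + superSign i j * toFun y (superComm x z)

/-- The central extension of the Lie superalgebra attached to `A` by a one-dimensional centre of
degree zero: the pair `(x, z)` is the element `x + z • C`, where `C` is the central generator. -/
def CentralExt {A : Type*} [NonUnitalRing A] [Module ℂ A] [IsScalarTower ℂ A A]
    [SMulCommClass ℂ A A] [GradedSuperring A] (_ψ : SuperCocycle A) : Type _ := A × ℂ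

section CentralExt

variable {A : Type*} [NonUnitalRing A] [Module ℂ A] [IsScalarTower ℂ A A] [SMulCommClass ℂ A A]
  [GradedSuperring A] (ψ : SuperCocycle A)

instance : AddCommGroup (CentralExt ψ) := inferInstanceAs (AddCommGroup (A × ℂ))

instance : Module ℂ (CentralExt ψ) := inferInstanceAs (Module ℂ (A × ℂ))

/-- The element `x + z • C`. -/
def CentralExt.mk (x : A) (z : ℂ) : CentralExt ψ := (x, z)

/-- The projection onto the original Lie superalgebra. -/
def CentralExt.base : CentralExt ψ →ₗ[ℂ] A := LinearMap.fst ℂ A ℂ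

/-- The coefficient of the central generator. -/
def CentralExt.coeff : CentralExt ψ →ₗ[ℂ] ℂ := LinearMap.snd ℂ A ℂ

/-- The linear map `x + z • C ↦ f x + (g x + z) • C`. -/
def CentralExt.lift {B : Type*} [NonUnitalRing B] [Module ℂ B] [IsScalarTower ℂ B B]
    [SMulCommClass ℂ B B] [GradedSuperring B] (ψ : SuperCocycle A) (ψ' : SuperCocycle B)
    (f : A →ₗ[ℂ] B) (g : A →ₗ[ℂ] ℂ) : CentralExt ψ →ₗ[ℂ] CentralExt ψ' :=
  (f ∘ₗ CentralExt.base ψ).prod (g ∘ₗ CentralExt.base ψ + CentralExt.coeff ψ)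

@[ext] theorem CentralExt.ext {x y : CentralExt ψ}
    (h1 : CentralExt.base ψ x = CentralExt.base ψ y)
    (h2 : CentralExt.coeff ψ x = CentralExt.coeff ψ y) : x = y := Prod.ext h1 h2

@[simp] theorem CentralExt.base_mk (x : A) (z : ℂ) : CentralExt.base ψ (CentralExt.mk ψ x z) = x :=
  rfl

@[simp] theorem CentralExt.coeff_mk (x : A) (z : ℂ) :
    CentralExt.coeff ψ (CentralExt.mk ψ x z) = z := rfl

instance : HalfGraded (CentralExt ψ) where
  comp i := ((HalfGraded.comp i : A →ₗ[ℂ] A) ∘ₗ CentralExt.base ψ).prod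
    (if i = 0 then CentralExt.coeff ψ else 0)
  comp_comp i j x := by
    refine Prod.ext ?_ ?_
    · change HalfGraded.comp i (HalfGraded.comp j x.1) = _
      rw [HalfGraded.comp_comp]
      split_ifs <;> rfl
    · by_cases h : i = j <;> by_cases hi : i = 0 <;> by_cases hj : j = 0 <;>
        simp_all [CentralExt.coeff] <;> rfl
  exists_eq_sum x := by
    obtain ⟨S, hS⟩ := HalfGraded.exists_eq_sum (L := A) x.1
    have key : ∀ i, i ∉ S → HalfGraded.comp i x.1 = 0 := by
      intro i hi
      rw [hS, map_sum]
      refine Finset.sum_eq_zero fun j hj => ?_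
      rw [HalfGraded.comp_comp, if_neg]
      rintro rfl; exact hi hj
    refine ⟨insert 0 S, ?_⟩
    apply CentralExt.ext
    · rw [map_sum]
      change x.1 = ∑ i ∈ insert 0 S, HalfGraded.comp i x.1
      rw [← Finset.sum_subset (Finset.subset_insert 0 S) (fun i _ hi => key i hi)]
      exact hS
    · rw [map_sum]
      change x.2 = ∑ i ∈ insert 0 S,
        (if i = 0 then CentralExt.coeff ψ else 0 : CentralExt ψ →ₗ[ℂ] ℂ) x
      rw [Finset.sum_eq_single_of_mem 0 (Finset.mem_insert_self _ _)]
      · simp only [if_true]; rfl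
      · intro b _ hb; simp [hb]

theorem CentralExt.mem_gr {i : ℤ} {x : CentralExt ψ} :
    x ∈ gr (CentralExt ψ) i ↔
      CentralExt.base ψ x ∈ gr A i ∧ (i ≠ 0 → CentralExt.coeff ψ x = 0) := by
  rw [SuperCircle.mem_gr, SuperCircle.mem_gr]
  constructor
  · intro h
    refine ⟨congrArg (CentralExt.base ψ) h, fun hi => ?_⟩
    rw [← congrArg (CentralExt.coeff ψ) h]
    change (if i = 0 then CentralExt.coeff ψ else 0 : CentralExt ψ →ₗ[ℂ] ℂ) x = 0
    simp [hi]
  · rintro ⟨h1, h2⟩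
    apply CentralExt.ext
    · exact h1
    · change (if i = 0 then CentralExt.coeff ψ else 0 : CentralExt ψ →ₗ[ℂ] ℂ) x = _
      by_cases hi : i = 0
      · simp [hi]
      · simp [hi, h2 hi]

/-- The bracket of the central extension: `[x + z C, y + w C] = [x, y] + ψ(x, y) C`. -/
instance : LieSuperalgebra (CentralExt ψ) where
  bracket := LinearMap.mk₂ ℂ
    (fun x y => CentralExt.mk ψ (superComm (CentralExt.base ψ x) (CentralExt.base ψ y))
      (ψ.toFun (CentralExt.base ψ x) (CentralExt.base ψ y)))
    (fun x y z => CentralExt.ext ψ (by simp) (by simp))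
    (fun a x y => CentralExt.ext ψ (by simp) (by simp))
    (fun x y z => CentralExt.ext ψ (by simp) (by simp))
    (fun a x y => CentralExt.ext ψ (by simp) (by simp))
  bracket_mem i j x y hx hy := by
    rw [CentralExt.mem_gr] at *
    exact ⟨superComm_mem hx.1 hy.1, fun h => ψ.degree i j _ _ hx.1 hy.1 h⟩
  skew i j x y hx hy := by
    rw [CentralExt.mem_gr] at *
    apply CentralExt.ext
    · simpa using superComm_skew hx.1 hy.1
    · simpa using ψ.skew i j _ _ hx.1 hy.1
  jacobi i j k x y z hx hy hz := by
    rw [CentralExt.mem_gr] at *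
    apply CentralExt.ext
    · simpa using superComm_jacobi hx.1 hy.1 hz.1
    · simpa using ψ.cocycle i j k _ _ _ hx.1 hy.1 hz.1

end CentralExt

/-! ## The Lie superalgebra `gl_{∞|∞}` and its central extension -/

/-- Matrices `(a_{ij})`, `i, j ∈ ½ℤ`, with finitely many nonzero diagonals.  Rows and columns are
indexed by doubled half-integers, so the entry at `(m, n)` is `a_{m/2, n/2}`. -/
def bandMatrices : Submodule ℂ (ℤ → ℤ → ℂ) where
  carrier := {A | ∃ N : ℤ, ∀ m n, N < |m - n| → A m n = 0}
  add_mem' := by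
    rintro A B ⟨N, hN⟩ ⟨M, hM⟩
    refine ⟨max N M, fun m n h => ?_⟩
    simp [hN m n (lt_of_le_of_lt (le_max_left _ _) h), hM m n (lt_of_le_of_lt (le_max_right _ _) h)]
  zero_mem' := ⟨0, fun _ _ _ => rfl⟩
  smul_mem' := by
    rintro c A ⟨N, hN⟩
    exact ⟨N, fun m n h => by simp [hN m n h]⟩

/-- The associative superalgebra underlying `gl_{∞|∞}`. -/
abbrev Gl : Type := bandMatrices

namespace Gl

theorem finsum_eq {f g : ℤ → ℂ} {m N : ℤ} {S : Finset ℤ} (hf : ∀ k, N < |m - k| → f k = 0)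
    (hS : Finset.Icc (m - N) (m + N) ⊆ S) : ∑ᶠ k, f k * g k = ∑ k ∈ S, f k * g k := by
  apply finsum_eq_sum_of_support_subset
  intro k hk
  by_contra hkS
  apply hk
  have : N < |m - k| := by
    by_contra h
    push Not at h
    rw [abs_le] at h
    exact hkS (hS (Finset.mem_Icc.2 ⟨by linarith, by linarith⟩))
  simp [hf k this]

instance : Mul Gl where
  mul A B := ⟨fun m n => ∑ᶠ k, A.1 m k * B.1 k n, by
    obtain ⟨N, hN⟩ := A.2
    obtain ⟨M, hM⟩ := B.2
    refine ⟨N + M, fun m n h => ?_⟩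
    refine finsum_eq_zero_of_forall_eq_zero fun k => ?_
    by_cases h1 : N < |m - k|
    · simp [hN m k h1]
    · have : M < |k - n| := by
        have := abs_sub_le m k n
        linarith
      simp [hM k n this]⟩

theorem mul_apply (A B : Gl) (m n : ℤ) : (A * B).1 m n = ∑ᶠ k, A.1 m k * B.1 k n := rfl

theorem mul_apply_eq {A : Gl} {N : ℤ} (hN : ∀ m n, N < |m - n| → A.1 m n = 0) (B : Gl) (m n : ℤ)
    {S : Finset ℤ} (hS : Finset.Icc (m - N) (m + N) ⊆ S) :
    (A * B).1 m n = ∑ k ∈ S, A.1 m k * B.1 k n :=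
  finsum_eq (hN m) hS

theorem exists_band (A : Gl) : ∃ N : ℤ, 0 ≤ N ∧ ∀ m n, N < |m - n| → A.1 m n = 0 := by
  obtain ⟨N, hN⟩ := A.2
  exact ⟨max N 0, le_max_right _ _, fun m n h => hN m n (lt_of_le_of_lt (le_max_left _ _) h)⟩

theorem ext {A B : Gl} (h : ∀ m n, A.1 m n = B.1 m n) : A = B :=
  Subtype.ext (funext fun m => funext fun n => h m n)

theorem add_mul' (A B C : Gl) : (A + B) * C = A * C + B * C := by
  obtain ⟨N, hN0, hN⟩ := A.exists_band
  obtain ⟨M, hM0, hM⟩ := B.exists_band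
  refine ext fun m n => ?_
  have h1 : Finset.Icc (m - N) (m + N) ⊆ Finset.Icc (m - (N + M)) (m + (N + M)) :=
    Finset.Icc_subset_Icc (by linarith) (by linarith)
  have h2 : Finset.Icc (m - M) (m + M) ⊆ Finset.Icc (m - (N + M)) (m + (N + M)) :=
    Finset.Icc_subset_Icc (by linarith) (by linarith)
  have h3 : ∀ m n, N + M < |m - n| → (A + B).1 m n = 0 := fun m n h => by
    change A.1 m n + B.1 m n = 0
    rw [hN m n (by linarith), hM m n (by linarith), add_zero]
  change _ = (A * C).1 m n + (B * C).1 m n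
  rw [mul_apply_eq hN C m n h1, mul_apply_eq hM C m n h2, mul_apply_eq h3 C m n subset_rfl,
    ← Finset.sum_add_distrib]
  exact Finset.sum_congr rfl fun k _ => add_mul _ _ _

theorem mul_add' (A B C : Gl) : A * (B + C) = A * B + A * C := by
  obtain ⟨N, hN0, hN⟩ := A.exists_band
  refine ext fun m n => ?_
  change _ = (A * B).1 m n + (A * C).1 m n
  rw [mul_apply_eq hN _ m n subset_rfl, mul_apply_eq hN _ m n subset_rfl,
    mul_apply_eq hN _ m n subset_rfl, ← Finset.sum_add_distrib]
  exact Finset.sum_congr rfl fun k _ => mul_add _ _ _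

theorem mul_assoc' (A B C : Gl) : A * B * C = A * (B * C) := by
  obtain ⟨N, hN0, hN⟩ := A.exists_band
  obtain ⟨M, hM0, hM⟩ := B.exists_band
  refine ext fun m n => ?_
  set S := Finset.Icc (m - (N + M)) (m + (N + M)) with hS
  set T := Finset.Icc (m - N) (m + N) with hT
  have hAB : ∀ k, N + M < |m - k| → (A * B).1 m k = 0 := by
    intro k hk
    rw [mul_apply_eq hN B m k subset_rfl]
    refine Finset.sum_eq_zero fun l hl => ?_
    rw [Finset.mem_Icc] at hl
    have h1 : |m - l| ≤ N := by rw [abs_le]; constructor <;> linarith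
    have h2 := abs_sub_le m l k
    rw [hM l k (by linarith), mul_zero]
  have e1 : (A * B * C).1 m n = ∑ k ∈ S, (A * B).1 m k * C.1 k n := finsum_eq hAB subset_rfl
  have e2 : ∀ l ∈ T, (B * C).1 l n = ∑ k ∈ S, B.1 l k * C.1 k n := by
    intro l hl
    rw [Finset.mem_Icc] at hl
    exact mul_apply_eq hM C l n (Finset.Icc_subset_Icc (by linarith) (by linarith))
  have e3 : ∀ k ∈ S, (A * B).1 m k * C.1 k n = ∑ l ∈ T, A.1 m l * B.1 l k * C.1 k n := by
    intro k _
    rw [mul_apply_eq hN B m k subset_rfl, Finset.sum_mul]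
  rw [e1, mul_apply_eq hN (B * C) m n subset_rfl, Finset.sum_congr rfl e3, Finset.sum_comm]
  refine Finset.sum_congr rfl fun l hl => ?_
  rw [e2 l hl, Finset.mul_sum]
  exact Finset.sum_congr rfl fun k _ => mul_assoc _ _ _

instance : NonUnitalRing Gl where
  left_distrib := mul_add'
  right_distrib := add_mul'
  zero_mul A := ext fun m n => by
    rw [mul_apply]
    change ∑ᶠ k, (0 : ℂ) * A.1 k n = 0
    simp
  mul_zero A := ext fun m n => by
    rw [mul_apply]
    change ∑ᶠ k, A.1 m k * (0 : ℂ) = 0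
    simp
  mul_assoc := mul_assoc'

instance : IsScalarTower ℂ Gl Gl where
  smul_assoc c A B := by
    obtain ⟨N, hN0, hN⟩ := A.exists_band
    refine ext fun m n => ?_
    change ((c • A) * B).1 m n = c * (A * B).1 m n
    rw [mul_apply_eq hN B m n subset_rfl, mul_apply_eq (A := c • A) (N := N)
      (fun m n h => by change c * A.1 m n = 0; simp [hN m n h]) B m n subset_rfl, Finset.mul_sum]
    exact Finset.sum_congr rfl fun k _ => mul_assoc _ _ _

instance : SMulCommClass ℂ Gl Gl where
  smul_comm c A B := by
    obtain ⟨N, hN0, hN⟩ := A.exists_band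
    refine ext fun m n => ?_
    change c * (A * B).1 m n = (A * (c • B)).1 m n
    rw [mul_apply_eq hN B m n subset_rfl, mul_apply_eq hN _ m n subset_rfl, Finset.mul_sum]
    exact Finset.sum_congr rfl fun k _ => mul_left_comm _ _ _

/-- The matrix with the same entries as `A` at the places `(m, n)` with `p (n - m)` and zero
elsewhere. -/
def restrictDiag (p : ℤ → Prop) [DecidablePred p] : Gl →ₗ[ℂ] Gl where
  toFun A := ⟨fun m n => if p (n - m) then A.1 m n else 0, by
    obtain ⟨N, hN⟩ := A.2
    exact ⟨N, fun m n h => by simp [hN m n h]⟩⟩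
  map_add' A B := ext fun m n => by
    change (if p (n - m) then A.1 m n + B.1 m n else 0) =
      (if p (n - m) then A.1 m n else 0) + (if p (n - m) then B.1 m n else 0)
    split_ifs <;> simp
  map_smul' c A := ext fun m n => by
    change (if p (n - m) then c * A.1 m n else 0) = c * (if p (n - m) then A.1 m n else 0)
    split_ifs <;> simp

theorem restrictDiag_apply (p : ℤ → Prop) [DecidablePred p] (A : Gl) (m n : ℤ) :
    (restrictDiag p A).1 m n = if p (n - m) then A.1 m n else 0 := rfl

/-- The principal gradation: `E_{ij}` has degree `j - i`. -/
instance : HalfGraded Gl where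
  comp i := restrictDiag (· = i)
  comp_comp i j A := ext fun m n => by
    by_cases h : i = j
    · subst h
      simp only [restrictDiag_apply, if_true]
      split_ifs <;> rfl
    · simp only [restrictDiag_apply, if_neg h]
      by_cases h1 : n - m = i
      · have h2 : n - m ≠ j := fun h' => h (h1.symm.trans h')
        simp [h1, h]
      · simp [h1]
  exists_eq_sum A := by
    obtain ⟨N, hN0, hN⟩ := A.exists_band
    refine ⟨Finset.Icc (-N) N, ext fun m n => ?_⟩
    have : ∀ S : Finset ℤ, (∑ i ∈ S, restrictDiag (· = i) A).1 m n
        = ∑ i ∈ S, (if n - m = i then A.1 m n else 0) := by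
      intro S
      induction S using Finset.induction_on with
      | empty => rfl
      | insert a S ha ih =>
        rw [Finset.sum_insert ha, Finset.sum_insert ha, ← ih]; rfl
    rw [this, Finset.sum_ite_eq]
    split_ifs with h
    · rfl
    · apply hN
      by_contra h'
      push Not at h'
      rw [abs_le] at h'
      exact h (Finset.mem_Icc.2 ⟨by linarith, by linarith⟩)

theorem mem_gr {i : ℤ} {A : Gl} : A ∈ gr Gl i ↔ ∀ m n, n - m ≠ i → A.1 m n = 0 := by
  rw [SuperCircle.mem_gr]
  constructor
  · intro h m n hmn
    rw [← h]
    change (if n - m = i then A.1 m n else 0) = 0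
    simp [hmn]
  · intro h
    refine ext fun m n => ?_
    change (if n - m = i then A.1 m n else 0) = _
    split_ifs with h'
    · rfl
    · exact (h m n h').symm

/-- `E_{ij}` is odd exactly when `i - j` is not an integer. -/
instance : GradedSuperring Gl where
  odd := restrictDiag Odd
  odd_apply i A hA := ext fun m n => by
    rw [mem_gr] at hA
    rw [restrictDiag_apply]
    by_cases h : n - m = i
    · subst h
      split_ifs <;> rfl
    · rw [hA m n h]
      split_ifs
      · exact (hA m n h).symm
      · rfl
      · exact (hA m n h).symm
      · rfl
  mul_mem i j A B hA hB := by
    rw [mem_gr] at *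
    intro m n h
    rw [mul_apply]
    refine finsum_eq_zero_of_forall_eq_zero fun k => ?_
    by_cases h1 : k - m = i
    · have : n - k ≠ j := fun h2 => h (by rw [← h1, ← h2]; ring)
      simp [hB k n this]
    · simp [hA m k h1]

/-- The supertrace `∑_r (-1)^{2r} c_{rr}`, for matrices with finitely many nonzero diagonal
entries. -/
def str (A : Gl) : ℂ := ∑ᶠ n, parSign n * A.1 n n

/-- The matrix `J = ∑_{r ≤ 0} E_{rr}`. -/
def J : Gl := ⟨fun m n => if m = n ∧ m ≤ 0 then 1 else 0, 0, fun m n h => by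
  have : m ≠ n := by rintro rfl; simp at h
  simp [this]⟩

/-- `[J, A]`. -/
def commJ (A : Gl) : Gl := J * A - A * J

theorem commJ_apply (A : Gl) (m n : ℤ) :
    (commJ A).1 m n = ((if m ≤ 0 then 1 else 0) - (if n ≤ 0 then 1 else 0)) * A.1 m n := by
  change (J * A).1 m n - (A * J).1 m n = _
  rw [mul_apply, mul_apply, finsum_eq_single _ m, finsum_eq_single _ n]
  · simp [J, sub_mul]
  · intro k hk; simp [J, hk]
  · intro k hk; simp [J, Ne.symm hk]

/-- Matrices with only finitely many nonzero entries. -/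
def FinSupp (X : Gl) : Prop := ∃ M : ℤ, ∀ m n, (M < |m| ∨ M < |n|) → X.1 m n = 0

theorem finSupp_commJ (A : Gl) : FinSupp (commJ A) := by
  obtain ⟨N, hN0, hN⟩ := A.exists_band
  refine ⟨N, fun m n h => ?_⟩
  rw [commJ_apply]
  by_cases h1 : N < |m - n|
  · simp [hN m n h1]
  · push Not at h1
    rw [abs_le] at h1
    rcases h with h | h <;> rw [lt_abs] at h <;> rcases h with h | h
    · rw [if_neg (by linarith), if_neg (by linarith)]; simp
    · rw [if_pos (by linarith), if_pos (by linarith)]; simp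
    · rw [if_neg (by linarith), if_neg (by linarith)]; simp
    · rw [if_pos (by linarith), if_pos (by linarith)]; simp

theorem FinSupp.str_eq {X : Gl} {M : ℤ} (hM : ∀ m n, (M < |m| ∨ M < |n|) → X.1 m n = 0) :
    str X = ∑ n ∈ Finset.Icc (-M) M, parSign n * X.1 n n := by
  apply finsum_eq_sum_of_support_subset
  intro k hk
  by_contra h
  apply hk
  change parSign k * X.1 k k = 0
  rw [hM k k, mul_zero]
  left
  by_contra h'
  push Not at h'
  rw [abs_le] at h'
  exact h (Finset.mem_coe.2 (Finset.mem_Icc.2 h'))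

theorem str_mul_left {X : Gl} {M : ℤ} (hM : ∀ m n, (M < |m| ∨ M < |n|) → X.1 m n = 0) (B : Gl) :
    str (X * B) = ∑ m ∈ Finset.Icc (-M) M, ∑ k ∈ Finset.Icc (-M) M,
      parSign m * (X.1 m k * B.1 k m) := by
  have key : ∀ m, (X * B).1 m m = ∑ k ∈ Finset.Icc (-M) M, X.1 m k * B.1 k m := by
    intro m
    apply finsum_eq_sum_of_support_subset
    intro k hk
    by_contra h
    apply hk
    change X.1 m k * B.1 k m = 0
    rw [hM m k, zero_mul]
    right
    by_contra h'
    push Not at h'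
    rw [abs_le] at h'
    exact h (Finset.mem_coe.2 (Finset.mem_Icc.2 h'))
  have : str (X * B) = ∑ m ∈ Finset.Icc (-M) M, parSign m * (X * B).1 m m := by
    apply finsum_eq_sum_of_support_subset
    intro m hm
    by_contra h
    apply hm
    have hm' : M < |m| := by
      by_contra h'
      push Not at h'
      rw [abs_le] at h'
      exact h (Finset.mem_coe.2 (Finset.mem_Icc.2 h'))
    simp only [key]
    rw [Finset.sum_eq_zero, mul_zero]
    intro k _
    rw [hM m k (Or.inl hm'), zero_mul]
  rw [this]
  refine Finset.sum_congr rfl fun m _ => ?_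
  rw [key, Finset.mul_sum]

theorem str_mul_right {X : Gl} {M : ℤ} (hM : ∀ m n, (M < |m| ∨ M < |n|) → X.1 m n = 0) (B : Gl) :
    str (B * X) = ∑ m ∈ Finset.Icc (-M) M, ∑ k ∈ Finset.Icc (-M) M,
      parSign m * (B.1 m k * X.1 k m) := by
  have key : ∀ m, (B * X).1 m m = ∑ k ∈ Finset.Icc (-M) M, B.1 m k * X.1 k m := by
    intro m
    apply finsum_eq_sum_of_support_subset
    intro k hk
    by_contra h
    apply hk
    change B.1 m k * X.1 k m = 0
    rw [hM k m, mul_zero]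
    left
    by_contra h'
    push Not at h'
    rw [abs_le] at h'
    exact h (Finset.mem_coe.2 (Finset.mem_Icc.2 h'))
  have : str (B * X) = ∑ m ∈ Finset.Icc (-M) M, parSign m * (B * X).1 m m := by
    apply finsum_eq_sum_of_support_subset
    intro m hm
    by_contra h
    apply hm
    have hm' : M < |m| := by
      by_contra h'
      push Not at h'
      rw [abs_le] at h'
      exact h (Finset.mem_coe.2 (Finset.mem_Icc.2 h'))
    simp only [key]
    rw [Finset.sum_eq_zero, mul_zero]
    intro k _
    rw [hM k m (Or.inr hm'), mul_zero]
  rw [this]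
  refine Finset.sum_congr rfl fun m _ => ?_
  rw [key, Finset.mul_sum]

theorem parSign_mul (i m k : ℤ) (h : k - m = i) : parSign m = superSign i i * parSign k := by
  subst h
  unfold parSign superSign
  by_cases h1 : Odd k <;> by_cases h2 : Odd m <;>
    simp [h1, h2, Int.odd_sub, ← Int.not_odd_iff_even]

theorem str_mul_comm {X Y : Gl} (hX : FinSupp X) {i j : ℤ} (hi : X ∈ gr Gl i) (hj : Y ∈ gr Gl j) :
    str (X * Y) = superSign i j * str (Y * X) := by
  obtain ⟨M, hM⟩ := hX
  rw [mem_gr] at hi hj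
  rw [str_mul_left hM, str_mul_right hM, Finset.sum_comm, Finset.mul_sum]
  refine Finset.sum_congr rfl fun k _ => ?_
  rw [Finset.mul_sum]
  refine Finset.sum_congr rfl fun m _ => ?_
  by_cases h1 : k - m = i
  · by_cases h2 : m - k = j
    · have : superSign i j = superSign i i := by
        have : j = -i := by linarith
        subst this
        unfold superSign
        simp
      rw [this, parSign_mul i m k h1]; ring
    · simp [hj k m h2]
  · simp [hi m k h1]

theorem str_mul_add {X X' : Gl} (hX : FinSupp X) (hX' : FinSupp X') (B : Gl) :
    str ((X + X') * B) = str (X * B) + str (X' * B) := by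
  obtain ⟨M, hM⟩ := hX
  obtain ⟨M', hM'⟩ := hX'
  have e1 : ∀ m n, (max M M' < |m| ∨ max M M' < |n|) → X.1 m n = 0 := fun m n h =>
    hM m n (h.imp (lt_of_le_of_lt (le_max_left _ _)) (lt_of_le_of_lt (le_max_left _ _)))
  have e2 : ∀ m n, (max M M' < |m| ∨ max M M' < |n|) → X'.1 m n = 0 := fun m n h =>
    hM' m n (h.imp (lt_of_le_of_lt (le_max_right _ _)) (lt_of_le_of_lt (le_max_right _ _)))
  have e3 : ∀ m n, (max M M' < |m| ∨ max M M' < |n|) → (X + X').1 m n = 0 := fun m n h => by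
    change X.1 m n + X'.1 m n = 0
    rw [e1 m n h, e2 m n h, add_zero]
  rw [str_mul_left e1, str_mul_left e2, str_mul_left e3, ← Finset.sum_add_distrib]
  refine Finset.sum_congr rfl fun m _ => ?_
  rw [← Finset.sum_add_distrib]
  refine Finset.sum_congr rfl fun k _ => ?_
  change parSign m * ((X.1 m k + X'.1 m k) * _) = _
  ring

theorem str_mul_smul {X : Gl} (hX : FinSupp X) (c : ℂ) (B : Gl) :
    str ((c • X) * B) = c * str (X * B) := by
  obtain ⟨M, hM⟩ := hX
  have e3 : ∀ m n, (M < |m| ∨ M < |n|) → (c • X).1 m n = 0 := fun m n h => by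
    change c * X.1 m n = 0
    rw [hM m n h, mul_zero]
  rw [str_mul_left hM, str_mul_left e3, Finset.mul_sum]
  refine Finset.sum_congr rfl fun m _ => ?_
  rw [Finset.mul_sum]
  refine Finset.sum_congr rfl fun k _ => ?_
  change parSign m * ((c * X.1 m k) * _) = _
  ring

theorem str_mul_add_right {X : Gl} (hX : FinSupp X) (B B' : Gl) :
    str (X * (B + B')) = str (X * B) + str (X * B') := by
  obtain ⟨M, hM⟩ := hX
  rw [str_mul_left hM, str_mul_left hM, str_mul_left hM, ← Finset.sum_add_distrib]
  refine Finset.sum_congr rfl fun m _ => ?_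
  rw [← Finset.sum_add_distrib]
  refine Finset.sum_congr rfl fun k _ => ?_
  change parSign m * (X.1 m k * (B.1 k m + B'.1 k m)) = _
  ring

theorem commJ_add (A B : Gl) : commJ (A + B) = commJ A + commJ B := by
  simp only [commJ, mul_add, add_mul]; abel

theorem commJ_smul (c : ℂ) (A : Gl) : commJ (c • A) = c • commJ A := by
  simp only [commJ, mul_smul_comm, smul_mul_assoc, smul_sub]

theorem commJ_mul (A B : Gl) : commJ (A * B) = commJ A * B + A * commJ B := by
  simp only [commJ, mul_sub, sub_mul, mul_assoc]; abel

theorem commJ_mem {i : ℤ} {A : Gl} (hA : A ∈ gr Gl i) : commJ A ∈ gr Gl i := by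
  rw [mem_gr] at *
  intro m n h
  rw [commJ_apply, hA m n h, mul_zero]

theorem FinSupp.mul_left {X : Gl} (hX : FinSupp X) (A : Gl) : FinSupp (A * X) := by
  obtain ⟨M, hM⟩ := hX
  obtain ⟨N, hN0, hN⟩ := A.exists_band
  refine ⟨max M (M + N), fun m n h => ?_⟩
  rw [mul_apply]
  refine finsum_eq_zero_of_forall_eq_zero fun k => ?_
  by_cases h1 : N < |m - k|
  · simp [hN m k h1]
  · rw [hM k n, mul_zero]
    rcases h with h | h
    · left
      have h2 := abs_sub_abs_le_abs_sub m k
      have := le_max_right M (M + N)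
      linarith
    · right
      exact lt_of_le_of_lt (le_max_left _ _) h

theorem FinSupp.mul_right {X : Gl} (hX : FinSupp X) (A : Gl) : FinSupp (X * A) := by
  obtain ⟨M, hM⟩ := hX
  obtain ⟨N, hN0, hN⟩ := A.exists_band
  refine ⟨max M (M + N), fun m n h => ?_⟩
  rw [mul_apply]
  refine finsum_eq_zero_of_forall_eq_zero fun k => ?_
  by_cases h1 : N < |k - n|
  · simp [hN k n h1]
  · rw [hM m k, zero_mul]
    rcases h with h | h
    · left
      exact lt_of_le_of_lt (le_max_left _ _) h
    · right
      have h2 := abs_sub_abs_le_abs_sub n k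
      rw [abs_sub_comm] at h2
      have := le_max_right M (M + N)
      linarith

/-- The form `α(A, B) = Str([J, A] B)`. -/
def alpha : Gl →ₗ[ℂ] Gl →ₗ[ℂ] ℂ := LinearMap.mk₂ ℂ (fun A B => str (commJ A * B))
  (fun A A' B => by rw [commJ_add, str_mul_add (finSupp_commJ A) (finSupp_commJ A')])
  (fun c A B => by rw [commJ_smul, str_mul_smul (finSupp_commJ A)]; rfl)
  (fun A B B' => str_mul_add_right (finSupp_commJ A) B B')
  (fun c A B => by
    rw [mul_smul_comm, ← smul_mul_assoc, str_mul_smul (finSupp_commJ A)]; rfl)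

theorem alpha_apply (A B : Gl) : alpha A B = str (commJ A * B) := rfl

theorem str_zero_of_mem {i : ℤ} (hi : i ≠ 0) {A : Gl} (hA : A ∈ gr Gl i) : str A = 0 := by
  rw [mem_gr] at hA
  rw [str]
  refine finsum_eq_zero_of_forall_eq_zero fun n => ?_
  rw [hA n n (by simpa using hi.symm), mul_zero]

theorem str_add {X Y : Gl} (hX : FinSupp X) (hY : FinSupp Y) : str (X + Y) = str X + str Y := by
  obtain ⟨M, hM⟩ := hX
  obtain ⟨M', hM'⟩ := hY
  have e1 : ∀ m n, (max M M' < |m| ∨ max M M' < |n|) → X.1 m n = 0 := fun m n h =>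
    hM m n (h.imp (lt_of_le_of_lt (le_max_left _ _)) (lt_of_le_of_lt (le_max_left _ _)))
  have e2 : ∀ m n, (max M M' < |m| ∨ max M M' < |n|) → Y.1 m n = 0 := fun m n h =>
    hM' m n (h.imp (lt_of_le_of_lt (le_max_right _ _)) (lt_of_le_of_lt (le_max_right _ _)))
  have e3 : ∀ m n, (max M M' < |m| ∨ max M M' < |n|) → (X + Y).1 m n = 0 := fun m n h => by
    change X.1 m n + Y.1 m n = 0
    rw [e1 m n h, e2 m n h, add_zero]
  rw [FinSupp.str_eq e1, FinSupp.str_eq e2, FinSupp.str_eq e3, ← Finset.sum_add_distrib]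
  exact Finset.sum_congr rfl fun k _ => mul_add _ _ _

theorem alpha_skew {i j : ℤ} {A B : Gl} (hA : A ∈ gr Gl i) (hB : B ∈ gr Gl j) :
    alpha A B = -(superSign i j * alpha B A) := by
  by_cases hij : i + j = 0
  · have h0 : str (commJ (A * B)) = 0 := by
      rw [str]
      refine finsum_eq_zero_of_forall_eq_zero fun n => ?_
      rw [commJ_apply]; simp
    rw [commJ_mul, str_add ((finSupp_commJ A).mul_right B) ((finSupp_commJ B).mul_left A)] at h0
    have h1 := str_mul_comm (finSupp_commJ B) (commJ_mem hB) hA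
    rw [alpha_apply, alpha_apply, h1, ← mul_assoc, superSign_mul_self, one_mul]
    linear_combination h0
  · rw [alpha_apply, alpha_apply,
      str_zero_of_mem hij (GradedSuperring.mul_mem _ _ _ _ (commJ_mem hA) hB),
      str_zero_of_mem (i := j + i) (by rwa [add_comm])
        (GradedSuperring.mul_mem _ _ _ _ (commJ_mem hB) hA)]
    simp

theorem alpha_cocycle {i j k : ℤ} {A B C : Gl} (hA : A ∈ gr Gl i) (hB : B ∈ gr Gl j)
    (hC : C ∈ gr Gl k) :
    alpha A (superComm B C) =
      alpha (superComm A B) C + superSign i j * alpha B (superComm A C) := by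
  have c1 := str_mul_comm (finSupp_commJ B) (commJ_mem hB) (GradedSuperring.mul_mem _ _ _ _ hC hA)
  have c2 := str_mul_comm (finSupp_commJ A) (commJ_mem hA) (GradedSuperring.mul_mem _ _ _ _ hC hB)
  rw [superComm_apply hB hC, superComm_apply hA hB, superComm_apply hA hC]
  simp only [map_sub, map_smul, LinearMap.sub_apply, LinearMap.smul_apply, smul_eq_mul]
  simp only [alpha_apply, commJ_mul, add_mul]
  have fA := finSupp_commJ A
  have fB := finSupp_commJ B
  rw [str_add ((fA.mul_right B).mul_right C) ((fB.mul_left A).mul_right C),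
    str_add ((fB.mul_right A).mul_right C) ((fA.mul_left B).mul_right C)]
  have d1 := str_mul_comm (X := commJ B * C) (fB.mul_right C)
    (GradedSuperring.mul_mem _ _ _ _ (commJ_mem hB) hC) hA
  have d2 := str_mul_comm (X := commJ A * C) (fA.mul_right C)
    (GradedSuperring.mul_mem _ _ _ _ (commJ_mem hA) hC) hB
  simp only [mul_assoc] at *
  rw [d1, d2, superSign_add_left, superSign_add_left]
  have s1 := superSign_mul_self i j
  rw [superSign_comm j i] at s1 ⊢
  have s2 := superSign_mul_self i k
  rw [superSign_comm k i] at s2 ⊢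
  have s3 := superSign_mul_self j k
  rw [superSign_comm k j] at s3 ⊢
  linear_combination str (A * (commJ B * C)) * superSign i k ^ 2 * s1 +
    str (A * (commJ B * C)) * s2 - superSign i j * str (B * (commJ A * C)) * s3

/-- The two-cocycle `α(A, B) = Str([J, A] B)` of `gl_{∞|∞}`. -/
def cocycle : SuperCocycle Gl where
  toFun := alpha
  degree _ _ _ _ hA hB h :=
    str_zero_of_mem h (GradedSuperring.mul_mem _ _ _ _ (commJ_mem hA) hB)
  skew _ _ _ _ hA hB := alpha_skew hA hB
  cocycle _ _ _ _ _ _ hA hB hC := alpha_cocycle hA hB hC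

end Gl

/-- The central extension of `gl_{∞|∞}`. -/
abbrev GlHat : Type := CentralExt Gl.cocycle

/-! ## Differential operators on the super circle -/

/-- The associative superalgebra of regular differential operators on the super circle `S^{1|1}`,
identified with `2 × 2` matrices of differential operators on the circle.  The element
`∑_k t^k F_k(D)`, `D = t ∂_t`, is stored as the finitely supported function `k ↦ F_k`; the matrix
units `(0,0)`, `(0,1)`, `(1,0)`, `(1,1)` stand for `∂_θ θ`, `∂_θ`, `θ`, `θ ∂_θ`. -/
def SD : Type := ℤ →₀ Matrix (Fin 2) (Fin 2) ℂ[X]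

namespace SD

instance : AddCommGroup SD := inferInstanceAs (AddCommGroup (ℤ →₀ Matrix (Fin 2) (Fin 2) ℂ[X]))

instance : Module ℂ SD := inferInstanceAs (Module ℂ (ℤ →₀ Matrix (Fin 2) (Fin 2) ℂ[X]))

/-- The coefficient `F_k` of `∑_k t^k F_k(D)`. -/
def coeff (k : ℤ) : SD →ₗ[ℂ] Matrix (Fin 2) (Fin 2) ℂ[X] := Finsupp.lapply k

/-- The element `t^k F(D)`. -/
def term (k : ℤ) : Matrix (Fin 2) (Fin 2) ℂ[X] →ₗ[ℂ] SD := Finsupp.lsingle k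

theorem coeff_term (k l : ℤ) (F : Matrix (Fin 2) (Fin 2) ℂ[X]) :
    coeff l (term k F) = if k = l then F else 0 := Finsupp.single_apply

theorem ext {x y : SD} (h : ∀ k a b, coeff k x a b = coeff k y a b) : x = y :=
  Finsupp.ext fun k => Matrix.ext fun a b => h k a b

theorem induction {p : SD → Prop} (x : SD) (h0 : p 0) (hadd : ∀ x y, p x → p y → p (x + y))
    (hterm : ∀ k F, p (term k F)) : p x :=
  Finsupp.induction_linear (motive := p) x h0 hadd hterm

/-- The linear map on `SD` with prescribed values on the elements `t^k F(D)`. -/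
def ofTerms {V : Type*} [AddCommGroup V] [Module ℂ V]
    (f : ℤ → Matrix (Fin 2) (Fin 2) ℂ[X] →ₗ[ℂ] V) : SD →ₗ[ℂ] V :=
  Finsupp.lsum ℂ f

theorem ofTerms_term {V : Type*} [AddCommGroup V] [Module ℂ V]
    (f : ℤ → Matrix (Fin 2) (Fin 2) ℂ[X] →ₗ[ℂ] V) (k : ℤ) (F : Matrix (Fin 2) (Fin 2) ℂ[X]) :
    ofTerms f (term k F) = f k F :=
  Finsupp.lsum_single _ _ _ _

theorem exists_bound (x : SD) : ∃ N : ℤ, ∀ k, N < |k| → coeff k x = 0 := by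
  refine SD.induction (p := fun x => ∃ N : ℤ, ∀ k, N < |k| → coeff k x = 0) x
    ⟨0, fun k _ => map_zero _⟩ ?_ ?_
  · rintro x y ⟨N, hN⟩ ⟨M, hM⟩
    refine ⟨max N M, fun k hk => ?_⟩
    rw [map_add, hN k (lt_of_le_of_lt (le_max_left _ _) hk),
      hM k (lt_of_le_of_lt (le_max_right _ _) hk), add_zero]
  · intro k F
    refine ⟨|k|, fun l hl => ?_⟩
    rw [coeff_term, if_neg]
    rintro rfl
    exact lt_irrefl _ hl

/-- The substitution `f(D) ↦ f(D + a)`. -/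
def shift (a : ℂ) : ℂ[X] →ₐ[ℂ] ℂ[X] := aeval (X + C a)

/-- The product `t^r F(D) · t^s G(D) = t^{r+s} F(D + s) G(D)`. -/
def mulTerm (r s : ℤ) : Matrix (Fin 2) (Fin 2) ℂ[X] →ₗ[ℂ] Matrix (Fin 2) (Fin 2) ℂ[X] →ₗ[ℂ] SD :=
  LinearMap.mk₂ ℂ (fun F G => term (r + s) ((shift s).mapMatrix F * G))
    (fun F F' G => by rw [map_add, add_mul, map_add])
    (fun c F G => by rw [map_smul, smul_mul_assoc, map_smul])
    (fun F G G' => by rw [mul_add, map_add])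
    (fun c F G => by rw [mul_smul_comm, map_smul])

/-- The bilinear extension of `mulTerm`. -/
def mulLin : SD →ₗ[ℂ] SD →ₗ[ℂ] SD :=
  ofTerms fun r => LinearMap.flip (ofTerms fun s => (mulTerm r s).flip)

instance : Mul SD := ⟨fun x y => mulLin x y⟩

theorem mul_def (x y : SD) : x * y = mulLin x y := rfl

theorem term_mul_term (r s : ℤ) (F G : Matrix (Fin 2) (Fin 2) ℂ[X]) :
    term r F * term s G = term (r + s) ((shift s).mapMatrix F * G) := by
  rw [mul_def, mulLin, ofTerms_term, LinearMap.flip_apply, ofTerms_term]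
  rfl

/-! The action on `t^s ℂ[t, t⁻¹] ⊕ θ t^s ℂ[t, t⁻¹]` with the basis `v_i = t^{-i+s}`,
`v_{i-1/2} = t^{-i+s} θ`.  A doubled index `m` is `2 p - a` with `p = idx m` and `a = par m`. -/

/-- The integer `p` with `m = 2 p` or `m = 2 p - 1`. -/
def idx (m : ℤ) : ℤ := (m + 1) / 2

/-- The parity of `m`. -/
def par (m : ℤ) : Fin 2 := if Odd m then 1 else 0

theorem idx_two_mul (p : ℤ) : idx (2 * p) = p := by unfold idx; omega

theorem idx_two_mul_sub (p : ℤ) : idx (2 * p - 1) = p := by unfold idx; omega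

theorem par_two_mul (p : ℤ) : par (2 * p) = 0 := by simp [par]

theorem par_two_mul_sub (p : ℤ) : par (2 * p - 1) = 1 := by
  have : Odd (2 * p - 1) := ⟨p - 1, by ring⟩
  simp [par, this]

theorem exists_idx (m : ℤ) : m = 2 * idx m - (par m : ℕ) := by
  unfold idx par
  split_ifs with h
  · obtain ⟨k, rfl⟩ := h
    simp only [Fin.val_one, Nat.cast_one]; omega
  · rw [Int.not_odd_iff_even] at h
    obtain ⟨k, rfl⟩ := h
    simp only [Fin.val_zero, Nat.cast_zero]; omega

theorem idx_eq (p : ℤ) (a : Fin 2) : idx (2 * p - (a : ℕ)) = p := by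
  fin_cases a
  · simpa using idx_two_mul p
  · simpa using idx_two_mul_sub p

theorem par_eq (p : ℤ) (a : Fin 2) : par (2 * p - (a : ℕ)) = a := by
  fin_cases a
  · simpa using par_two_mul p
  · simpa using par_two_mul_sub p

/-- The map `φ_s : SD → gl_{∞|∞}`, `t^k f_a(D) M_a ↦ ∑_{j ∈ ℤ} f_a(-j + s) E_{j-k,j} M_a`, where
`E_{pq} M_0 = E_{p,q}`, `E_{pq} M_1 = E_{p-1/2,q-1/2}`, `E_{pq} M_+ = E_{p,q-1/2}` and
`E_{pq} M_- = E_{p-1/2,q}`. -/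
def phi (s : ℂ) : SD →ₗ[ℂ] Gl where
  toFun x := ⟨fun m n =>
      (coeff (idx n - idx m) x (par m) (par n)).eval (-(idx n : ℂ) + s), by
    obtain ⟨N, hN⟩ := exists_bound x
    refine ⟨2 * |N| + 2, fun m n h => ?_⟩
    change (coeff (idx n - idx m) x (par m) (par n)).eval _ = 0
    rw [hN, Matrix.zero_apply, eval_zero]
    unfold idx
    rw [lt_abs] at h ⊢
    have := le_abs_self N
    omega⟩
  map_add' x y := Gl.ext fun m n => by
    change Polynomial.eval _ (coeff _ (x + y) _ _) =
      Polynomial.eval _ (coeff _ x _ _) + Polynomial.eval _ (coeff _ y _ _)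
    rw [map_add, Matrix.add_apply, eval_add]
  map_smul' c x := Gl.ext fun m n => by
    change Polynomial.eval _ (coeff _ (c • x) _ _) = c * Polynomial.eval _ (coeff _ x _ _)
    rw [map_smul, Matrix.smul_apply, eval_smul, smul_eq_mul]

theorem phi_apply (s : ℂ) (x : SD) (m n : ℤ) : (phi s x).1 m n =
    (coeff (idx n - idx m) x (par m) (par n)).eval (-(idx n : ℂ) + s) := rfl

theorem phi_injective (s : ℂ) : Function.Injective (phi s) := by
  rw [← LinearMap.ker_eq_bot, LinearMap.ker_eq_bot']
  intro x hx
  refine ext fun k a b => ?_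
  rw [map_zero, Matrix.zero_apply]
  have key : ∀ q : ℤ, (coeff k x a b).eval (-(q : ℂ) + s) = 0 := by
    intro q
    have h1 : (phi s x).1 (2 * (q - k) - (a : ℕ)) (2 * q - (b : ℕ)) = 0 := by rw [hx]; rfl
    rw [phi_apply, idx_eq, idx_eq, par_eq, par_eq] at h1
    rwa [show q - (q - k) = k by ring] at h1
  apply Polynomial.eq_zero_of_infinite_isRoot
  refine Set.Infinite.mono (s := Set.range fun q : ℤ => -(q : ℂ) + s) ?_ ?_
  · rintro _ ⟨q, rfl⟩
    exact key q
  · apply Set.infinite_range_of_injective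
    intro q q' h
    simpa using h

theorem phi_term_mul (s : ℂ) (r u : ℤ) (F G : Matrix (Fin 2) (Fin 2) ℂ[X]) :
    phi s (term r F * term u G) = phi s (term r F) * phi s (term u G) := by
  refine Gl.ext fun m n => ?_
  rw [term_mul_term, phi_apply, Gl.mul_apply, coeff_term]
  simp only [phi_apply, coeff_term]
  set l := idx n - u with hl
  have hsub : (Function.support fun k => Polynomial.eval (-(idx k : ℂ) + s)
      ((if r = idx k - idx m then F else 0) (par m) (par k)) * Polynomial.eval (-(idx n : ℂ) + s)
      ((if u = idx n - idx k then G else 0) (par k) (par n))) ⊆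
      (({2 * l, 2 * l - 1} : Finset ℤ) : Set ℤ) := by
    intro k hk
    have h1 : u = idx n - idx k := by
      by_contra h
      apply hk
      simp [h]
    have h2 := exists_idx k
    have h3 : idx k = l := by omega
    rw [h3] at h2
    simp only [Finset.coe_insert, Finset.coe_singleton, Set.mem_insert_iff,
      Set.mem_singleton_iff]
    have := (par k).2
    omega
  rw [finsum_eq_sum_of_support_subset _ hsub, Finset.sum_pair (by omega)]
  simp only [idx_two_mul, idx_two_mul_sub, par_two_mul, par_two_mul_sub]
  have e1 : (u = idx n - l) := by omega
  rw [if_pos e1]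
  by_cases h : r = l - idx m
  · rw [if_pos h, if_pos (by omega), Matrix.mul_apply, Fin.sum_univ_two]
    have e2 : ∀ f : ℂ[X], (shift u f).eval (-(idx n : ℂ) + s) = f.eval (-(l : ℂ) + s) := by
      intro f
      rw [shift, Polynomial.aeval_def, Polynomial.eval₂_eq_sum_range, Polynomial.eval_finsetSum,
        Polynomial.eval_eq_sum_range]
      refine Finset.sum_congr rfl fun i _ => ?_
      rw [hl]
      simp only [Polynomial.algebraMap_eq, eval_mul, eval_C, eval_pow, eval_add, eval_X]
      congr 2
      push_cast; ring
    simp only [AlgHom.mapMatrix_apply, Matrix.map_apply, eval_add, eval_mul, e2]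
  · rw [if_neg h, if_neg (by omega)]
    simp

theorem phi_mul (s : ℂ) (x y : SD) : phi s (x * y) = phi s x * phi s y := by
  simp only [mul_def]
  refine SD.induction (p := fun x => phi s (mulLin x y) = phi s x * phi s y) x ?_ ?_ ?_
  · rw [map_zero, LinearMap.zero_apply, map_zero, zero_mul]
  · intro x x' h h'
    rw [map_add, LinearMap.add_apply, map_add, h, h', map_add, add_mul]
  · intro r F
    refine SD.induction (p := fun y => phi s (mulLin (term r F) y) = phi s (term r F) * phi s y)
      y ?_ ?_ ?_
    · rw [map_zero, map_zero, mul_zero]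
    · intro y y' h h'
      rw [map_add, map_add, h, h', map_add, mul_add]
    · intro u G
      exact phi_term_mul s r u F G

instance : NonUnitalRing SD where
  left_distrib x y z := (mulLin x).map_add y z
  right_distrib x y z := by simp only [mul_def, map_add, LinearMap.add_apply]
  zero_mul x := by simp only [mul_def, map_zero, LinearMap.zero_apply]
  mul_zero x := (mulLin x).map_zero
  mul_assoc x y z := phi_injective 0 (by simp only [phi_mul, mul_assoc])

instance : IsScalarTower ℂ SD SD where
  smul_assoc c x y := by
    change mulLin (c • x) y = c • mulLin x y
    rw [map_smul, LinearMap.smul_apply]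

instance : SMulCommClass ℂ SD SD where
  smul_comm c x y := ((mulLin x).map_smul c y).symm

/-- The part of `x` consisting of the matrix entries `(a, b)` of `t^k F_k(D)` with `p k a b`. -/
def restrictEntries (p : ℤ → Fin 2 → Fin 2 → Prop) [∀ k a b, Decidable (p k a b)] :
    SD →ₗ[ℂ] SD :=
  ofTerms fun k => term k ∘ₗ
    { toFun := fun F => Matrix.of fun a b => if p k a b then F a b else 0
      map_add' := fun F G => by
        ext a b : 2; simp only [Matrix.of_apply, Matrix.add_apply]; split_ifs <;> simp
      map_smul' := fun c F => by
        ext a b : 2; simp only [Matrix.of_apply, Matrix.smul_apply]; split_ifs <;> simp }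

theorem coeff_restrictEntries (p : ℤ → Fin 2 → Fin 2 → Prop) [∀ k a b, Decidable (p k a b)]
    (x : SD) (k : ℤ) (a b : Fin 2) :
    coeff k (restrictEntries p x) a b = if p k a b then coeff k x a b else 0 := by
  refine SD.induction (p := fun x => coeff k (restrictEntries p x) a b =
    if p k a b then coeff k x a b else 0) x ?_ ?_ ?_
  · simp only [map_zero, Matrix.zero_apply, ite_self]
  · intro x y hx hy
    rw [map_add, map_add, Matrix.add_apply, hx, hy, map_add, Matrix.add_apply]
    split_ifs <;> simp
  · intro l F
    have : restrictEntries p (term l F)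
        = term l (Matrix.of fun a b => if p l a b then F a b else 0) := by
      rw [restrictEntries, ofTerms_term]; rfl
    rw [this, coeff_term, coeff_term]
    by_cases h : l = k
    · subst h
      simp
    · simp [h]

/-- The principal gradation: `t` has degree `1`, `D` has degree `0`, `θ` has degree `1/2` and `∂_θ`
has degree `-1/2`. -/
instance : HalfGraded SD where
  comp i := restrictEntries fun k a b => 2 * k + (a : ℕ) - (b : ℕ) = i
  comp_comp i j x := ext fun k a b => by
    rw [coeff_restrictEntries, coeff_restrictEntries]
    by_cases h : i = j
    · subst h
      rw [if_pos rfl, coeff_restrictEntries]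
      split_ifs <;> rfl
    · rw [if_neg h]
      by_cases h1 : 2 * k + (a : ℕ) - (b : ℕ) = i
      · rw [if_pos h1, if_neg (fun h2 => h (h1.symm.trans h2))]; simp
      · rw [if_neg h1]; simp
  exists_eq_sum x := by
    obtain ⟨N, hN⟩ := exists_bound x
    refine ⟨Finset.Icc (-(2 * |N| + 1)) (2 * |N| + 1), ext fun k a b => ?_⟩
    rw [map_sum, Matrix.sum_apply]
    simp only [coeff_restrictEntries]
    rw [Finset.sum_ite_eq]
    split_ifs with h
    · rfl
    · rw [hN, Matrix.zero_apply]
      rw [Finset.mem_Icc] at h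
      have h1 := a.2
      have h2 := b.2
      have := le_abs_self N
      rw [lt_abs]
      omega

theorem mem_gr {i : ℤ} {x : SD} : x ∈ gr SD i ↔
    ∀ k (a b : Fin 2), 2 * k + (a : ℕ) - (b : ℕ) ≠ i → coeff k x a b = 0 := by
  rw [SuperCircle.mem_gr]
  constructor
  · intro h k a b hk
    rw [← h]
    exact (coeff_restrictEntries _ _ _ _ _).trans (if_neg hk)
  · intro h
    refine ext fun k a b => (coeff_restrictEntries _ _ _ _ _).trans ?_
    split_ifs with h'
    · rfl
    · exact (h k a b h').symm

theorem phi_mem_gr {s : ℂ} {i : ℤ} {x : SD} : phi s x ∈ gr Gl i ↔ x ∈ gr SD i := by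
  have key : ∀ y, phi s (HalfGraded.comp i y) = HalfGraded.comp i (phi s y) := by
    intro y
    refine Gl.ext fun m n => ?_
    rw [phi_apply]
    change Polynomial.eval _ (coeff _ (restrictEntries _ y) _ _) =
      if n - m = i then (phi s y).1 m n else 0
    rw [coeff_restrictEntries, phi_apply]
    have h1 := exists_idx m
    have h2 := exists_idx n
    by_cases h : n - m = i
    · rw [if_pos h, if_pos (by omega)]
    · rw [if_neg h, if_neg (by omega), eval_zero]
  rw [SuperCircle.mem_gr, SuperCircle.mem_gr, ← key]
  exact (phi_injective s).eq_iff

instance : GradedSuperring SD where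
  odd := restrictEntries fun _ a b => a ≠ b
  odd_apply i x hx := by
    rw [mem_gr] at hx
    refine ext fun k a b => ?_
    rw [coeff_restrictEntries]
    by_cases h : 2 * k + (a : ℕ) - (b : ℕ) = i
    · have h1 : Odd i ↔ a ≠ b := by
        subst h
        rw [← Int.not_even_iff_odd]
        fin_cases a <;> fin_cases b <;> simp [parity_simps]
      by_cases h2 : a ≠ b
      · rw [if_pos h2, if_pos (h1.2 h2)]
      · rw [if_neg h2, if_neg (fun h3 => h2 (h1.1 h3))]; simp
    · have h1 := hx k a b h
      split_ifs <;> simp [h1]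
  mul_mem i j x y hx hy := by
    rw [← phi_mem_gr (s := 0)] at *
    rw [phi_mul]
    exact GradedSuperring.mul_mem _ _ _ _ hx hy

theorem phi_superComm (s : ℂ) {i j : ℤ} {x y : SD} (hx : x ∈ gr SD i) (hy : y ∈ gr SD j) :
    phi s (superComm x y) = superComm (phi s x) (phi s y) := by
  rw [superComm_apply hx hy, superComm_apply (phi_mem_gr.2 hx) (phi_mem_gr.2 hy), map_sub,
    map_smul, phi_mul, phi_mul]

/-- The supertrace `α⁰ - α¹` of a `2 × 2` matrix. -/
def str₂ (M : Matrix (Fin 2) (Fin 2) ℂ) : ℂ := M 0 0 - M 1 1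

/-- `Str (F(j) G(j + r))`. -/
def strEval (r : ℤ) (F G : Matrix (Fin 2) (Fin 2) ℂ[X]) (j : ℤ) : ℂ :=
  str₂ (F.map (Polynomial.eval (j : ℂ)) * G.map (Polynomial.eval ((j : ℂ) + r)))

theorem strEval_eq (r : ℤ) (F G : Matrix (Fin 2) (Fin 2) ℂ[X]) (j : ℤ) : strEval r F G j =
    (F 0 0).eval (j : ℂ) * (G 0 0).eval ((j : ℂ) + r) +
    (F 0 1).eval (j : ℂ) * (G 1 0).eval ((j : ℂ) + r) -
    (F 1 0).eval (j : ℂ) * (G 0 1).eval ((j : ℂ) + r) -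
    (F 1 1).eval (j : ℂ) * (G 1 1).eval ((j : ℂ) + r) := by
  simp only [strEval, str₂, Matrix.mul_apply, Fin.sum_univ_two, Matrix.map_apply]
  ring

/-- The value `Ψ(t^r F(D), t^{-r} G(D))`: it is `∑_{-r ≤ j ≤ -1} Str (F(j) G(j + r))` if `r ≥ 0` (the
second sum is empty then), and the values for `r < 0` are those forced by skew-supersymmetry. -/
def psiTerm (r : ℤ) :
    Matrix (Fin 2) (Fin 2) ℂ[X] →ₗ[ℂ] Matrix (Fin 2) (Fin 2) ℂ[X] →ₗ[ℂ] ℂ :=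
  LinearMap.mk₂ ℂ
    (fun F G => ∑ j ∈ Finset.Ico (-r) 0, strEval r F G j - ∑ j ∈ Finset.Ico 0 (-r), strEval r F G j)
    (fun F F' G => by
      have : ∀ j, strEval r (F + F') G j = strEval r F G j + strEval r F' G j := fun j => by
        simp only [strEval_eq, Matrix.add_apply, eval_add]; ring
      simp only [this, Finset.sum_add_distrib]; ring)
    (fun c F G => by
      have : ∀ j, strEval r (c • F) G j = c * strEval r F G j := fun j => by
        simp only [strEval_eq, Matrix.smul_apply, eval_smul, smul_eq_mul]; ring
      simp only [this, ← Finset.mul_sum, smul_eq_mul]; ring)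
    (fun F G G' => by
      have : ∀ j, strEval r F (G + G') j = strEval r F G j + strEval r F G' j := fun j => by
        simp only [strEval_eq, Matrix.add_apply, eval_add]; ring
      simp only [this, Finset.sum_add_distrib]; ring)
    (fun c F G => by
      have : ∀ j, strEval r F (c • G) j = c * strEval r F G j := fun j => by
        simp only [strEval_eq, Matrix.smul_apply, eval_smul, smul_eq_mul]; ring
      simp only [this, ← Finset.mul_sum, smul_eq_mul]; ring)

/-- The two-cocycle `Ψ`, with `Ψ(t^r F(D), t^s G(D)) = 0` for `r + s ≠ 0`. -/
def psi : SD →ₗ[ℂ] SD →ₗ[ℂ] ℂ := ofTerms fun r => (psiTerm r).compl₂ (coeff (-r))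

theorem finsum_idx {f : ℤ → ℂ} {K : ℤ} (hf : ∀ m, ¬(-K < idx m ∧ idx m ≤ K) → f m = 0) :
    ∑ᶠ m, f m = ∑ p ∈ Finset.Ioc (-K) K, (f (2 * p) + f (2 * p - 1)) := by
  have h1 : ∑ᶠ m, f m = ∑ m ∈ Finset.Ioc (-(2 * K)) (2 * K), f m := by
    apply finsum_eq_sum_of_support_subset
    intro m hm
    by_contra h
    apply hm
    apply hf
    intro h'
    apply h
    rw [Finset.mem_coe, Finset.mem_Ioc]
    unfold idx at h'
    omega
  rw [h1]
  have h2 : ∀ p, f (2 * p) + f (2 * p - 1) = ∑ a : Fin 2, f (2 * p - (a : ℕ)) := by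
    intro p; rw [Fin.sum_univ_two]; simp
  simp only [h2]
  rw [← Finset.sum_product']
  symm
  refine Finset.sum_nbij' (fun x => 2 * x.1 - ((x.2 : ℕ) : ℤ)) (fun m => (idx m, par m)) ?_ ?_ ?_ ?_ ?_
  · rintro ⟨p, a⟩ h
    simp only [Finset.mem_product, Finset.mem_Ioc, Finset.mem_univ, and_true] at h
    have := a.2
    rw [Finset.mem_Ioc]
    dsimp only
    omega
  · intro m h
    rw [Finset.mem_Ioc] at h
    simp only [Finset.mem_product, Finset.mem_Ioc, Finset.mem_univ, and_true]
    unfold idx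
    omega
  · rintro ⟨p, a⟩ _
    exact Prod.ext (idx_eq p a) (par_eq p a)
  · intro m _
    exact (exists_idx m).symm
  · intro x _; rfl

theorem nonpos_iff (m : ℤ) : m ≤ 0 ↔ idx m ≤ 0 := by unfold idx; omega

theorem commJ_phi_mul_apply (r u : ℤ) (F G : Matrix (Fin 2) (Fin 2) ℂ[X]) (m : ℤ) :
    (Gl.commJ (phi 0 (term r F)) * phi 0 (term u G)).1 m m =
      if u = -r then ((if idx m ≤ 0 then 1 else 0) - (if idx m + r ≤ 0 then 1 else 0)) *
        ((F (par m) 0).eval (-((idx m : ℂ) + r)) * (G 0 (par m)).eval (-(idx m : ℂ)) +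
          (F (par m) 1).eval (-((idx m : ℂ) + r)) * (G 1 (par m)).eval (-(idx m : ℂ))) else 0 := by
  have hc : ∀ (A : Gl) (m n : ℤ), (Gl.commJ A).1 m n =
      ((if idx m ≤ 0 then 1 else 0) - (if idx n ≤ 0 then 1 else 0)) * A.1 m n := by
    intro A m n
    rw [Gl.commJ_apply, if_congr (nonpos_iff m) rfl rfl, if_congr (nonpos_iff n) rfl rfl]
  rw [Gl.mul_apply]
  simp only [hc, phi_apply, coeff_term]
  by_cases hu : u = -r
  · rw [if_pos hu]
    set l := idx m + r with hl
    have hsub : (Function.support fun k => ((if idx m ≤ 0 then 1 else 0) -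
        (if idx k ≤ 0 then 1 else 0)) * Polynomial.eval (-(idx k : ℂ) + 0)
        ((if r = idx k - idx m then F else 0) (par m) (par k)) * Polynomial.eval (-(idx m : ℂ) + 0)
        ((if u = idx m - idx k then G else 0) (par k) (par m))) ⊆
        (({2 * l, 2 * l - 1} : Finset ℤ) : Set ℤ) := by
      intro k hk
      have h1 : r = idx k - idx m := by
        by_contra h
        apply hk
        simp [h]
      have h2 := exists_idx k
      have h3 : idx k = l := by omega
      rw [h3] at h2
      simp only [Finset.coe_insert, Finset.coe_singleton, Set.mem_insert_iff,
        Set.mem_singleton_iff]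
      have := (par k).2
      omega
    rw [finsum_eq_sum_of_support_subset _ hsub, Finset.sum_pair (by omega)]
    simp only [idx_two_mul, idx_two_mul_sub, par_two_mul, par_two_mul_sub, add_zero]
    rw [if_pos (by omega : r = l - idx m), if_pos (by omega : u = idx m - l)]
    have : (l : ℂ) = (idx m : ℂ) + r := by rw [hl]; push_cast; ring
    rw [this]
    ring
  · rw [if_neg hu]
    refine finsum_eq_zero_of_forall_eq_zero fun k => ?_
    by_cases h1 : r = idx k - idx m
    · rw [if_neg (by omega : ¬ u = idx m - idx k)]; simp
    · rw [if_neg h1]; simp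

theorem sum_window (r : ℤ) (T : ℤ → ℂ) :
    ∑ p ∈ Finset.Ioc (-|r|) |r|,
      (((if p ≤ 0 then 1 else 0) - (if p + r ≤ 0 then 1 else 0)) * T (-(p + r)) : ℂ) =
    ∑ j ∈ Finset.Ico (-r) 0, T j - ∑ j ∈ Finset.Ico 0 (-r), T j := by
  rcases le_total 0 r with h | h
  · rw [abs_of_nonneg h, Finset.Ico_eq_empty (by omega : ¬ (0 : ℤ) < -r), Finset.sum_empty, sub_zero]
    rw [← Finset.sum_subset (s₁ := Finset.Ioc (-r) 0) (Finset.Ioc_subset_Ioc le_rfl h)]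
    · refine Finset.sum_nbij' (fun p => -(p + r)) (fun j => -(j + r)) ?_ ?_ ?_ ?_ ?_
      · intro p hp; rw [Finset.mem_Ioc] at hp; rw [Finset.mem_Ico]; omega
      · intro p hp; rw [Finset.mem_Ico] at hp; rw [Finset.mem_Ioc]; omega
      · intro p _; ring
      · intro p _; ring
      · intro p hp
        rw [Finset.mem_Ioc] at hp
        rw [if_pos hp.2, if_neg (by omega)]; ring
    · intro p hp hp'
      rw [Finset.mem_Ioc] at hp hp'
      rw [if_neg (by omega), if_neg (by omega)]; ring
  · rw [abs_of_nonpos h, Finset.Ico_eq_empty (by omega : ¬ -r < (0 : ℤ)), Finset.sum_empty, zero_sub]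
    rw [← Finset.sum_subset (s₁ := Finset.Ioc 0 (-r)) (Finset.Ioc_subset_Ioc (by omega) le_rfl),
      ← Finset.sum_neg_distrib]
    · refine Finset.sum_nbij' (fun p => -(p + r)) (fun j => -(j + r)) ?_ ?_ ?_ ?_ ?_
      · intro p hp; rw [Finset.mem_Ioc] at hp; rw [Finset.mem_Ico]; omega
      · intro p hp; rw [Finset.mem_Ico] at hp; rw [Finset.mem_Ioc]; omega
      · intro p _; ring
      · intro p _; ring
      · intro p hp
        rw [Finset.mem_Ioc] at hp
        rw [if_neg (by omega), if_pos (by omega)]; ring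
    · intro p hp hp'
      rw [Finset.mem_Ioc] at hp hp'
      rw [if_pos (by omega), if_pos (by omega)]; ring

theorem alpha_phi_term (r u : ℤ) (F G : Matrix (Fin 2) (Fin 2) ℂ[X]) :
    Gl.alpha (phi 0 (term r F)) (phi 0 (term u G)) = psi (term r F) (term u G) := by
  rw [psi, ofTerms_term, LinearMap.compl₂_apply, coeff_term, Gl.alpha_apply, Gl.str]
  simp only [commJ_phi_mul_apply]
  by_cases hu : u = -r
  · simp only [if_pos hu]
    rw [finsum_idx (K := |r|)]
    · rw [psiTerm, LinearMap.mk₂_apply, ← sum_window]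
      refine Finset.sum_congr rfl fun p _ => ?_
      have o1 : parSign (2 * p) = 1 := by simp [parSign]
      have o2 : parSign (2 * p - 1) = -1 := by
        have : Odd (2 * p - 1) := ⟨p - 1, by ring⟩
        simp [parSign, this]
      simp only [idx_two_mul, idx_two_mul_sub, par_two_mul, par_two_mul_sub, o1, o2, strEval_eq]
      have e1 : ((-(p + r) : ℤ) : ℂ) = -((p : ℂ) + r) := by push_cast; ring
      have e2 : -((p : ℂ) + r) + r = -(p : ℂ) := by ring
      rw [e1, e2]
      ring
    · intro m hm
      have : ((if idx m ≤ 0 then 1 else 0) - (if idx m + r ≤ 0 then 1 else 0) : ℂ) = 0 := by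
        have h1 := le_abs_self r
        have h2 := neg_abs_le r
        by_cases h : idx m ≤ 0
        · rw [if_pos h, if_pos (by omega)]; ring
        · rw [if_neg h, if_neg (by omega)]; ring
      rw [this]; ring
  · simp only [if_neg hu, map_zero]
    exact finsum_eq_zero_of_forall_eq_zero fun _ => mul_zero _

theorem alpha_phi (x y : SD) : Gl.alpha (phi 0 x) (phi 0 y) = psi x y := by
  refine SD.induction (p := fun x => Gl.alpha (phi 0 x) (phi 0 y) = psi x y) x ?_ ?_ ?_
  · simp only [map_zero, LinearMap.zero_apply]
  · intro x x' h h'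
    rw [map_add, map_add, map_add, LinearMap.add_apply, LinearMap.add_apply, h, h']
  · intro r F
    refine SD.induction (p := fun y => Gl.alpha (phi 0 (term r F)) (phi 0 y) = psi (term r F) y)
      y ?_ ?_ ?_
    · simp only [map_zero]
    · intro x x' h h'
      rw [map_add, map_add, map_add, h, h']
    · intro u G
      exact alpha_phi_term r u F G

/-- The two-cocycle `Ψ` of `SD`. -/
def cocycle : SuperCocycle SD where
  toFun := psi
  degree i j x y hx hy h := by
    rw [← alpha_phi]
    exact Gl.cocycle.degree i j _ _ (phi_mem_gr.2 hx) (phi_mem_gr.2 hy) h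
  skew i j x y hx hy := by
    rw [← alpha_phi, ← alpha_phi]
    exact Gl.cocycle.skew i j _ _ (phi_mem_gr.2 hx) (phi_mem_gr.2 hy)
  cocycle i j k x y z hx hy hz := by
    rw [← alpha_phi, ← alpha_phi, ← alpha_phi, phi_superComm 0 hy hz, phi_superComm 0 hx hy,
      phi_superComm 0 hx hz]
    exact Gl.cocycle.cocycle i j k _ _ _ (phi_mem_gr.2 hx) (phi_mem_gr.2 hy) (phi_mem_gr.2 hz)

end SD

/-- The central extension of the Lie superalgebra of differential operators on the super circle. -/
abbrev SDHat : Type := CentralExt SD.cocycle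

namespace Gl

/-- The form on the basis `(e_i)_{i ∈ ½ℤ}`: `(e_i|e_j) = (-1)^i δ_{i,-j}` for `i, j ∈ ℤ`,
`(e_r|e_s) = (-1)^{r+1/2} δ_{r,-s}` for `r, s ∈ ½ + ℤ`, and `(e_i|e_r) = 0`. -/
def form (m n : ℤ) : ℂ := if m + n = 0 then parSign (SD.idx m) else 0

/-- The subspace of `gl_{∞|∞}` preserving the form: the matrices `T` with
`(T v|w) = -(-1)^{|T||v|} (v|T w)`.  For the basis vectors `v = e_a`, `w = e_b` only the part of `T`
of the parity of `a + b` matters. -/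
def ospSubspace : Submodule ℂ Gl where
  carrier := {T | ∀ a b : ℤ, ∑ᶠ m, T.1 m a * form m b =
    -(superSign (a + b) a * ∑ᶠ m, form a m * T.1 m b)}
  add_mem' := by
    intro T T' hT hT' a b
    have e1 : ∀ T : Gl, ∑ᶠ m, T.1 m a * form m b = T.1 (-b) a * form (-b) b := fun T =>
      finsum_eq_single _ _ fun m hm => by
        rw [form, if_neg (fun h => hm (by omega)), mul_zero]
    have e2 : ∀ T : Gl, ∑ᶠ m, form a m * T.1 m b = form a (-a) * T.1 (-a) b := fun T =>
      finsum_eq_single _ _ fun m hm => by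
        rw [form, if_neg (fun h => hm (by omega)), zero_mul]
    have h1 := hT a b
    have h2 := hT' a b
    rw [e1, e2] at h1 h2 ⊢
    change (T.1 (-b) a + T'.1 (-b) a) * _ = -(_ * (_ * (T.1 (-a) b + T'.1 (-a) b)))
    linear_combination h1 + h2
  zero_mem' := by
    intro a b
    change ∑ᶠ m, (0 : ℂ) * form m b = -(_ * ∑ᶠ m, form a m * (0 : ℂ))
    simp
  smul_mem' := by
    intro c T hT a b
    have h1 := hT a b
    change ∑ᶠ m, (c * T.1 m a) * form m b = -(_ * ∑ᶠ m, form a m * (c * T.1 m b))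
    have e1 : ∑ᶠ m, (c * T.1 m a) * form m b = c * ∑ᶠ m, T.1 m a * form m b := by
      rw [← smul_eq_mul c, smul_finsum]
      exact finsum_congr fun m => by rw [smul_eq_mul]; ring
    have e2 : ∑ᶠ m, form a m * (c * T.1 m b) = c * ∑ᶠ m, form a m * T.1 m b := by
      rw [← smul_eq_mul c (∑ᶠ m, _), smul_finsum]
      exact finsum_congr fun m => by rw [smul_eq_mul]; ring
    rw [e1, e2, h1]; ring

/-- The anti-involution of `gl_{∞|∞}` attached to the form. -/
def tau : Gl →ₗ[ℂ] Gl where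
  toFun T := ⟨fun m n => superSign (n - m) n * parSign (SD.idx m) * parSign (SD.idx n) *
      T.1 (-n) (-m), by
    obtain ⟨N, hN⟩ := T.2
    refine ⟨N, fun m n h => ?_⟩
    dsimp only
    rw [hN (-n) (-m) (by rwa [show -n - -m = m - n by ring]), mul_zero]⟩
  map_add' T T' := ext fun m n => mul_add _ (T.1 (-n) (-m)) (T'.1 (-n) (-m))
  map_smul' c T := ext fun m n => mul_left_comm _ c (T.1 (-n) (-m))

theorem tau_apply (T : Gl) (m n : ℤ) : (tau T).1 m n =
    superSign (n - m) n * parSign (SD.idx m) * parSign (SD.idx n) * T.1 (-n) (-m) := rfl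

theorem parSign_mul_self (n : ℤ) : parSign n * parSign n = 1 := by
  unfold parSign; split_ifs <;> norm_num

theorem parSign_neg (n : ℤ) : parSign (-n) = parSign n := by
  unfold parSign; simp

theorem mem_ospSubspace {T : Gl} : T ∈ ospSubspace ↔ tau T = -T := by
  have e1 : ∀ a b : ℤ, ∑ᶠ m, T.1 m a * form m b = T.1 (-b) a * parSign (SD.idx (-b)) := by
    intro a b
    rw [finsum_eq_single _ (-b) fun m hm => by
      rw [form, if_neg (fun h => hm (by omega)), mul_zero]]
    rw [form, if_pos (by omega)]
  have e2 : ∀ a b : ℤ, ∑ᶠ m, form a m * T.1 m b = parSign (SD.idx a) * T.1 (-a) b := by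
    intro a b
    rw [finsum_eq_single _ (-a) fun m hm => by
      rw [form, if_neg (fun h => hm (by omega)), zero_mul]]
    rw [form, if_pos (by omega)]
  constructor
  · intro h
    refine ext fun m n => ?_
    change _ = -(T.1 m n)
    have h1 := h n (-m)
    rw [e1, e2, neg_neg] at h1
    have h2 := parSign_mul_self (SD.idx m)
    rw [tau_apply, sub_eq_add_neg]
    linear_combination parSign (SD.idx m) * h1 - T.1 m n * h2
  · intro h a b
    have h1 : (tau T).1 (-b) a = -(T.1 (-b) a) := by rw [h]; rfl
    have h2 := parSign_mul_self (SD.idx (-b))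
    rw [tau_apply, neg_neg, sub_neg_eq_add] at h1
    rw [e1, e2]
    linear_combination parSign (SD.idx (-b)) * h1 -
      superSign (a + b) a * parSign (SD.idx a) * T.1 (-a) b * h2

theorem tau_mul {i j : ℤ} {X Y : Gl} (hX : X ∈ gr Gl i) (hY : Y ∈ gr Gl j) :
    tau (X * Y) = superSign i j • (tau Y * tau X) := by
  rw [mem_gr] at hX hY
  refine ext fun m n => ?_
  change _ = superSign i j * (tau Y * tau X).1 m n
  rw [tau_apply, mul_apply, mul_apply, ← smul_eq_mul (superSign i j), ← smul_eq_mul, smul_finsum,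
    smul_finsum, ← finsum_comp_equiv (Equiv.neg ℤ)]
  refine finsum_congr fun k => ?_
  simp only [Equiv.neg_apply, tau_apply, smul_eq_mul]
  by_cases h1 : -k - -n = i
  · by_cases h2 : -m - -k = j
    · have h3 := parSign_mul_self (SD.idx k)
      have h4 : superSign i j * superSign (k - m) k * superSign (n - k) n = superSign (n - m) n := by
        obtain rfl : i = n - k := by omega
        obtain rfl : j = k - m := by omega
        unfold superSign
        by_cases o1 : Odd k <;> by_cases o2 : Odd m <;> by_cases o3 : Odd n <;>
          simp [o1, o2, o3, Int.odd_sub, ← Int.not_odd_iff_even]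
      rw [← h4]
      linear_combination (-(superSign i j * superSign (k - m) k * superSign (n - k) n) *
        parSign (SD.idx m) * parSign (SD.idx n) * X.1 (-n) (-k) * Y.1 (-k) (-m)) * h3
    · rw [hY (-k) (-m) h2]; ring
  · rw [hX (-n) (-k) h1]; ring

theorem comp_tau (i : ℤ) (T : Gl) : HalfGraded.comp i (tau T) = tau (HalfGraded.comp i T) := by
  refine ext fun m n => ?_
  change (if n - m = i then (tau T).1 m n else 0) = _ * (if -m - -n = i then T.1 (-n) (-m) else 0)
  rw [tau_apply, show -m - -n = n - m by ring]
  split_ifs <;> simp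

theorem tau_mem_gr {i : ℤ} {T : Gl} (hT : T ∈ gr Gl i) : tau T ∈ gr Gl i := by
  rw [SuperCircle.mem_gr] at *
  rw [comp_tau, hT]

theorem tau_superComm {i j : ℤ} {X Y : Gl} (hX : X ∈ gr Gl i) (hY : Y ∈ gr Gl j) :
    tau (superComm X Y) = -superComm (tau X) (tau Y) := by
  rw [superComm_apply hX hY, superComm_apply (tau_mem_gr hX) (tau_mem_gr hY), map_sub, map_smul,
    tau_mul hX hY, tau_mul hY hX, smul_smul, superSign_mul_self, one_smul, neg_sub]

end Gl

/-- The central extension of the Lie superalgebra `B` of type `OSP`: the subalgebra of the central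
extension of `gl_{∞|∞}` lying over the subspace of `gl_{∞|∞}` preserving the form. -/
def bHat : GradedSubalgebra GlHat where
  carrier := Gl.ospSubspace.comap (CentralExt.base Gl.cocycle)
  comp_mem i x hx := by
    rw [Submodule.mem_comap, Gl.mem_ospSubspace] at *
    change Gl.tau (HalfGraded.comp i (CentralExt.base Gl.cocycle x)) =
      -HalfGraded.comp i (CentralExt.base Gl.cocycle x)
    rw [← Gl.comp_tau, hx, map_neg]
  bracket_mem := by
    refine bracket_mem_of_homogeneous ?_ ?_
    · intro i x hx
      rw [Submodule.mem_comap, Gl.mem_ospSubspace] at *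
      change Gl.tau (HalfGraded.comp i (CentralExt.base Gl.cocycle x)) =
        -HalfGraded.comp i (CentralExt.base Gl.cocycle x)
      rw [← Gl.comp_tau, hx, map_neg]
    · intro i j x y hx hy hi hj
      rw [Submodule.mem_comap, Gl.mem_ospSubspace] at *
      rw [CentralExt.mem_gr] at hi hj
      change Gl.tau (superComm (CentralExt.base Gl.cocycle x) (CentralExt.base Gl.cocycle y)) =
        -superComm (CentralExt.base Gl.cocycle x) (CentralExt.base Gl.cocycle y)
      rw [Gl.tau_superComm hi.1 hj.1, hx, hy, map_neg, map_neg, LinearMap.neg_apply, neg_neg]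

/-- The Lie superalgebra underlying `bHat`. -/
abbrev BHat : Type := bHat.carrier

namespace SD

/-- The substitution `f(D) ↦ f(-D + a)`. -/
def reflect (a : ℂ) : ℂ[X] →ₐ[ℂ] ℂ[X] := aeval (-X + C a)

/-- The anti-involution of `SD` with `t ↦ -t`, `D ↦ -D - 1 + ∂_θ θ`, `θ ↦ t ∂_θ` and
`∂_θ ↦ -t⁻¹ θ`.  Explicitly,
`t^k f(D) ∂_θ θ ↦ (-1)^k t^k f(-D - k) ∂_θ θ`, `t^k f(D) θ ∂_θ ↦ (-1)^k t^k f(-D - k - 1) θ ∂_θ`,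
`t^k f(D) θ ↦ (-1)^k t^{k+1} f(-D - k - 1) ∂_θ`, `t^k f(D) ∂_θ ↦ (-1)^{k-1} t^{k-1} f(-D - k) θ`. -/
def sigma : SD →ₗ[ℂ] SD := ofTerms fun k => parSign k •
  { toFun := fun F =>
      term k !![reflect (-k) (F 0 0), 0; 0, reflect (-k - 1) (F 1 1)] +
      term (k + 1) !![0, reflect (-k - 1) (F 1 0); 0, 0] -
      term (k - 1) !![0, 0; reflect (-k) (F 0 1), 0]
    map_add' := fun F G => by
      refine ext fun l a b => ?_
      simp only [map_add, map_sub, coeff_term, Matrix.add_apply, Matrix.sub_apply]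
      fin_cases a <;> fin_cases b <;> simp <;> split_ifs <;> simp <;> ring
    map_smul' := fun c F => by
      refine ext fun l a b => ?_
      simp only [map_add, map_sub, map_smul, coeff_term, Matrix.add_apply, Matrix.sub_apply,
        Matrix.smul_apply, RingHom.id_apply]
      fin_cases a <;> fin_cases b <;> simp <;> split_ifs <;> simp }

theorem sigma_term (k : ℤ) (F : Matrix (Fin 2) (Fin 2) ℂ[X]) : sigma (term k F) = parSign k •
    (term k !![reflect (-k) (F 0 0), 0; 0, reflect (-k - 1) (F 1 1)] +
      term (k + 1) !![0, reflect (-k - 1) (F 1 0); 0, 0] -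
      term (k - 1) !![0, 0; reflect (-k) (F 0 1), 0]) := by
  rw [sigma, ofTerms_term]; rfl

theorem eval_reflect (a z : ℂ) (f : ℂ[X]) : (reflect a f).eval z = f.eval (-z + a) := by
  rw [reflect, Polynomial.aeval_def, Polynomial.eval₂_eq_sum_range, Polynomial.eval_finsetSum,
    Polynomial.eval_eq_sum_range]
  refine Finset.sum_congr rfl fun i _ => ?_
  simp only [Polynomial.algebraMap_eq, eval_mul, eval_C, eval_pow, eval_add, eval_neg, eval_X]

theorem parSign_add (m n : ℤ) : parSign (m + n) = parSign m * parSign n := by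
  unfold parSign
  by_cases h1 : Odd m <;> by_cases h2 : Odd n <;>
    simp [h1, h2, Int.odd_add, ← Int.not_odd_iff_even]

theorem phi_sigma (x : SD) : phi 0 (sigma x) = Gl.tau (phi 0 x) := by
  refine SD.induction (p := fun x => phi 0 (sigma x) = Gl.tau (phi 0 x)) x ?_ ?_ ?_
  · simp only [map_zero]
  · intro x y hx hy
    rw [map_add, map_add, hx, hy, map_add, map_add]
  · intro k F
    refine Gl.ext fun m n => ?_
    have n1 : ∀ p : ℤ, idx (-(2 * p)) = -p := fun p => by unfold idx; omega
    have n2 : ∀ p : ℤ, idx (-(2 * p - 1)) = 1 - p := fun p => by unfold idx; omega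
    have p1 : ∀ p : ℤ, par (-(2 * p)) = 0 := fun p => by simp [par]
    have p2 : ∀ p : ℤ, par (-(2 * p - 1)) = 1 := fun p => by
      have : Odd (-(2 * p - 1)) := ⟨-p, by ring⟩
      unfold par; rw [if_pos this]
    have o1 : ∀ p : ℤ, ¬ Odd (2 * p) := fun p => by simp
    have o2 : ∀ p : ℤ, Odd (2 * p - 1) := fun p => ⟨p - 1, by ring⟩
    have hps : ∀ p q : ℤ, parSign (q - p) = parSign p * parSign q := fun p q => by
      rw [sub_eq_add_neg, parSign_add, Gl.parSign_neg, mul_comm]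
    have s1 : parSign 1 = -1 := by simp [parSign]
    rw [Gl.tau_apply, phi_apply, phi_apply, sigma_term, coeff_term]
    simp only [map_add, map_sub, map_smul, coeff_term, Matrix.add_apply, Matrix.sub_apply,
      Matrix.smul_apply, eval_smul, eval_add, eval_sub, smul_eq_mul]
    obtain ⟨p, rfl | rfl⟩ : ∃ p : ℤ, m = 2 * p ∨ m = 2 * p - 1 := ⟨idx m, by unfold idx; omega⟩ <;>
    obtain ⟨q, rfl | rfl⟩ : ∃ q : ℤ, n = 2 * q ∨ n = 2 * q - 1 := ⟨idx n, by unfold idx; omega⟩ <;>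
    simp only [n1, n2, p1, p2, idx_two_mul, idx_two_mul_sub, par_two_mul, par_two_mul_sub]
    · have hs : superSign (2 * q - 2 * p) (2 * q) = 1 := by simp [superSign]
      rw [hs]
      by_cases h : k = q - p
      · rw [if_pos h, if_neg (by omega : ¬ k + 1 = q - p), if_neg (by omega : ¬ k - 1 = q - p),
          if_pos (by omega : k = -p - -q), h, hps]
        simp [eval_reflect]
      · rw [if_neg h, if_neg (by omega : ¬ k = -p - -q)]
        split_ifs <;> simp
    · have hs : superSign (2 * q - 1 - 2 * p) (2 * q - 1) = -1 := by
        rw [superSign, if_pos ⟨⟨q - p - 1, by ring⟩, o2 q⟩]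
      rw [hs]
      by_cases h : k + 1 = q - p
      · rw [if_pos h, if_neg (by omega : ¬ k = q - p), if_neg (by omega : ¬ k - 1 = q - p),
          if_pos (by omega : k = -p - (1 - q)), show k = (q - p) + -1 by omega, parSign_add,
          Gl.parSign_neg, s1, hps]
        simp [eval_reflect]
      · rw [if_neg h, if_neg (by omega : ¬ k = -p - (1 - q))]
        split_ifs <;> simp
    · have hs : superSign (2 * q - (2 * p - 1)) (2 * q) = 1 := by simp [superSign]
      rw [hs]
      by_cases h : k - 1 = q - p
      · rw [if_pos h, if_neg (by omega : ¬ k = q - p), if_neg (by omega : ¬ k + 1 = q - p),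
          if_pos (by omega : k = 1 - p - -q), show k = (q - p) + 1 by omega, parSign_add, s1, hps]
        simp [eval_reflect]
        left; congr 1; ring
      · rw [if_neg h, if_neg (by omega : ¬ k = 1 - p - -q)]
        split_ifs <;> simp
    · have hs : superSign (2 * q - 1 - (2 * p - 1)) (2 * q - 1) = 1 := by
        rw [superSign, if_neg]
        rintro ⟨⟨a, ha⟩, -⟩
        omega
      rw [hs]
      by_cases h : k = q - p
      · rw [if_pos h, if_neg (by omega : ¬ k + 1 = q - p), if_neg (by omega : ¬ k - 1 = q - p),
          if_pos (by omega : k = 1 - p - (1 - q)), h, hps]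
        simp [eval_reflect]
        left; congr 1; ring
      · rw [if_neg h, if_neg (by omega : ¬ k = 1 - p - (1 - q))]
        split_ifs <;> simp

theorem sigma_mul {i j : ℤ} {x y : SD} (hx : x ∈ gr SD i) (hy : y ∈ gr SD j) :
    sigma (x * y) = superSign i j • (sigma y * sigma x) := by
  apply phi_injective 0
  rw [phi_sigma, phi_mul, Gl.tau_mul (phi_mem_gr.2 hx) (phi_mem_gr.2 hy), map_smul, phi_mul,
    phi_sigma, phi_sigma]

theorem sigma_generators : sigma (term 1 1) = -term 1 1 ∧
    sigma (term 0 (Matrix.diagonal fun _ => X)) =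
      -term 0 (Matrix.diagonal fun _ => X) - term 0 1 + term 0 (Matrix.single 0 0 1) ∧
    sigma (term 0 (Matrix.single 1 0 1)) = term 1 (Matrix.single 0 1 1) ∧
    sigma (term 0 (Matrix.single 0 1 1)) = -term (-1) (Matrix.single 1 0 1) := by
  refine ⟨?_, ?_, ?_, ?_⟩ <;>
  · rw [sigma_term]
    refine ext fun l a b => ?_
    simp only [map_smul, map_add, map_sub, map_neg, coeff_term]
    fin_cases a <;> fin_cases b <;> simp [parSign, reflect] <;> split_ifs <;> simp <;> ring

theorem sigma_eq_neg_iff {x : SD} : sigma x = -x ↔ phi 0 x ∈ Gl.ospSubspace := by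
  rw [Gl.mem_ospSubspace, ← phi_sigma, ← map_neg, (phi_injective 0).eq_iff]

theorem comp_phi (s : ℂ) (i : ℤ) (x : SD) :
    phi s (HalfGraded.comp i x) = HalfGraded.comp i (phi s x) := by
  obtain ⟨S, hS⟩ := HalfGraded.exists_eq_sum x
  have h : ∀ j, HalfGraded.comp i (phi s (HalfGraded.comp j x)) =
      phi s (HalfGraded.comp i (HalfGraded.comp j x)) := by
    intro j
    have h1 : phi s (HalfGraded.comp j x) ∈ gr Gl j := phi_mem_gr.2 ⟨x, rfl⟩
    rw [SuperCircle.mem_gr] at h1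
    rw [HalfGraded.comp_comp, ← h1, HalfGraded.comp_comp, h1]
    split_ifs <;> simp
  conv_rhs => rw [hS, map_sum, map_sum]
  conv_lhs => rw [hS, map_sum, map_sum]
  exact Finset.sum_congr rfl fun j _ => (h j).symm

end SD

/-- The subalgebra of fixed points `{x : σ(x) = -x}`, with its central extension: the subalgebra of
`SDHat` lying over `{x ∈ SD : σ(x) = -x}`. -/
def zeroSDHat : GradedSubalgebra SDHat where
  carrier := (LinearMap.ker (SD.sigma + LinearMap.id)).comap (CentralExt.base SD.cocycle)
  comp_mem i x hx := by
    rw [Submodule.mem_comap, LinearMap.mem_ker, LinearMap.add_apply, LinearMap.id_apply,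
      add_eq_zero_iff_eq_neg, SD.sigma_eq_neg_iff] at *
    change SD.phi 0 (HalfGraded.comp i (CentralExt.base SD.cocycle x)) ∈ _
    rw [Gl.mem_ospSubspace] at *
    rw [SD.comp_phi, ← Gl.comp_tau, hx, map_neg]
  bracket_mem := by
    refine bracket_mem_of_homogeneous ?_ ?_
    · intro i x hx
      rw [Submodule.mem_comap, LinearMap.mem_ker, LinearMap.add_apply, LinearMap.id_apply,
        add_eq_zero_iff_eq_neg, SD.sigma_eq_neg_iff] at *
      change SD.phi 0 (HalfGraded.comp i (CentralExt.base SD.cocycle x)) ∈ _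
      rw [Gl.mem_ospSubspace] at *
      rw [SD.comp_phi, ← Gl.comp_tau, hx, map_neg]
    · intro i j x y hx hy hi hj
      rw [Submodule.mem_comap, LinearMap.mem_ker, LinearMap.add_apply, LinearMap.id_apply,
        add_eq_zero_iff_eq_neg, SD.sigma_eq_neg_iff] at *
      rw [CentralExt.mem_gr] at hi hj
      change SD.phi 0 (superComm (CentralExt.base SD.cocycle x) (CentralExt.base SD.cocycle y)) ∈ _
      rw [Gl.mem_ospSubspace] at *
      rw [SD.phi_superComm 0 hi.1 hj.1,
        Gl.tau_superComm (SD.phi_mem_gr.2 hi.1) (SD.phi_mem_gr.2 hj.1), hx, hy, map_neg, map_neg,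
        LinearMap.neg_apply, neg_neg]

/-- The Lie superalgebra underlying `zeroSDHat`. -/
abbrev ZeroSDHat : Type := zeroSDHat.carrier

theorem mem_zeroSDHat {x : SDHat} : x ∈ zeroSDHat.carrier ↔
    SD.sigma (CentralExt.base SD.cocycle x) = -CentralExt.base SD.cocycle x := by
  change CentralExt.base SD.cocycle x ∈ LinearMap.ker (SD.sigma + LinearMap.id) ↔ _
  rw [LinearMap.mem_ker, LinearMap.add_apply, LinearMap.id_apply, add_eq_zero_iff_eq_neg]

/-! ## The homomorphisms to the central extensions -/

namespace SD

/-- The solution `h` of `h(w) - h(w + 1) = f(w)` given by Bernoulli polynomials; it inverts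
`1 - (D ↦ D + 1)` modulo constants. -/
def antidiff : ℂ[X] →ₗ[ℂ] ℂ[X] :=
  (Polynomial.basisMonomials ℂ).constr ℂ fun n =>
    -((n : ℂ) + 1)⁻¹ • (Polynomial.bernoulli (n + 1)).map (algebraMap ℚ ℂ)

theorem antidiff_sub_shift (f : ℂ[X]) : antidiff f - shift 1 (antidiff f) = f := by
  have h : antidiff - (shift 1).toLinearMap ∘ₗ antidiff = LinearMap.id := by
    refine (Polynomial.basisMonomials ℂ).ext fun n => ?_
    rw [LinearMap.sub_apply, LinearMap.comp_apply, antidiff, Module.Basis.constr_basis]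
    have hb := congrArg (Polynomial.map (algebraMap ℚ ℂ)) (bernoulli_comp_one_add_X (n + 1))
    rw [Polynomial.map_comp, Polynomial.map_add, Polynomial.map_add] at hb
    simp only [Polynomial.map_one, Polynomial.map_X, Nat.add_sub_cancel] at hb
    have hs : ∀ g : ℂ[X], (shift 1).toLinearMap g = g.comp (1 + X) := by
      intro g
      change aeval (X + C 1) g = _
      rw [Polynomial.aeval_def, add_comm X, C_1]; rfl
    rw [map_smul, hs, hb, ← smul_sub, sub_add_cancel_left, smul_neg, neg_smul, neg_neg]
    have hn : ((n : ℂ) + 1) ≠ 0 := Nat.cast_add_one_ne_zero n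
    rw [nsmul_eq_mul, Polynomial.map_mul, Polynomial.map_pow, Polynomial.map_X,
      Polynomial.map_natCast, LinearMap.id_apply, Polynomial.coe_basisMonomials]
    change _ = Polynomial.monomial n (1 : ℂ)
    rw [← Polynomial.C_mul_X_pow_eq_monomial, C_1, one_mul, Polynomial.smul_eq_C_mul, ← mul_assoc,
      ← Polynomial.C_eq_natCast, ← Polynomial.C_mul]
    push_cast
    rw [inv_mul_cancel₀ hn, C_1, one_mul]
  exact congrArg (fun g => g f) h

/-- The functional `Str_s ∘ (1 - (D ↦ D + 1))⁻¹` on `SD`, where `Str_s` sends `t^r F(D)` to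
`δ_{r,0} (F_0(s) - F_0(0) - F_1(s) + F_1(0))`. -/
def chi (s : ℂ) : SD →ₗ[ℂ] ℂ where
  toFun x := (antidiff (coeff 0 x 0 0)).eval s - (antidiff (coeff 0 x 0 0)).eval 0 -
    (antidiff (coeff 0 x 1 1)).eval s + (antidiff (coeff 0 x 1 1)).eval 0
  map_add' x y := by
    simp only [map_add, Matrix.add_apply, eval_add]; ring
  map_smul' c x := by
    simp only [map_smul, Matrix.smul_apply, eval_smul, smul_eq_mul, RingHom.id_apply]; ring

end SD

/-- The map from the central extension of `SD` to that of `gl_{∞|∞}`: it sends `x ∈ SD` to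
`φ_s(x) + Str_s((1 - (D ↦ D + 1))⁻¹ x) • 1` and the central generator `C` to `1`. -/
def phiHat (s : ℂ) : SDHat →ₗ[ℂ] GlHat := CentralExt.lift _ _ (SD.phi s) (SD.chi s)

/-- The restriction of `phiHat s` to the fixed point subalgebra. -/
def phiHatZero (s : ℂ) : ZeroSDHat →ₗ[ℂ] GlHat := (phiHat s).domRestrict zeroSDHat.carrier

/-- The restriction of `phiHat 0` to the fixed point subalgebra, as a map to `BHat`. -/
def phiHatB : ZeroSDHat →ₗ[ℂ] BHat :=
  (phiHatZero 0).codRestrict bHat.carrier fun x =>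
    SD.sigma_eq_neg_iff.1 (mem_zeroSDHat.1 x.2)

/-! ## Highest weights -/

/-- The diagonal entry at `a = n / 2`. -/
def diagEntry (n : ℤ) : GlHat →ₗ[ℂ] ℂ where
  toFun x := (CentralExt.base Gl.cocycle x).1 n n
  map_add' _ _ := rfl
  map_smul' _ _ := rfl

/-- The highest weight `Λ` of `GlHat` in the restricted dual of the Cartan subalgebra, with
`Λ(E_{aa}) = l_{2a}` (`a ∈ ½ℤ`) and `Λ(1) = c`. -/
def glWeight (l : ℤ →₀ ℂ) (c : ℂ) : Module.Dual ℂ (gr GlHat 0) :=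
  (l.sum (fun n a => a • diagEntry n) + c • CentralExt.coeff Gl.cocycle).domRestrict (gr GlHat 0)

/-- The highest weight `Λ` of `BHat` in the restricted dual of the Cartan subalgebra, with
`Λ(E_{aa} - E_{-a,-a}) = l_{2a}` (`a ∈ ½ℕ`, `a > 0`) and `Λ(1) = c`. -/
def bWeight (l : ℕ+ →₀ ℂ) (c : ℂ) : Module.Dual ℂ (gr BHat 0) :=
  ((l.sum (fun n a => a • diagEntry (n : ℤ)) + c • CentralExt.coeff Gl.cocycle).domRestrict
    bHat.carrier).domRestrict (gr BHat 0)

/-- The element `f(D) M_{aa}` of degree zero, `M_{00} = ∂_θ θ`, `M_{11} = θ ∂_θ`. -/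
def sdDiag (a : Fin 2) (f : ℂ[X]) : SDHat :=
  CentralExt.mk SD.cocycle (SD.term 0 (Matrix.single a a f)) 0

/-- The central generator `C`. -/
def sdC : SDHat := CentralExt.mk SD.cocycle 0 1

theorem sdDiag_mem (a : Fin 2) (f : ℂ[X]) : sdDiag a f ∈ gr SDHat 0 := by
  rw [CentralExt.mem_gr]
  refine ⟨?_, fun _ => rfl⟩
  rw [sdDiag, CentralExt.base_mk, SD.mem_gr]
  intro k p q h
  rw [SD.coeff_term]
  split_ifs with hk
  · subst hk
    rw [Matrix.single_apply, if_neg]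
    rintro ⟨rfl, rfl⟩
    simp at h
  · rfl

theorem sdC_mem : sdC ∈ gr SDHat 0 := by
  rw [CentralExt.mem_gr]
  exact ⟨Submodule.zero_mem _, fun h => absurd rfl h⟩

theorem sdC_mem_zero : sdC ∈ zeroSDHat.carrier := by
  rw [mem_zeroSDHat, sdC, CentralExt.base_mk, map_zero, neg_zero]

/-- The coefficient of `x^n` in `n! sinh (x p)`. -/
def sinhCoeff (p : ℂ[X]) (n : ℕ) : ℂ[X] := (1 / 2 : ℂ) • (p ^ n - (-p) ^ n)

theorem sinhCoeff_neg (p : ℂ[X]) (n : ℕ) : sinhCoeff (-p) n = -sinhCoeff p n := by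
  rw [sinhCoeff, sinhCoeff, neg_neg, ← smul_neg, neg_sub]

theorem map_sinhCoeff (φ : ℂ[X] →ₐ[ℂ] ℂ[X]) (p : ℂ[X]) (n : ℕ) :
    φ (sinhCoeff p n) = sinhCoeff (φ p) n := by
  simp only [sinhCoeff, map_smul, map_sub, map_pow, map_neg]

theorem sdDiag_mem_of_reflect {f : ℂ[X]} (h : SD.reflect 0 f = -f) :
    sdDiag 0 f ∈ zeroSDHat.carrier := by
  rw [mem_zeroSDHat, sdDiag, CentralExt.base_mk, SD.sigma_term, ← map_neg]
  refine SD.ext fun l a b => ?_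
  simp only [map_smul, map_add, map_sub, SD.coeff_term]
  fin_cases a <;> fin_cases b <;> simp [parSign] <;> split_ifs <;> simp [h]

theorem sdDiag_mem_of_reflect' {f : ℂ[X]} (h : SD.reflect (-1) f = -f) :
    sdDiag 1 f ∈ zeroSDHat.carrier := by
  rw [mem_zeroSDHat, sdDiag, CentralExt.base_mk, SD.sigma_term, ← map_neg]
  refine SD.ext fun l a b => ?_
  simp only [map_smul, map_add, map_sub, SD.coeff_term]
  fin_cases a <;> fin_cases b <;> simp [parSign] <;> split_ifs <;> simp [h]

theorem sdDiag_zero_mem (n : ℕ) : sdDiag 0 (sinhCoeff X n) ∈ zeroSDHat.carrier := by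
  apply sdDiag_mem_of_reflect
  rw [map_sinhCoeff, ← sinhCoeff_neg]
  simp [SD.reflect]

theorem sdDiag_one_mem (n : ℕ) : sdDiag 1 (sinhCoeff (X + C (1 / 2)) n) ∈ zeroSDHat.carrier := by
  apply sdDiag_mem_of_reflect'
  rw [map_sinhCoeff, ← sinhCoeff_neg]
  congr 1
  simp only [SD.reflect, map_add, aeval_X, aeval_C, Polynomial.algebraMap_eq]
  rw [neg_add, add_assoc, ← C_add, ← C_neg]
  congr 2
  norm_num

/-- The central generator of `SDHat`, in the component of degree zero. -/
def sdC₀ : gr SDHat 0 := ⟨sdC, sdC_mem⟩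

/-- The generating functions `Δ_0(x) = -ξ(e^{xD} ∂_θ θ)` (`a = 0`) and `Δ_1(x) = -ξ(e^{xD} θ ∂_θ)`
(`a = 1`) of a weight `ξ` of `SDHat`, as formal power series in `x`. -/
def sdDelta (ξ : Module.Dual ℂ (gr SDHat 0)) (a : Fin 2) : PowerSeries ℂ :=
  PowerSeries.mk fun n => -((n.factorial : ℂ)⁻¹ * ξ ⟨sdDiag a (X ^ n), sdDiag_mem a _⟩)

theorem mem_gr_zeroSDHat {x : SDHat} (hx : x ∈ zeroSDHat.carrier) (h : x ∈ gr SDHat 0) :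
    (⟨x, hx⟩ : ZeroSDHat) ∈ gr ZeroSDHat 0 :=
  (mem_gr_sub_iff zeroSDHat.carrier (fun _ _ => rfl)).2 h

/-- The central generator of `ZeroSDHat`, in the component of degree zero. -/
def zeroC₀ : gr ZeroSDHat 0 := ⟨⟨sdC, sdC_mem_zero⟩, mem_gr_zeroSDHat _ sdC_mem⟩

/-- The generating function `⁰Δ_0(x) = -ξ(sinh (x D) ∂_θ θ)` of a weight `ξ` of `ZeroSDHat`. -/
def zeroDelta₀ (ξ : Module.Dual ℂ (gr ZeroSDHat 0)) : PowerSeries ℂ :=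
  PowerSeries.mk fun n => -((n.factorial : ℂ)⁻¹ *
    ξ ⟨⟨sdDiag 0 (sinhCoeff X n), sdDiag_zero_mem n⟩, mem_gr_zeroSDHat _ (sdDiag_mem _ _)⟩)

/-- The generating function `⁰Δ_1(x) = -ξ(sinh (x (D + 1/2)) θ ∂_θ)` of a weight `ξ` of
`ZeroSDHat`. -/
def zeroDelta₁ (ξ : Module.Dual ℂ (gr ZeroSDHat 0)) : PowerSeries ℂ :=
  PowerSeries.mk fun n => -((n.factorial : ℂ)⁻¹ *
    ξ ⟨⟨sdDiag 1 (sinhCoeff (X + C (1 / 2)) n), sdDiag_one_mem n⟩,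
      mem_gr_zeroSDHat _ (sdDiag_mem _ _)⟩)

/-- The power series `e^{a x}`. -/
def expS (a : ℂ) : PowerSeries ℂ := PowerSeries.rescale a (PowerSeries.exp ℂ)

/-- The power series `sinh (a x)`. -/
def sinhS (a : ℂ) : PowerSeries ℂ := (1 / 2 : ℂ) • (expS a - expS (-a))

/-- The power series `cosh (a x)`. -/
def coshS (a : ℂ) : PowerSeries ℂ := (1 / 2 : ℂ) • (expS a + expS (-a))

end SuperCircle

end

open SuperCircle

/-! A pullback along a graded homomorphism keeps the highest weight vector and composes the weight
with the homomorphism. Two things remain: irreducibility and the generating functions.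

Irreducibility. The images of the differential operator algebras are much smaller than the matrix
algebras: along each diagonal the entries are values of polynomials. However, on a given vector `w`
an infinite matrix acts through finitely many rows only. Since `Λ` has finitely many nonzero labels,
matrices of degree zero supported in far rows and without central part kill the highest weight
vector `v`. By induction on the depth of the degree the same holds in every negative degree, because
otherwise `ρ x v` would be a nonzero singular vector of negative degree, which an irreducible module
does not have (`eq_zero_of_singular`). The vectors killed by far matrices form a submodule
containing `v`, hence the whole module (`exists_far_apply_eq_zero`). So it suffices to match a given
matrix on finitely many rows, with a width that does not depend on how many, and this is Lagrange
interpolation (`SD.exists_phi_eq`).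

For the fixed points of `-σ` one interpolates by `y - σ(y)`. The relation `φ_s ∘ σ = τ ∘ φ_{-s}`
(`SD.phi_sigma_eq_tau`) shows what its image is. If `2s` is not an integer, the evaluation points of
`φ_s` and `φ_{-s}` are disjoint, so `φ_s(y)` can be prescribed while `φ_{-s}(y)` vanishes on the
window, and all of `gl_{∞|∞}` is reached. If `s = 0` the two coincide, and exactly the matrices with
`τ(A) = -A` are approximated, by interpolating `A/2`.

Homomorphism. The cocycle `α` pulled back along `φ_s` differs from `Ψ` by the coboundary of `χ_s`
(`SD.alpha_phi_eq`); this is a telescoping sum.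

Generating functions. A functional `ℓ` on polynomials is determined by the series `ℓ(e^{xD})`. A
diagonal entry of `φ_s(e^{xD})` is an exponential, and the central correction gives the functional
`f ↦ h(s) - h(0)`, with series `(e^{sx} - 1)/(1 - e^x)` (`egf_antidiffEval`). The formulas for the
fixed points are odd parts of these, taken after a shift by one half in the `θ ∂_θ` component. All
identities are proved with denominators cleared and divided in Laurent series at the end. -/

noncomputable section

namespace SuperCircle

/-! ## Irreducible highest weight modules -/

section HighestWeight

variable {L : Type*} [AddCommGroup L] [Module ℂ L] [LieSuperalgebra L]
  {V : Type*} [AddCommGroup V] [Module ℂ V] {ρ : L →ₗ[ℂ] Module.End ℂ V}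

theorem comp_mem_gr {L : Type*} [AddCommGroup L] [Module ℂ L] [HalfGraded L] (i : ℤ) (x : L) :
    HalfGraded.comp i x ∈ gr L i := ⟨x, rfl⟩

/-- The vectors obtained from `u` by repeated action of elements of nonpositive degree. -/
inductive NonposOrbit (ρ : L →ₗ[ℂ] Module.End ℂ V) (u : V) : V → Prop
  | base : NonposOrbit ρ u u
  | step (i : ℤ) (x : L) (w : V) : i ≤ 0 → x ∈ gr L i → NonposOrbit ρ u w →
      NonposOrbit ρ u (ρ x w)

/-- A subspace stable under homogeneous elements is stable. -/
theorem apply_mem_of_homogeneous {W : Submodule ℂ V}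
    (h : ∀ i, ∀ x ∈ gr L i, ∀ w ∈ W, ρ x w ∈ W) (x : L) (w : V) (hw : w ∈ W) : ρ x w ∈ W := by
  obtain ⟨S, hS⟩ := HalfGraded.exists_eq_sum x
  rw [hS, map_sum, LinearMap.sum_apply]
  exact Submodule.sum_mem _ fun i _ => h i _ (comp_mem_gr i x) w hw

theorem apply_apply_of_map_bracket
    (hρ : ∀ i j x y, x ∈ gr L i → y ∈ gr L j →
      ρ (LieSuperalgebra.bracket x y) = ρ x * ρ y - superSign i j • (ρ y * ρ x))
    {i j : ℤ} {x y : L} (hx : x ∈ gr L i) (hy : y ∈ gr L j) (w : V) :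
    ρ x (ρ y w) = ρ (LieSuperalgebra.bracket x y) w + superSign i j • ρ y (ρ x w) := by
  rw [hρ i j x y hx hy]
  simp

/-- The span of the orbit of a singular vector under elements of nonpositive degree is a
submodule. -/
theorem apply_mem_span_nonposOrbit
    (hρ : ∀ i j x y, x ∈ gr L i → y ∈ gr L j →
      ρ (LieSuperalgebra.bracket x y) = ρ x * ρ y - superSign i j • (ρ y * ρ x))
    {u : V} (hu : ∀ i x, 0 < i → x ∈ gr L i → ρ x u = 0) (x : L) (w : V)
    (hw : w ∈ Submodule.span ℂ {w | NonposOrbit ρ u w}) :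
    ρ x w ∈ Submodule.span ℂ {w | NonposOrbit ρ u w} := by
  -- The claim is made for elements of every degree: moving `x` past `y` produces `[x, y]`, to which
  -- the induction hypothesis has to apply as well.
  have key : ∀ w, NonposOrbit ρ u w → ∀ i, ∀ x ∈ gr L i,
      ρ x w ∈ Submodule.span ℂ {w | NonposOrbit ρ u w} := by
    intro w hw
    induction hw with
    | base =>
      intro i x hx
      rcases lt_or_ge 0 i with hi | hi
      · rw [hu i x hi hx]
        exact Submodule.zero_mem _
      · exact Submodule.subset_span (NonposOrbit.step i x u hi hx .base)
    | step j y w hj hy hw ih =>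
      intro i x hx
      rcases lt_or_ge 0 i with hi | hi
      · rw [apply_apply_of_map_bracket hρ hx hy]
        refine Submodule.add_mem _ (ih _ _ (LieSuperalgebra.bracket_mem i j x y hx hy))
          (Submodule.smul_mem _ _ ?_)
        refine Submodule.span_induction (p := fun z _ =>
          ρ y z ∈ Submodule.span ℂ {w | NonposOrbit ρ u w}) ?_ ?_ ?_ ?_ (ih i x hx)
        · exact fun z hz => Submodule.subset_span (NonposOrbit.step j y z hj hy hz)
        · rw [map_zero]; exact Submodule.zero_mem _
        · intro z z' _ _ h h'
          rw [map_add]; exact Submodule.add_mem _ h h'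
        · intro a z _ h
          rw [map_smul]; exact Submodule.smul_mem _ _ h
      · exact Submodule.subset_span (NonposOrbit.step i x _ hi hx (.step j y w hj hy hw))
  refine apply_mem_of_homogeneous ?_ x w hw
  intro i x hx w hw
  refine Submodule.span_induction (p := fun z _ =>
    ρ x z ∈ Submodule.span ℂ {w | NonposOrbit ρ u w}) ?_ ?_ ?_ ?_ hw
  · exact fun z hz => key z hz i x hx
  · rw [map_zero]; exact Submodule.zero_mem _
  · intro z z' _ _ h h'
    rw [map_add]; exact Submodule.add_mem _ h h'
  · intro a z _ h
    rw [map_smul]; exact Submodule.smul_mem _ _ h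

/-- A singular vector of negative degree in an irreducible module with a nonzero vector of degree
zero vanishes. -/
theorem eq_zero_of_singular
    (hρ : ∀ i j x y, x ∈ gr L i → y ∈ gr L j →
      ρ (LieSuperalgebra.bracket x y) = ρ x * ρ y - superSign i j • (ρ y * ρ x))
    (hirr : ∀ W : Submodule ℂ V, (∀ x, ∀ w ∈ W, ρ x w ∈ W) → W = ⊥ ∨ W = ⊤)
    {𝒱 : ℤ → Submodule ℂ V} (h𝒱 : DirectSum.IsInternal 𝒱)
    (hgr : ∀ i j x m, x ∈ gr L i → m ∈ 𝒱 j → ρ x m ∈ 𝒱 (i + j))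
    {v : V} (hv : v ∈ 𝒱 0) (hv0 : v ≠ 0) {k : ℤ} (hk : k < 0) {u : V} (hu : u ∈ 𝒱 k)
    (hsing : ∀ i x, 0 < i → x ∈ gr L i → ρ x u = 0) : u = 0 := by
  have hle : Submodule.span ℂ {w | NonposOrbit ρ u w} ≤ ⨆ i, ⨆ _ : i ≠ 0, 𝒱 i := by
    rw [Submodule.span_le]
    -- Lowering keeps the degree negative, so this submodule misses degree zero and cannot contain
    -- `v`.
    have : ∀ w, NonposOrbit ρ u w → ∃ i < 0, w ∈ 𝒱 i := by
      intro w hw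
      induction hw with
      | base => exact ⟨k, hk, hu⟩
      | step i x w hi hx _ ih =>
        obtain ⟨j, hj, hw⟩ := ih
        exact ⟨i + j, by omega, hgr i j x w hx hw⟩
    intro w hw
    obtain ⟨i, hi, hw⟩ := this w hw
    exact Submodule.mem_iSup_of_mem i (Submodule.mem_iSup_of_mem hi.ne hw)
  have hmem : u ∈ Submodule.span ℂ {w | NonposOrbit ρ u w} := Submodule.subset_span .base
  rcases hirr _ (apply_mem_span_nonposOrbit hρ hsing) with h | h
  · rw [h] at hmem
    exact (Submodule.mem_bot ℂ).1 hmem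
  · have hd := h𝒱.submodule_iSupIndep 0
    have hv' : v ∈ ⨆ i, ⨆ _ : i ≠ 0, 𝒱 i := hle (h ▸ Submodule.mem_top)
    exact absurd (Submodule.disjoint_def.1 hd v hv hv') hv0

/-- Pullback of an irreducible highest weight module along a graded homomorphism whose image acts
densely. -/
theorem IsIrreducibleHighestWeight.comp {L' : Type*} [AddCommGroup L'] [Module ℂ L']
    [LieSuperalgebra L'] {ξ : Module.Dual ℂ (gr L 0)} (h : IsIrreducibleHighestWeight ρ ξ)
    (f : L' →ₗ[ℂ] L) (hgr : ∀ i x, x ∈ gr L' i → f x ∈ gr L i)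
    (hbr : ∀ i j x y, x ∈ gr L' i → y ∈ gr L' j →
      f (LieSuperalgebra.bracket x y) = LieSuperalgebra.bracket (f x) (f y))
    (hdense : ∀ x w, ∃ y, ρ (f y) w = ρ x w) :
    IsIrreducibleHighestWeight (ρ ∘ₗ f) (ξ ∘ₗ f.restrict (hgr 0)) where
  map_bracket i j x y hx hy := by
    simp only [LinearMap.comp_apply]
    rw [hbr i j x y hx hy, h.map_bracket i j _ _ (hgr i x hx) (hgr j y hy)]
  exists_highest_weight_vector := by
    obtain ⟨𝒱, h𝒱, h1, v, hv, hv0, h2, h3⟩ := h.exists_highest_weight_vector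
    exact ⟨𝒱, h𝒱, fun i j x m hx hm => h1 i j _ m (hgr i x hx) hm, v, hv, hv0,
      fun i x hi hx => h2 i _ hi (hgr i x hx), fun x => h3 (f.restrict (hgr 0) x)⟩
  -- The approximating element may depend on the vector; this is enough to make `W` stable under all
  -- of `L`.
  irreducible W hW := h.irreducible W fun x w hw => by
    obtain ⟨y, hy⟩ := hdense x w
    rw [← hy]
    exact hW y w hw

end HighestWeight

/-! ## Local finiteness of the action of infinite matrices -/

/-- An element of `GlHat` without central part whose entries vanish in the rows `m`, `|m| ≤ M`. -/
def Far (M : ℤ) (x : GlHat) : Prop :=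
  CentralExt.coeff Gl.cocycle x = 0 ∧ ∀ m n, |m| ≤ M → (CentralExt.base Gl.cocycle x).1 m n = 0

theorem Far.mono {M M' : ℤ} {x : GlHat} (h : Far M x) (hM : M' ≤ M) : Far M' x :=
  ⟨h.1, fun m n hm => h.2 m n (hm.trans hM)⟩

/-- The commutator `[J, A]` keeps only the entries whose row and column lie on different sides of
the cut at zero. For `A` of degree `i` such rows satisfy `|m| ≤ |i|`. -/
theorem Gl.alpha_eq_zero_of_far {i : ℤ} {A B : Gl} (hA : A ∈ gr Gl i)
    (h : ∀ m n, |m| ≤ |i| → A.1 m n = 0) : Gl.alpha A B = 0 := by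
  have : Gl.commJ A = 0 := by
    refine Gl.ext fun m n => ?_
    rw [Gl.commJ_apply]
    change _ = (0 : ℂ)
    by_cases hi : n - m = i
    · by_cases hm : |m| ≤ |i|
      · rw [h m n hm, mul_zero]
      · have : (m ≤ 0) ↔ (n ≤ 0) := by
          rw [abs_le] at hm
          have h1 := le_abs_self i
          have h2 := neg_abs_le i
          omega
        simp [this]
    · rw [Gl.mem_gr.1 hA m n hi, mul_zero]
  rw [Gl.alpha_apply, this, zero_mul, Gl.str]
  exact finsum_eq_zero_of_forall_eq_zero fun n => mul_zero _

/-- Brackets lose a controlled number of rows: row `m` of `x y` uses row `m` of `x`, row `m` of `y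
x` uses row `m + j` of `x`, and the cocycle uses the rows up to `|i|`. The last use is why `M'` has
to be nonnegative. -/
theorem Far.bracket {i j M M' : ℤ} {x y : GlHat} (hx : x ∈ gr GlHat i) (hy : y ∈ gr GlHat j)
    (h : Far M x) (hM' : 0 ≤ M') (hM : M' + |i| + |j| ≤ M) :
    Far M' (LieSuperalgebra.bracket x y) := by
  rw [CentralExt.mem_gr] at hx hy
  have hi := abs_nonneg i
  have hj := abs_nonneg j
  constructor
  · exact Gl.alpha_eq_zero_of_far hx.1 fun m n hm => h.2 m n (by omega)
  · intro m n hm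
    change (superComm (CentralExt.base Gl.cocycle x) (CentralExt.base Gl.cocycle y)).1 m n = 0
    rw [superComm_apply hx.1 hy.1]
    change (_ * _ : Gl).1 m n - superSign i j * (_ * _ : Gl).1 m n = 0
    rw [Gl.mul_apply, Gl.mul_apply, finsum_eq_zero_of_forall_eq_zero,
      finsum_eq_zero_of_forall_eq_zero, mul_zero, sub_zero]
    · intro k
      by_cases hk : k - m = j
      · rw [h.2 k n, mul_zero]
        have : |k| ≤ |m| + |j| := by
          rw [show k = m + j by omega]; exact abs_add_le m j
        omega
      · rw [Gl.mem_gr.1 hy.1 m k hk, zero_mul]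
    · intro k
      rw [h.2 m k (by omega), zero_mul]

theorem Far.neg_smul {M : ℤ} {x : GlHat} (h : Far M x) (a : ℂ) : Far M (-(a • x)) := by
  refine ⟨by rw [map_neg, map_smul, h.1, smul_zero, neg_zero], fun m n hm => ?_⟩
  rw [map_neg, map_smul]
  change -(a * _) = (0 : ℂ)
  rw [h.2 m n hm, mul_zero, neg_zero]

theorem Far.bracket' {i j M M' : ℤ} {x y : GlHat} (hx : x ∈ gr GlHat i) (hy : y ∈ gr GlHat j)
    (h : Far M x) (hM' : 0 ≤ M') (hM : M' + |i| + |j| ≤ M) :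
    Far M' (LieSuperalgebra.bracket y x) := by
  rw [LieSuperalgebra.skew j i y x hy hx]
  exact (h.bracket hx hy hM' hM).neg_smul _

section LocallyFinite

variable {L : Type*} [AddCommGroup L] [Module ℂ L] [LieSuperalgebra L]
  {V : Type*} [AddCommGroup V] [Module ℂ V] {ρ : L →ₗ[ℂ] Module.End ℂ V}
  {ξ : Module.Dual ℂ (gr L 0)} {ι : L →ₗ[ℂ] GlHat}

theorem mem_gr_of_comp (hcomp : ∀ i x, ι (HalfGraded.comp i x) = HalfGraded.comp i (ι x))
    {i : ℤ} {x : L} (hx : x ∈ gr L i) : ι x ∈ gr GlHat i := by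
  rw [mem_gr] at *
  rw [← hcomp, hx]

/-- This is the local finiteness behind all density arguments. The map `ι` is there so that the same
proof serves `GlHat` itself and its subalgebra `BHat`; the hypothesis on `ξ` expresses that the
weight lies in the restricted dual. -/
theorem IsIrreducibleHighestWeight.exists_far_apply_eq_zero (h : IsIrreducibleHighestWeight ρ ξ)
    (hcomp : ∀ i x, ι (HalfGraded.comp i x) = HalfGraded.comp i (ι x))
    (hbr : ∀ x y, ι (LieSuperalgebra.bracket x y) = LieSuperalgebra.bracket (ι x) (ι y))
    (hξ : ∃ N, ∀ x : gr L 0, Far N (ι x) → ξ x = 0) (w : V) (k : ℤ) :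
    ∃ M, ∀ x ∈ gr L k, Far M (ι x) → ρ x w = 0 := by
  obtain ⟨𝒱, h𝒱, hgr, v, hv, hv0, hpos, hwt⟩ := h.exists_highest_weight_vector
  have hact := fun {i j : ℤ} {x y : L} (hx : x ∈ gr L i) (hy : y ∈ gr L j) (w : V) =>
    apply_apply_of_map_bracket h.map_bracket hx hy w
  -- For the highest weight vector, by induction on the depth `n`, with one bound for all degrees at
  -- least `-n`.
  have base : ∀ n : ℕ, ∃ M, 0 ≤ M ∧ ∀ k : ℤ, -(n : ℤ) ≤ k → ∀ x ∈ gr L k, Far M (ι x) →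
      ρ x v = 0 := by
    intro n
    induction n with
    | zero =>
      obtain ⟨N, hN⟩ := hξ
      refine ⟨max N 0, le_max_right _ _, fun k hk x hx hfar => ?_⟩
      rcases lt_or_eq_of_le hk with hk | hk
      · exact hpos k x (by simpa using hk) hx
      · obtain rfl : k = 0 := by simpa using hk.symm
        rw [hwt ⟨x, hx⟩, hN ⟨x, hx⟩ (hfar.mono (le_max_left _ _)), zero_smul]
    | succ n ih =>
      obtain ⟨M, hM0, hM⟩ := ih
      -- The new degree is `k = -(n + 1)`, and only raising elements of degree `i ≤ n + 1` need
      -- attention, so a bracket costs `i + |k| ≤ 2(n + 1)` rows.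
      refine ⟨M + 2 * (n + 1), by omega, fun k hk x hx hfar => ?_⟩
      by_cases hk' : -(n : ℤ) ≤ k
      · exact hM k hk' x hx (hfar.mono (by omega))
      · have hux : ρ x v ∈ 𝒱 k := by simpa using hgr k 0 x v hx hv
        -- A raising element `y` kills `v`, so `ρ y (ρ x v) = ρ [y, x] v`, where `[y, x]` has larger
        -- degree and is still far. Thus `ρ x v` is singular of negative degree.
        refine eq_zero_of_singular h.map_bracket h.irreducible h𝒱 hgr hv hv0 (by omega) hux ?_
        intro i y hi hy
        rw [hact hy hx, hpos i y hi hy, map_zero, smul_zero, add_zero]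
        have hb := LieSuperalgebra.bracket_mem i k y x hy hx
        rcases lt_or_ge 0 (i + k) with hik | hik
        · exact hpos _ _ hik hb
        · refine hM (i + k) (by omega) _ hb ?_
          rw [hbr]
          refine hfar.bracket' (mem_gr_of_comp hcomp hx) (mem_gr_of_comp hcomp hy) hM0 ?_
          rw [abs_of_pos hi, abs_of_neg (by omega : k < 0)]
          push_cast at hk
          omega
  -- The bound is allowed to depend on the degree `k`; a bound uniform in `k` would not be preserved
  -- by the action.
  let P : Submodule ℂ V :=
    { carrier := {w | ∀ k, ∃ M, ∀ x ∈ gr L k, Far M (ι x) → ρ x w = 0}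
      zero_mem' := fun k => ⟨0, fun x _ _ => map_zero _⟩
      add_mem' := by
        intro w w' hw hw' k
        obtain ⟨M, hM⟩ := hw k
        obtain ⟨M', hM'⟩ := hw' k
        refine ⟨max M M', fun x hx hf => ?_⟩
        rw [map_add, hM x hx (hf.mono (le_max_left _ _)), hM' x hx (hf.mono (le_max_right _ _)),
          add_zero]
      smul_mem' := by
        intro a w hw k
        obtain ⟨M, hM⟩ := hw k
        exact ⟨M, fun x hx hf => by rw [map_smul, hM x hx hf, smul_zero]⟩ }
  have hP : ∀ x, ∀ w ∈ P, ρ x w ∈ P := by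
    refine apply_mem_of_homogeneous ?_
    intro j y hy w hw k
    obtain ⟨M, hM⟩ := hw k
    obtain ⟨M', hM'⟩ := hw (k + j)
    -- In `x y w = [x, y] w ± y x w` the second term needs `x` far for `w`, the first needs `[x, y]`
    -- far for `w`, at a cost of `|k| + |j|` rows.
    refine ⟨max M (max M' 0 + |k| + |j|), fun x hx hf => ?_⟩
    rw [hact hx hy, hM x hx (hf.mono (le_max_left _ _)), map_zero, smul_zero, add_zero]
    refine hM' _ (LieSuperalgebra.bracket_mem k j x y hx hy) ?_
    rw [hbr]
    exact (hf.bracket (mem_gr_of_comp hcomp hx) (mem_gr_of_comp hcomp hy) (le_max_right _ _)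
      (le_max_right _ _)).mono (le_max_left _ _)
  have hvP : v ∈ P := by
    intro k
    obtain ⟨M, -, hM⟩ := base k.natAbs
    exact ⟨M, hM k (by omega)⟩
  rcases h.irreducible P hP with hb | ht
  · rw [hb] at hvP
    exact absurd ((Submodule.mem_bot ℂ).1 hvP) hv0
  · have : w ∈ P := ht ▸ Submodule.mem_top
    exact this k

/-- Passing from homogeneous elements to arbitrary ones requires a bound on the width, since only
then do finitely many degrees enter. -/
theorem IsIrreducibleHighestWeight.exists_far_apply_eq_zero_of_band
    (h : IsIrreducibleHighestWeight ρ ξ) (hι : Function.Injective ι)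
    (hcomp : ∀ i x, ι (HalfGraded.comp i x) = HalfGraded.comp i (ι x))
    (hbr : ∀ x y, ι (LieSuperalgebra.bracket x y) = LieSuperalgebra.bracket (ι x) (ι y))
    (hξ : ∃ N, ∀ x : gr L 0, Far N (ι x) → ξ x = 0) (w : V) (K : ℤ) :
    ∃ M, ∀ x, (∀ m n, K < |m - n| → (CentralExt.base Gl.cocycle (ι x)).1 m n = 0) →
      Far M (ι x) → ρ x w = 0 := by
  choose M hM using h.exists_far_apply_eq_zero hcomp hbr hξ w
  -- One row bound for the finitely many degrees between `-K` and `K`.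
  obtain ⟨B, hB⟩ := ((Finset.Icc (-K) K).image M).bddAbove
  refine ⟨B, fun x hK hf => ?_⟩
  obtain ⟨S, hS⟩ := HalfGraded.exists_eq_sum x
  rw [hS, map_sum, LinearMap.sum_apply]
  refine Finset.sum_eq_zero fun i _ => ?_
  have entry : ∀ m n, (CentralExt.base Gl.cocycle (ι (HalfGraded.comp i x))).1 m n =
      if n - m = i then (CentralExt.base Gl.cocycle (ι x)).1 m n else 0 := by
    intro m n
    rw [hcomp]
    rfl
  have hc : CentralExt.coeff Gl.cocycle (ι (HalfGraded.comp i x)) = 0 := by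
    rw [hcomp]
    change (if i = 0 then CentralExt.coeff Gl.cocycle else 0 : GlHat →ₗ[ℂ] ℂ) (ι x) = 0
    split_ifs
    · exact hf.1
    · rfl
  by_cases hi : i ∈ Finset.Icc (-K) K
  · refine hM i _ (comp_mem_gr i x) ⟨hc, fun m n hm => ?_⟩
    rw [entry, hf.2 m n (hm.trans (hB (Finset.mem_coe.2 (Finset.mem_image_of_mem M hi)))), ite_self]
  -- Outside the band the component has zero matrix and zero central part, so it vanishes by
  -- injectivity of `ι`.
  · have : HalfGraded.comp i x = 0 := by
      apply hι
      rw [map_zero]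
      refine CentralExt.ext _ (Gl.ext fun m n => ?_) hc
      rw [entry]
      split_ifs with hmn
      · rw [hK]
        · rfl
        · rw [Finset.mem_Icc] at hi
          rw [lt_abs]
          omega
      · rfl
    rw [this, map_zero, LinearMap.zero_apply]

end LocallyFinite

/-! ## Interpolation by differential operators -/

namespace SD

/-- Lagrange interpolation at two families of nodes. They are disjoint because `s - s'` is not an
integer, so the two sets of values can be prescribed independently. -/
theorem exists_eval_eq {s s' : ℂ} (hs : ∀ k : ℤ, s - s' ≠ k) (f g : ℤ → ℂ) (M : ℤ) :
    ∃ p : ℂ[X], ∀ q : ℤ, |q| ≤ M →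
      p.eval (-(q : ℂ) + s) = f q ∧ p.eval (-(q : ℂ) + s') = g q := by
  let v : ℤ ⊕ ℤ → ℂ := Sum.elim (fun q => -(q : ℂ) + s) fun q => -(q : ℂ) + s'
  have hv : Function.Injective v := by
    have aux : ∀ a b : ℤ, -(a : ℂ) + s ≠ -(b : ℂ) + s' := by
      intro a b h
      apply hs (a - b)
      push_cast
      linear_combination h
    rintro (a | a) (b | b) h
    · simpa [v] using h
    · exact absurd h (aux a b)
    · exact absurd h.symm (aux b a)
    · simpa [v] using h
  let S : Finset (ℤ ⊕ ℤ) := (Finset.Icc (-M) M).disjSum (Finset.Icc (-M) M)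
  refine ⟨Lagrange.interpolate S v (Sum.elim f g), fun q hq => ?_⟩
  have hq' : q ∈ Finset.Icc (-M) M := Finset.mem_Icc.2 (abs_le.1 hq)
  exact ⟨Lagrange.eval_interpolate_at_node (v := v) (Sum.elim f g) hv.injOn
      (Finset.inl_mem_disjSum.2 hq'),
    Lagrange.eval_interpolate_at_node (v := v) (Sum.elim f g) hv.injOn
      (Finset.inr_mem_disjSum.2 hq')⟩

/-- Two matrices with finitely many nonzero diagonals can be interpolated simultaneously, on any
finite set of rows, by the images of one differential operator under `φ_s` and `φ_{s'}`. -/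
theorem exists_phi_eq {s s' : ℂ} (hs : ∀ k : ℤ, s - s' ≠ k) (A B : Gl) :
    ∃ K : ℤ, ∀ M : ℤ, ∃ y : SD, (∀ t m n, K < |m - n| → (phi t y).1 m n = 0) ∧
      (∀ m n, |m| ≤ M → (phi s y).1 m n = A.1 m n) ∧
      ∀ m n, |m| ≤ M → (phi s' y).1 m n = B.1 m n := by
  obtain ⟨N, hN0, hN⟩ := A.exists_band
  obtain ⟨N', hN0', hN'⟩ := B.exists_band
  set R := N + N' + 1 with hR
  -- The width is fixed before the window `M`. In doubled indices a power `t^k` fills diagonals up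
  -- to distance `2|k| + 1`.
  refine ⟨2 * R + 1, fun M => ?_⟩
  -- The entry of `t^k p(D)` in column `2q - b` sits in row `2(q - k) - a` and is `p(-q + s)`. The
  -- range `|M| + R + 1` covers each `q` that such an entry in a row of the window can have.
  choose p hp using fun (k : ℤ) (a b : Fin 2) => exists_eval_eq hs
    (fun q => A.1 (2 * (q - k) - (a : ℕ)) (2 * q - (b : ℕ)))
    (fun q => B.1 (2 * (q - k) - (a : ℕ)) (2 * q - (b : ℕ))) (|M| + R + 1)
  let y : SD := ∑ k ∈ Finset.Icc (-R) R, term k (Matrix.of fun a b => p k a b)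
  have hy : ∀ k a b, coeff k y a b = if k ∈ Finset.Icc (-R) R then p k a b else 0 := by
    intro k a b
    simp only [y, map_sum, coeff_term, Finset.sum_ite_eq']
    split_ifs <;> rfl
  have hband : ∀ t m n, 2 * R + 1 < |m - n| → (phi t y).1 m n = 0 := by
    intro t m n h
    rw [phi_apply, hy, if_neg, eval_zero]
    rw [Finset.mem_Icc]
    unfold idx
    rw [lt_abs] at h
    omega
  have hM := le_abs_self M
  have main : ∀ m n, |m| ≤ M → (phi s y).1 m n = A.1 m n ∧ (phi s' y).1 m n = B.1 m n := by
    intro m n hm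
    rw [phi_apply, phi_apply, hy]
    have h1 := exists_idx m
    have h2 := exists_idx n
    have h3 := (par m).2
    have h4 := (par n).2
    by_cases hk : idx n - idx m ∈ Finset.Icc (-R) R
    · rw [if_pos hk]
      rw [Finset.mem_Icc] at hk
      have := hp (idx n - idx m) (par m) (par n) (idx n) (by
        rw [abs_le] at hm ⊢
        omega)
      rw [this.1, this.2, sub_sub_cancel, ← h1, ← h2]
      exact ⟨rfl, rfl⟩
    -- If the power of `t` exceeds `R`, the place lies outside the bands of both `A` and `B`, so
    -- zero is the correct value.
    · rw [if_neg hk, eval_zero, eval_zero]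
      rw [Finset.mem_Icc] at hk
      exact ⟨(hN m n (by rw [lt_abs]; omega)).symm, (hN' m n (by rw [lt_abs]; omega)).symm⟩
  exact ⟨y, hband, fun m n hm => (main m n hm).1, fun m n hm => (main m n hm).2⟩

/-! ## The anti-involution -/

/-- Reflecting `D` reverses the sign of the evaluation point, and `τ` reverses indices; the two
reversals agree when the parameter `s` is replaced by `-s`. -/
theorem phi_sigma_eq_tau (s : ℂ) (x : SD) : phi s (sigma x) = Gl.tau (phi (-s) x) := by
  have n1 : ∀ p : ℤ, idx (-(2 * p)) = -p := fun p => by unfold idx; omega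
  have n2 : ∀ p : ℤ, idx (-(2 * p - 1)) = 1 - p := fun p => by unfold idx; omega
  have p1 : ∀ p : ℤ, par (-(2 * p)) = 0 := fun p => by simp [par]
  have p2 : ∀ p : ℤ, par (-(2 * p - 1)) = 1 := fun p => by
    have : Odd (-(2 * p - 1)) := ⟨-p, by ring⟩
    unfold par; rw [if_pos this]
  have o2 : ∀ p : ℤ, Odd (2 * p - 1) := fun p => ⟨p - 1, by ring⟩
  have hps : ∀ p q : ℤ, parSign (q - p) = parSign p * parSign q := fun p q => by
    rw [sub_eq_add_neg, parSign_add, Gl.parSign_neg, mul_comm]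
  have s1 : parSign 1 = -1 := by simp [parSign]
  refine SD.induction (p := fun x => phi s (sigma x) = Gl.tau (phi (-s) x)) x ?_ ?_ ?_
  · simp only [map_zero]
  · intro x y hx hy
    rw [map_add, map_add, hx, hy, map_add, map_add]
  · intro k F
    refine Gl.ext fun m n => ?_
    rw [Gl.tau_apply, phi_apply, phi_apply, sigma_term, coeff_term]
    simp only [map_add, map_sub, map_smul, coeff_term, Matrix.add_apply, Matrix.sub_apply,
      Matrix.smul_apply, eval_smul, eval_add, eval_sub, smul_eq_mul]
    obtain ⟨p, rfl | rfl⟩ : ∃ p : ℤ, m = 2 * p ∨ m = 2 * p - 1 := ⟨idx m, by unfold idx; omega⟩ <;>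
    obtain ⟨q, rfl | rfl⟩ : ∃ q : ℤ, n = 2 * q ∨ n = 2 * q - 1 := ⟨idx n, by unfold idx; omega⟩ <;>
    simp only [n1, n2, p1, p2, idx_two_mul, idx_two_mul_sub, par_two_mul, par_two_mul_sub]
    · have hs : superSign (2 * q - 2 * p) (2 * q) = 1 := by simp [superSign]
      rw [hs]
      by_cases h : k = q - p
      · rw [if_pos h, if_neg (by omega : ¬ k + 1 = q - p), if_neg (by omega : ¬ k - 1 = q - p),
          if_pos (by omega : k = -p - -q), h, hps]
        simp [eval_reflect]
        left; congr 1; ring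
      · rw [if_neg h, if_neg (by omega : ¬ k = -p - -q)]
        split_ifs <;> simp
    · have hs : superSign (2 * q - 1 - 2 * p) (2 * q - 1) = -1 := by
        rw [superSign, if_pos ⟨⟨q - p - 1, by ring⟩, o2 q⟩]
      rw [hs]
      by_cases h : k + 1 = q - p
      · rw [if_pos h, if_neg (by omega : ¬ k = q - p), if_neg (by omega : ¬ k - 1 = q - p),
          if_pos (by omega : k = -p - (1 - q)), show k = (q - p) + -1 by omega, parSign_add,
          Gl.parSign_neg, s1, hps]
        simp [eval_reflect]
        left; congr 1; ring
      · rw [if_neg h, if_neg (by omega : ¬ k = -p - (1 - q))]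
        split_ifs <;> simp
    · have hs : superSign (2 * q - (2 * p - 1)) (2 * q) = 1 := by simp [superSign]
      rw [hs]
      by_cases h : k - 1 = q - p
      · rw [if_pos h, if_neg (by omega : ¬ k = q - p), if_neg (by omega : ¬ k + 1 = q - p),
          if_pos (by omega : k = 1 - p - -q), show k = (q - p) + 1 by omega, parSign_add, s1, hps]
        simp [eval_reflect]
        left; congr 1; ring
      · rw [if_neg h, if_neg (by omega : ¬ k = 1 - p - -q)]
        split_ifs <;> simp
    · have hs : superSign (2 * q - 1 - (2 * p - 1)) (2 * q - 1) = 1 := by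
        rw [superSign, if_neg]
        rintro ⟨⟨a, ha⟩, -⟩
        omega
      rw [hs]
      by_cases h : k = q - p
      · rw [if_pos h, if_neg (by omega : ¬ k + 1 = q - p), if_neg (by omega : ¬ k - 1 = q - p),
          if_pos (by omega : k = 1 - p - (1 - q)), h, hps]
        simp [eval_reflect]
        left; congr 1; ring
      · rw [if_neg h, if_neg (by omega : ¬ k = 1 - p - (1 - q))]
        split_ifs <;> simp

end SD

/-- The signs `(-1)^{idx}` at `k` and `-k` differ exactly for odd `k`, since `idx (-(2p - 1)) = 1 -
p`. The Koszul signs of the two applications of `τ` compensate for this. -/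
theorem Gl.tau_tau (T : Gl) : tau (tau T) = T := by
  refine ext fun m n => ?_
  rw [tau_apply, tau_apply, neg_neg, neg_neg]
  have hidx : ∀ k : ℤ, parSign (SD.idx (-k)) = parSign k * parSign (SD.idx k) := by
    intro k
    have hp : ∀ p : ℤ, SD.idx (-(2 * p)) = -p := fun p => by unfold SD.idx; omega
    have hp' : ∀ p : ℤ, SD.idx (-(2 * p - 1)) = -p + 1 := fun p => by unfold SD.idx; omega
    obtain ⟨p, rfl | rfl⟩ : ∃ p : ℤ, k = 2 * p ∨ k = 2 * p - 1 :=
      ⟨SD.idx k, by unfold SD.idx; omega⟩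
    · have : ¬ Odd (2 * p) := by simp
      rw [hp, SD.idx_two_mul, parSign_neg]
      simp [parSign, this]
    · have : Odd (2 * p - 1) := ⟨p - 1, by ring⟩
      rw [hp', SD.idx_two_mul_sub, SD.parSign_add, parSign_neg, mul_comm]
      simp [parSign, this]
  have hsign : superSign (n - m) n * superSign (-m - -n) (-m) * parSign m * parSign n = 1 := by
    unfold superSign parSign
    by_cases o1 : Odd m <;> by_cases o2 : Odd n <;>
      simp [o1, o2, Int.odd_sub, Int.odd_add, ← Int.not_odd_iff_even]
  rw [hidx, hidx]
  have h1 := parSign_mul_self (SD.idx m)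
  have h2 := parSign_mul_self (SD.idx n)
  linear_combination T.1 m n * (hsign + (superSign (n - m) n * superSign (-m - -n) (-m) *
    parSign m * parSign n) * (parSign (SD.idx n) * parSign (SD.idx n) * h1 + h2))

theorem SD.sigma_sigma (x : SD) : sigma (sigma x) = x := by
  apply phi_injective 0
  rw [phi_sigma, phi_sigma, Gl.tau_tau]

/-! ## The cocycles -/

namespace SD

theorem eval_shift (a z : ℂ) (f : ℂ[X]) : (shift a f).eval z = f.eval (z + a) := by
  rw [shift, Polynomial.aeval_def, Polynomial.algebraMap_eq]
  change (f.comp (X + C a)).eval z = _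
  rw [Polynomial.eval_comp, eval_add, eval_X, eval_C]

/-- Polynomials with the same difference differ by a constant. -/
theorem eval_sub_eval_eq {f g : ℂ[X]} (h : f - shift 1 f = g - shift 1 g) (z w : ℂ) :
    f.eval z - f.eval w = g.eval z - g.eval w := by
  -- The difference `f - g` is invariant under `w ↦ w + 1`, hence takes a single value on the
  -- natural numbers, hence is constant.
  have h0 : f - g = C ((f - g).eval 0) := by
    rw [← sub_eq_zero]
    apply Polynomial.eq_zero_of_infinite_isRoot
    refine Set.Infinite.mono (s := Set.range fun n : ℕ => (n : ℂ)) ?_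
      (Set.infinite_range_of_injective Nat.cast_injective)
    rintro _ ⟨n, rfl⟩
    change Polynomial.eval _ _ = 0
    induction n with
    | zero => simp
    | succ n ih =>
      have h1 := congrArg (Polynomial.eval (n : ℂ)) h
      simp only [eval_sub, eval_shift, eval_C] at h1 ih ⊢
      push_cast
      linear_combination ih - h1
  have h1 := congrArg (Polynomial.eval z) h0
  have h2 := congrArg (Polynomial.eval w) h0
  rw [eval_C, eval_sub] at h1 h2
  linear_combination h1 - h2

theorem antidiff_sub_shift_eval (f : ℂ[X]) (s : ℂ) :
    (antidiff (f - shift 1 f)).eval s - (antidiff (f - shift 1 f)).eval 0 = f.eval s - f.eval 0 :=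
  eval_sub_eval_eq (by rw [antidiff_sub_shift]) s 0

/-- The window sum of `T` is a solution of `h(w) - h(w + 1) = T(w - r) - T(w)`. -/
theorem antidiff_shift_sub (p : ℂ[X]) (r : ℤ) (s : ℂ) :
    (antidiff (shift (-r) p - p)).eval s - (antidiff (shift (-r) p - p)).eval 0 =
      (∑ j ∈ Finset.Ico (-r) 0, p.eval (j + s) - ∑ j ∈ Finset.Ico 0 (-r), p.eval (j + s)) -
      (∑ j ∈ Finset.Ico (-r) 0, p.eval (j : ℂ) - ∑ j ∈ Finset.Ico 0 (-r), p.eval (j : ℂ)) := by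
  -- An explicit antidifference. One of the two sums is empty according to the sign of `r`, and the
  -- other telescopes. It agrees with `antidiff` up to a constant, which the difference of values
  -- removes.
  let g : ℂ[X] := ∑ j ∈ Finset.Ico (-r) 0, shift j p - ∑ j ∈ Finset.Ico 0 (-r), shift j p
  have hg : ∀ z, g.eval z =
      ∑ j ∈ Finset.Ico (-r) 0, p.eval (j + z) - ∑ j ∈ Finset.Ico 0 (-r), p.eval (j + z) := by
    intro z
    simp only [g, eval_sub, Polynomial.eval_finsetSum, eval_shift]
    simp only [add_comm z]
  have hss : ∀ j : ℤ, shift 1 (shift j p) = shift ((j + 1 : ℤ) : ℂ) p := by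
    intro j
    refine Polynomial.funext fun z => ?_
    simp only [eval_shift]
    congr 1; push_cast; ring
  have h0 : shift 0 p = p := Polynomial.funext fun z => by rw [eval_shift, add_zero]
  have tel : ∀ a b : ℤ, a ≤ b → ∑ j ∈ Finset.Ico a b, (shift (j : ℂ) p - shift ((j + 1 : ℤ) : ℂ) p)
      = shift (a : ℂ) p - shift (b : ℂ) p := by
    intro a b hab
    induction b, hab using Int.leInduction with
    | base => simp
    | succ b hab ih =>
      rw [← Finset.insert_Ico_right_eq_Ico_add_one hab, Finset.sum_insert (by simp), ih]
      ring
  have hd : g - shift 1 g = shift (-r) p - p := by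
    simp only [g, map_sub, map_sum, hss]
    have e : ∀ a b a' b' : ℂ[X], a - b - (a' - b') = (a - a') - (b - b') := fun _ _ _ _ => by ring
    rw [e, ← Finset.sum_sub_distrib, ← Finset.sum_sub_distrib]
    rcases le_total 0 r with h | h
    · rw [tel (-r) 0 (by omega), Finset.Ico_eq_empty (by omega : ¬ (0 : ℤ) < -r), Finset.sum_empty,
        sub_zero, Int.cast_zero, h0, Int.cast_neg]
    · rw [tel 0 (-r) (by omega), Finset.Ico_eq_empty (by omega : ¬ -r < (0 : ℤ)), Finset.sum_empty,
        Int.cast_zero, h0, Int.cast_neg]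
      ring
  have := eval_sub_eval_eq (f := antidiff (shift (-r) p - p)) (g := g)
    (by rw [antidiff_sub_shift, hd]) s 0
  rw [this, hg, hg]
  simp

/-- Conjugation by `t^s` replaces `D` by `D + s`. This reduces the evaluation of `α` on the image of
`φ_s` to the case `s = 0`, which is `Ψ`. -/
theorem phi_term_eq_phi_zero (s : ℂ) (k : ℤ) (F : Matrix (Fin 2) (Fin 2) ℂ[X]) :
    phi s (term k F) = phi 0 (term k ((shift s).mapMatrix F)) := by
  refine Gl.ext fun m n => ?_
  rw [phi_apply, phi_apply, coeff_term, coeff_term]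
  split_ifs
  · rw [AlgHom.mapMatrix_apply, Matrix.map_apply, eval_shift, add_zero]
  · simp

theorem odd_term (k : ℤ) (F : Matrix (Fin 2) (Fin 2) ℂ[X]) :
    GradedSuperring.odd (term k F) = term k !![0, F 0 1; F 1 0, 0] := by
  refine ext fun l a b => ?_
  refine (coeff_restrictEntries _ _ _ _ _).trans ?_
  rw [coeff_term, coeff_term]
  fin_cases a <;> fin_cases b <;> by_cases h : k = l <;> simp [h]

theorem chi_apply (s : ℂ) (x : SD) : chi s x =
    (antidiff (coeff 0 x 0 0 - coeff 0 x 1 1)).eval s -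
      (antidiff (coeff 0 x 0 0 - coeff 0 x 1 1)).eval 0 := by
  simp only [chi, LinearMap.coe_mk, AddHom.coe_mk, map_sub, eval_sub]
  ring

theorem superComm_def (x y : SD) : superComm x y =
    x * y - y * x + (2 : ℂ) • (GradedSuperring.odd y * GradedSuperring.odd x) := rfl

/-- Put `p(w) = Str(F(w) G(w + r))`. For opposite powers of `t`, the left side is the window sum of
`p(j + s)` and `Ψ` is that of `p(j)`. The supertrace of the commutator is `p(w - r) - p(w)`, and its
antidifference, evaluated between `0` and `s`, is the difference of the two window sums. -/
theorem alpha_phi_term_eq (s : ℂ) (r u : ℤ) (F G : Matrix (Fin 2) (Fin 2) ℂ[X]) :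
    Gl.alpha (phi s (term r F)) (phi s (term u G)) =
      psi (term r F) (term u G) + chi s (superComm (term r F) (term u G)) := by
  rw [phi_term_eq_phi_zero s r F, phi_term_eq_phi_zero s u G, alpha_phi, superComm_def, odd_term, odd_term,
    term_mul_term, term_mul_term, term_mul_term]
  by_cases hu : u = -r
  · subst hu
    let p : ℂ[X] := F 0 0 * shift r (G 0 0) + F 0 1 * shift r (G 1 0) -
      F 1 0 * shift r (G 0 1) - F 1 1 * shift r (G 1 1)
    have hpsi : ∀ F G : Matrix (Fin 2) (Fin 2) ℂ[X], psi (term r F) (term (-r) G) =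
        ∑ j ∈ Finset.Ico (-r) 0, strEval r F G j - ∑ j ∈ Finset.Ico 0 (-r), strEval r F G j := by
      intro F G
      rw [psi, ofTerms_term, LinearMap.compl₂_apply, coeff_term, if_pos rfl]
      rfl
    have hstr : ∀ j, strEval r F G j = p.eval (j : ℂ) := by
      intro j
      simp only [strEval_eq, p, eval_sub, eval_add, eval_mul, eval_shift]
    have hstr' : ∀ j, strEval r ((shift s).mapMatrix F) ((shift s).mapMatrix G) j =
        p.eval (j + s) := by
      intro j
      have : (j : ℂ) + r + s = j + s + r := by ring
      simp only [strEval_eq, p, eval_sub, eval_add, eval_mul, eval_shift, AlgHom.mapMatrix_apply,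
        Matrix.map_apply, this]
    rw [hpsi, hpsi, chi_apply]
    simp only [hstr, hstr', map_add, map_sub, map_smul, coeff_term, add_neg_cancel, neg_add_cancel,
      if_true]
    have hsr : ∀ f : ℂ[X], shift (-(r : ℂ)) (shift r f) = f := fun f =>
      Polynomial.funext fun z => by rw [eval_shift, eval_shift, neg_add_cancel_right]
    have hcoeff := antidiff_shift_sub p r s
    -- Cyclicity of the supertrace, up to the shift by `r`. The doubled product of odd parts
    -- supplies the super sign.
    have hp : shift (-(r : ℂ)) p - p =
        (((shift ((-r : ℤ) : ℂ)).mapMatrix F * G - (shift (r : ℂ)).mapMatrix G * F +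
          (2 : ℂ) • ((shift (r : ℂ)).mapMatrix !![0, G 0 1; G 1 0, 0] *
            !![0, F 0 1; F 1 0, 0])) 0 0 : ℂ[X]) -
        (((shift ((-r : ℤ) : ℂ)).mapMatrix F * G - (shift (r : ℂ)).mapMatrix G * F +
          (2 : ℂ) • ((shift (r : ℂ)).mapMatrix !![0, G 0 1; G 1 0, 0] *
            !![0, F 0 1; F 1 0, 0])) 1 1 : ℂ[X]) := by
      simp only [p, map_sub, map_add, map_mul, hsr, Matrix.add_apply, Matrix.sub_apply,
        Matrix.mul_apply, Fin.sum_univ_two, AlgHom.mapMatrix_apply,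
        Matrix.map_apply, two_smul, Int.cast_neg]
      simp
      ring
    rw [hp] at hcoeff
    simp only [← map_sub, hcoeff] at *
    ring
  · have h1 : r + u ≠ 0 := by omega
    have h2 : u + r ≠ 0 := by omega
    rw [psi, ofTerms_term, ofTerms_term, LinearMap.compl₂_apply, LinearMap.compl₂_apply,
      coeff_term, coeff_term, if_neg hu, if_neg hu, map_zero, map_zero, chi_apply]
    simp only [map_add, map_sub, map_smul, coeff_term, if_neg h1, if_neg h2]
    simp

theorem alpha_phi_eq (s : ℂ) (x y : SD) :
    Gl.alpha (phi s x) (phi s y) = psi x y + chi s (superComm x y) := by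
  refine SD.induction (p := fun x => Gl.alpha (phi s x) (phi s y) =
    psi x y + chi s (superComm x y)) x ?_ ?_ ?_
  · simp only [map_zero, LinearMap.zero_apply, add_zero]
  · intro x x' h h'
    simp only [map_add, LinearMap.add_apply, h, h']
    ring
  · intro r F
    refine SD.induction (p := fun y => Gl.alpha (phi s (term r F)) (phi s y) =
      psi (term r F) y + chi s (superComm (term r F) y)) y ?_ ?_ ?_
    · simp only [map_zero, add_zero]
    · intro x x' h h'
      simp only [map_add, h, h']
      ring
    · intro u G
      exact alpha_phi_term_eq s r u F G

end SD

/-! ## The homomorphisms and their dense image -/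

theorem coeff_phiHat (s : ℂ) (x : SDHat) : CentralExt.coeff Gl.cocycle (phiHat s x) =
    SD.chi s (CentralExt.base SD.cocycle x) + CentralExt.coeff SD.cocycle x := rfl

theorem SD.chi_eq_zero {i : ℤ} (hi : i ≠ 0) (s : ℂ) {x : SD} (hx : x ∈ gr SD i) :
    chi s x = 0 := by
  rw [mem_gr] at hx
  rw [chi_apply, hx 0 0 0 (by simpa using hi.symm), hx 0 1 1 (by simpa using hi.symm)]
  simp

theorem phiHat_mem_gr (s : ℂ) (i : ℤ) (x : SDHat) (hx : x ∈ gr SDHat i) :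
    phiHat s x ∈ gr GlHat i := by
  rw [CentralExt.mem_gr] at *
  refine ⟨SD.phi_mem_gr.2 hx.1, fun hi => ?_⟩
  rw [coeff_phiHat, hx.2 hi, SD.chi_eq_zero hi s hx.1, add_zero]

/-- The central term of the source bracket is `Ψ(x, y)`, to which `χ_s([x, y])` is added by the map;
together they are `α(φ_s x, φ_s y)`. -/
theorem phiHat_bracket (s : ℂ) (i j : ℤ) (x y : SDHat) (hx : x ∈ gr SDHat i)
    (hy : y ∈ gr SDHat j) :
    phiHat s (LieSuperalgebra.bracket x y) = LieSuperalgebra.bracket (phiHat s x) (phiHat s y) := by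
  rw [CentralExt.mem_gr] at hx hy
  refine CentralExt.ext _ (SD.phi_superComm s hx.1 hy.1) ?_
  refine Eq.trans ?_ (SD.alpha_phi_eq s _ _).symm
  exact add_comm _ _

/-! ### Density of the images on each module vector. -/

section Dense

variable {V : Type*} [AddCommGroup V] [Module ℂ V]

theorem Far.base_zero {M : ℤ} {x : GlHat} (h : Far M x) {n : ℤ} (hn : |n| ≤ M) :
    diagEntry n x = 0 := h.2 n n hn

/-- This is where membership of `Λ` in the restricted dual enters: finitely many labels see only
finitely many rows. -/
theorem glWeight_eq_zero_of_far (l : ℤ →₀ ℂ) (c : ℂ) :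
    ∃ N, ∀ x : gr GlHat 0, Far N (x : GlHat) → glWeight l c x = 0 := by
  obtain ⟨N, hN⟩ := (l.support.image fun n => |n|).bddAbove
  refine ⟨N, fun x hx => ?_⟩
  change (l.sum (fun n a => a • diagEntry n) + c • CentralExt.coeff Gl.cocycle) (x : GlHat) = 0
  rw [LinearMap.add_apply, LinearMap.smul_apply, hx.1, smul_zero, add_zero, Finsupp.sum,
    LinearMap.sum_apply]
  refine Finset.sum_eq_zero fun n hn => ?_
  rw [LinearMap.smul_apply, hx.base_zero (hN (Finset.mem_coe.2 (Finset.mem_image_of_mem _ hn))),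
    smul_zero]

theorem bWeight_eq_zero_of_far (l : ℕ+ →₀ ℂ) (c : ℂ) :
    ∃ N, ∀ x : gr BHat 0, Far N (x : BHat) → bWeight l c x = 0 := by
  obtain ⟨N, hN⟩ := (l.support.image fun n : ℕ+ => |(n : ℤ)|).bddAbove
  refine ⟨N, fun x hx => ?_⟩
  change (l.sum (fun n a => a • diagEntry (n : ℤ)) + c • CentralExt.coeff Gl.cocycle)
    ((x : BHat) : GlHat) = 0
  rw [LinearMap.add_apply, LinearMap.smul_apply, hx.1, smul_zero, add_zero, Finsupp.sum,
    LinearMap.sum_apply]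
  refine Finset.sum_eq_zero fun n hn => ?_
  rw [LinearMap.smul_apply, hx.base_zero (hN (Finset.mem_coe.2 (Finset.mem_image_of_mem _ hn))),
    smul_zero]

/-- A subspace of matrices containing the central generator acts densely if it approximates every
matrix on finitely many rows, with uniformly bounded width. -/
theorem exists_apply_eq {L L' : Type*} [AddCommGroup L] [Module ℂ L] [LieSuperalgebra L]
    [AddCommGroup L'] [Module ℂ L'] {ρ : L →ₗ[ℂ] Module.End ℂ V} {ξ : Module.Dual ℂ (gr L 0)}
    {ι : L →ₗ[ℂ] GlHat} (h : IsIrreducibleHighestWeight ρ ξ) (hι : Function.Injective ι)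
    (hcomp : ∀ i x, ι (HalfGraded.comp i x) = HalfGraded.comp i (ι x))
    (hbr : ∀ x y, ι (LieSuperalgebra.bracket x y) = LieSuperalgebra.bracket (ι x) (ι y))
    (hξ : ∃ N, ∀ x : gr L 0, Far N (ι x) → ξ x = 0) (f : L' →ₗ[ℂ] L)
    (hf : ∀ x, ∃ K : ℤ, ∀ M : ℤ, ∃ y,
      (∀ m n, K < |m - n| → (CentralExt.base Gl.cocycle (ι (f y))).1 m n = 0) ∧
      (∀ m n, |m| ≤ M → (CentralExt.base Gl.cocycle (ι (f y))).1 m n =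
        (CentralExt.base Gl.cocycle (ι x)).1 m n) ∧
      CentralExt.coeff Gl.cocycle (ι (f y)) = CentralExt.coeff Gl.cocycle (ι x)) (x : L) (w : V) :
    ∃ y, ρ (f y) w = ρ x w := by
  obtain ⟨K, hK⟩ := hf x
  obtain ⟨N, hN0, hN⟩ := (CentralExt.base Gl.cocycle (ι x)).exists_band
  -- The window depends only on `w` and on a common width for `x` and all its approximations; the
  -- approximation is chosen afterwards, and its difference from `x` kills `w`.
  obtain ⟨M, hM⟩ := h.exists_far_apply_eq_zero_of_band hι hcomp hbr hξ w (max K N)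
  obtain ⟨y, h1, h2, h3⟩ := hK M
  refine ⟨y, ?_⟩
  have entry : ∀ m n, (CentralExt.base Gl.cocycle (ι (f y - x))).1 m n =
      (CentralExt.base Gl.cocycle (ι (f y))).1 m n -
        (CentralExt.base Gl.cocycle (ι x)).1 m n := by
    intro m n
    rw [map_sub, map_sub]
    rfl
  rw [← sub_eq_zero, ← LinearMap.sub_apply, ← map_sub]
  refine hM _ (fun m n hmn => ?_) ⟨?_, fun m n hm => ?_⟩
  · rw [entry, h1 m n (lt_of_le_of_lt (le_max_left _ _) hmn),
      hN m n (lt_of_le_of_lt (le_max_right _ _) hmn), sub_zero]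
  · rw [map_sub, map_sub, h3, sub_self]
  · rw [entry, h2 m n hm, sub_self]

theorem phiHat_dense (s c : ℂ) (l : ℤ →₀ ℂ) {ρ : GlHat →ₗ[ℂ] Module.End ℂ V}
    (h : IsIrreducibleHighestWeight ρ (glWeight l c)) (x : GlHat) (w : V) :
    ∃ y, ρ (phiHat s y) w = ρ x w := by
  refine exists_apply_eq (ι := LinearMap.id) h Function.injective_id (fun _ _ => rfl)
    (fun _ _ => rfl) (glWeight_eq_zero_of_far l c) (phiHat s) (fun x => ?_) x w
  -- Only the interpolation at `s` is used. The value `s + 1/2` is any second parameter outside the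
  -- coset of `s` modulo the integers.
  have hs : ∀ k : ℤ, s - (s + 1 / 2) ≠ k := by
    intro k hk
    have h2 : ((-1 : ℤ) : ℂ) = ((2 * k : ℤ) : ℂ) := by
      push_cast
      linear_combination 2 * hk
    have := Int.cast_injective h2
    omega
  obtain ⟨K, hK⟩ := SD.exists_phi_eq hs (CentralExt.base Gl.cocycle x) 0
  refine ⟨K, fun M => ?_⟩
  obtain ⟨y, h1, h2, -⟩ := hK M
  -- The central coordinate is free in the source, so it is chosen to cancel the correction
  -- `χ_s(y)`.
  refine ⟨CentralExt.mk SD.cocycle y (CentralExt.coeff Gl.cocycle x - SD.chi s y), h1 s, h2, ?_⟩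
  rw [LinearMap.id_apply, LinearMap.id_apply, coeff_phiHat, CentralExt.base_mk,
    CentralExt.coeff_mk, add_sub_cancel]

/-- Since `σ` is an involution, antisymmetrising any operator lands in the fixed point subalgebra,
so interpolation can be carried out in the whole algebra first. -/
theorem sub_sigma_mem (y : SD) (z : ℂ) :
    CentralExt.mk SD.cocycle (y - SD.sigma y) z ∈ zeroSDHat.carrier := by
  rw [mem_zeroSDHat, CentralExt.base_mk, map_sub, SD.sigma_sigma, neg_sub]

theorem phi_sub_sigma_apply (s : ℂ) (y : SD) (m n : ℤ) :
    (SD.phi s (y - SD.sigma y)).1 m n = (SD.phi s y).1 m n - superSign (n - m) n *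
      parSign (SD.idx m) * parSign (SD.idx n) * (SD.phi (-s) y).1 (-n) (-m) := by
  rw [map_sub, SD.phi_sigma_eq_tau]
  rfl

/-- The image of `y - σ(y)` is `φ_s(y) - τ(φ_{-s}(y))`. Because `2s` is not an integer, `y` can be
chosen with the first term equal to the given matrix and the second equal to zero on the window. -/
theorem phiHatZero_dense (s c : ℂ) (hs : ∀ k : ℤ, s ≠ k / 2) (l : ℤ →₀ ℂ)
    {ρ : GlHat →ₗ[ℂ] Module.End ℂ V}
    (h : IsIrreducibleHighestWeight ρ (glWeight l c)) (x : GlHat) (w : V) :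
    ∃ y, ρ (phiHatZero s y) w = ρ x w := by
  refine exists_apply_eq (ι := LinearMap.id) h Function.injective_id (fun _ _ => rfl)
    (fun _ _ => rfl) (glWeight_eq_zero_of_far l c) (phiHatZero s) (fun x => ?_) x w
  have hs' : ∀ k : ℤ, s - -s ≠ k := fun k hk => hs k (by linear_combination hk / 2)
  obtain ⟨K, hK⟩ := SD.exists_phi_eq hs' (CentralExt.base Gl.cocycle x) 0
  refine ⟨K, fun M => ?_⟩
  -- The map `τ` exchanges the place `(m, n)` with `(-n, -m)`, so columns of the window become rows;
  -- within the band they satisfy `|n| ≤ |M| + |K|`.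
  obtain ⟨y, h1, h2, h3⟩ := hK (|M| + |K|)
  have hle := le_abs_self M
  have hle' := le_abs_self K
  have hnn := abs_nonneg K
  have hband : ∀ m n, K < |m - n| → (SD.phi s (y - SD.sigma y)).1 m n = 0 := by
    intro m n hmn
    rw [phi_sub_sigma_apply, h1 s m n hmn,
      h1 (-s) (-n) (-m) (by rwa [show -n - -m = m - n by ring]), mul_zero, sub_zero]
  refine ⟨⟨CentralExt.mk SD.cocycle (y - SD.sigma y) (CentralExt.coeff Gl.cocycle x -
    SD.chi s (y - SD.sigma y)), sub_sigma_mem _ _⟩, hband, fun m n hm => ?_, ?_⟩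
  · change (SD.phi s (y - SD.sigma y)).1 m n = (CentralExt.base Gl.cocycle x).1 m n
    rw [phi_sub_sigma_apply, h2 m n (by omega)]
    have : (SD.phi (-s) y).1 (-n) (-m) = 0 := by
      by_cases hmn : K < |m - n|
      · exact h1 (-s) (-n) (-m) (by rwa [show -n - -m = m - n by ring])
      · refine h3 (-n) (-m) ?_
        rw [abs_neg]
        have := abs_sub_abs_le_abs_sub n m
        rw [abs_sub_comm] at this
        omega
    rw [this, mul_zero, sub_zero]
  · change SD.chi s (y - SD.sigma y) + (CentralExt.coeff Gl.cocycle x -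
      SD.chi s (y - SD.sigma y)) = _
    exact add_sub_cancel _ _

/-- At `s = 0` the two terms `φ_0(y)` and `τ(φ_0(y))` cannot be chosen independently. Since `τ(A) =
-A`, interpolating `A/2` makes their difference equal to `A`. -/
theorem phiHatB_dense (c : ℂ) (l : ℕ+ →₀ ℂ) {ρ : BHat →ₗ[ℂ] Module.End ℂ V}
    (h : IsIrreducibleHighestWeight ρ (bWeight l c)) (x : BHat) (w : V) :
    ∃ y, ρ (phiHatB y) w = ρ x w := by
  refine exists_apply_eq (ι := bHat.carrier.subtype) h Subtype.val_injective (fun _ _ => rfl)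
    (fun _ _ => rfl) (bWeight_eq_zero_of_far l c) phiHatB (fun x => ?_) x w
  have hs : ∀ k : ℤ, (0 : ℂ) - 1 / 2 ≠ k := by
    intro k hk
    have h2 : ((-1 : ℤ) : ℂ) = ((2 * k : ℤ) : ℂ) := by
      push_cast
      linear_combination 2 * hk
    have := Int.cast_injective h2
    omega
  set A := CentralExt.base Gl.cocycle (x : GlHat) with hA
  have htau : Gl.tau A = -A := Gl.mem_ospSubspace.1 x.2
  obtain ⟨K, hK⟩ := SD.exists_phi_eq hs ((1 / 2 : ℂ) • A) 0
  refine ⟨K, fun M => ?_⟩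
  obtain ⟨y, h1, h2, -⟩ := hK (|M| + |K|)
  have hle := le_abs_self M
  have hle' := le_abs_self K
  have hnn := abs_nonneg K
  have hband : ∀ m n, K < |m - n| → (SD.phi 0 (y - SD.sigma y)).1 m n = 0 := by
    intro m n hmn
    rw [phi_sub_sigma_apply, h1 0 m n hmn,
      h1 (-0) (-n) (-m) (by rwa [show -n - -m = m - n by ring]), mul_zero, sub_zero]
  have happ : ∀ m n, |m| ≤ M → (SD.phi 0 (y - SD.sigma y)).1 m n = A.1 m n := by
    intro m n hm
    have hA1 := congrArg (fun T : Gl => T.1 m n) htau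
    change superSign (n - m) n * parSign (SD.idx m) * parSign (SD.idx n) * A.1 (-n) (-m) =
      -(A.1 m n) at hA1
    -- Outside the band the interpolant vanishes; as it equals `A/2` on the window, so does the
    -- entry of `A`. Inside the band both places lie in the enlarged window.
    by_cases hmn : K < |m - n|
    · have e1 := h1 0 m n hmn
      rw [h2 m n (by omega)] at e1
      change (1 / 2 : ℂ) * A.1 m n = 0 at e1
      rw [hband m n hmn]
      linear_combination -2 * e1
    · rw [phi_sub_sigma_apply, neg_zero, h2 m n (by omega), h2 (-n) (-m) (by
        rw [abs_neg]
        have := abs_sub_abs_le_abs_sub n m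
        rw [abs_sub_comm] at this
        omega)]
      change (1 / 2 : ℂ) * A.1 m n - _ * ((1 / 2 : ℂ) * A.1 (-n) (-m)) = _
      linear_combination -(1 / 2) * hA1
  refine ⟨⟨CentralExt.mk SD.cocycle (y - SD.sigma y) (CentralExt.coeff Gl.cocycle (x : GlHat) -
    SD.chi 0 (y - SD.sigma y)), sub_sigma_mem _ _⟩, hband, happ, ?_⟩
  change SD.chi 0 (y - SD.sigma y) + (CentralExt.coeff Gl.cocycle (x : GlHat) -
    SD.chi 0 (y - SD.sigma y)) = _
  exact add_sub_cancel _ _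

/-! ### The maps on the fixed point algebra as graded homomorphisms. -/

theorem phiHatZero_mem_gr (s : ℂ) (i : ℤ) (x : ZeroSDHat) (hx : x ∈ gr ZeroSDHat i) :
    phiHatZero s x ∈ gr GlHat i :=
  phiHat_mem_gr s i x ((mem_gr_sub_iff zeroSDHat.carrier (fun _ _ => rfl)).1 hx)

theorem phiHatZero_bracket (s : ℂ) (i j : ℤ) (x y : ZeroSDHat) (hx : x ∈ gr ZeroSDHat i)
    (hy : y ∈ gr ZeroSDHat j) : phiHatZero s (LieSuperalgebra.bracket x y) =
      LieSuperalgebra.bracket (phiHatZero s x) (phiHatZero s y) :=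
  phiHat_bracket s i j x y ((mem_gr_sub_iff zeroSDHat.carrier (fun _ _ => rfl)).1 hx)
    ((mem_gr_sub_iff zeroSDHat.carrier (fun _ _ => rfl)).1 hy)

theorem phiHatB_mem_gr (i : ℤ) (x : ZeroSDHat) (hx : x ∈ gr ZeroSDHat i) :
    phiHatB x ∈ gr BHat i :=
  (mem_gr_sub_iff bHat.carrier (fun _ _ => rfl)).2 (phiHatZero_mem_gr 0 i x hx)

theorem phiHatB_bracket (i j : ℤ) (x y : ZeroSDHat) (hx : x ∈ gr ZeroSDHat i)
    (hy : y ∈ gr ZeroSDHat j) : phiHatB (LieSuperalgebra.bracket x y) =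
      LieSuperalgebra.bracket (phiHatB x) (phiHatB y) :=
  Subtype.ext (phiHatZero_bracket 0 i j x y hx hy)

end Dense

/-! ## Exponential generating functions of functionals on polynomials -/

/-- The power series `ℓ(e^{xD})` of a functional `ℓ` on polynomials in `D`. -/
def egf : Module.Dual ℂ ℂ[X] →ₗ[ℂ] PowerSeries ℂ where
  toFun ℓ := PowerSeries.mk fun n => (n.factorial : ℂ)⁻¹ * ℓ (X ^ n)
  map_add' ℓ ℓ' := by
    ext n
    simp [mul_add]
  map_smul' a ℓ := by
    ext n
    simp [mul_left_comm]

theorem coeff_egf (ℓ : Module.Dual ℂ ℂ[X]) (n : ℕ) :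
    PowerSeries.coeff n (egf ℓ) = (n.factorial : ℂ)⁻¹ * ℓ (X ^ n) :=
  PowerSeries.coeff_mk n fun n => (n.factorial : ℂ)⁻¹ * ℓ (X ^ n)

/-- The coefficients of the series are the values on monomials up to factorials. This is what makes
a weight determined by its generating functions. -/
theorem egf_injective : Function.Injective egf := by
  intro ℓ ℓ' h
  refine (Polynomial.basisMonomials ℂ).ext fun n => ?_
  have hn := congrArg (PowerSeries.coeff n) h
  rw [coeff_egf, coeff_egf] at hn
  have hf : ((n.factorial : ℂ)⁻¹) ≠ 0 := inv_ne_zero (Nat.cast_ne_zero.2 n.factorial_ne_zero)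
  rw [Polynomial.coe_basisMonomials]
  simp only [← Polynomial.X_pow_eq_monomial]
  exact mul_left_cancel₀ hf hn

theorem coeff_expS (a : ℂ) (n : ℕ) :
    PowerSeries.coeff n (expS a) = (n.factorial : ℂ)⁻¹ * a ^ n := by
  rw [expS, PowerSeries.coeff_rescale, PowerSeries.coeff_exp]
  simp [mul_comm]

theorem egf_leval (z : ℂ) : egf (Polynomial.leval z) = expS z := by
  ext n
  rw [coeff_egf, coeff_expS]
  simp

theorem expS_add (a b : ℂ) : expS (a + b) = expS a * expS b :=
  (PowerSeries.exp_mul_exp_eq_exp_add a b).symm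

theorem expS_zero : expS 0 = 1 := by
  rw [← egf_leval]
  ext n
  rw [coeff_egf, PowerSeries.coeff_one]
  by_cases h : n = 0 <;> simp [h]

/-- This is `e^{x(D + a)} = e^{xa} e^{xD}`, that is, the binomial theorem coefficient by
coefficient. -/
theorem egf_comp_shift (ℓ : Module.Dual ℂ ℂ[X]) (a : ℂ) :
    egf (ℓ ∘ₗ (SD.shift a).toLinearMap) = expS a * egf ℓ := by
  ext n
  rw [coeff_egf, PowerSeries.coeff_mul]
  simp only [coeff_egf, coeff_expS, LinearMap.comp_apply, AlgHom.toLinearMap_apply]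
  rw [map_pow, SD.shift, aeval_X, add_comm, (Commute.all (C a) X).add_pow', map_sum, Finset.mul_sum]
  refine Finset.sum_congr rfl fun m hm => ?_
  rw [Finset.HasAntidiagonal.mem_antidiagonal] at hm
  have hc : ((n.choose m.1 : ℂ)) = n.factorial * ((m.1.factorial : ℂ)⁻¹ * (m.2.factorial : ℂ)⁻¹) := by
    rw [← hm, Nat.cast_add_choose, div_eq_mul_inv, mul_inv]
  have hn : (n.factorial : ℂ) ≠ 0 := Nat.cast_ne_zero.2 n.factorial_ne_zero
  rw [← C_pow, ← Polynomial.smul_eq_C_mul, map_nsmul, map_smul, nsmul_eq_mul, hc, smul_eq_mul,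
    mul_assoc, inv_mul_cancel_left₀ hn]
  ring

theorem egf_comp_reflect (ℓ : Module.Dual ℂ ℂ[X]) :
    egf (ℓ ∘ₗ (SD.reflect 0).toLinearMap) = PowerSeries.rescale (-1) (egf ℓ) := by
  ext n
  rw [PowerSeries.coeff_rescale, coeff_egf, coeff_egf, LinearMap.comp_apply,
    AlgHom.toLinearMap_apply, map_pow, SD.reflect, aeval_X, C_0, add_zero, neg_pow]
  have : ((-1 : ℂ[X]) ^ n * X ^ n) = ((-1 : ℂ) ^ n) • X ^ n := by
    rw [Polynomial.smul_eq_C_mul]; simp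
  rw [this, map_smul, smul_eq_mul]
  ring

/-- The functional `f ↦ h(s) - h(0)`, where `h(w) - h(w + 1) = f(w)`. -/
def antidiffEval (s : ℂ) : Module.Dual ℂ ℂ[X] :=
  (Polynomial.leval s - Polynomial.leval 0) ∘ₗ SD.antidiff

/-- The functional `f ↦ h(s) - h(0)` becomes evaluation at `s` minus evaluation at `0` when composed
with the difference operator, and on series that operator is multiplication by `1 - e^x`. -/
theorem egf_antidiffEval (s : ℂ) : egf (antidiffEval s) * (1 - expS 1) = expS s - 1 := by
  have h : antidiffEval s - antidiffEval s ∘ₗ (SD.shift 1).toLinearMap =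
      Polynomial.leval s - Polynomial.leval 0 := by
    refine LinearMap.ext fun f => ?_
    have := SD.antidiff_sub_shift_eval f s
    rw [map_sub, eval_sub, eval_sub] at this
    simp only [antidiffEval, LinearMap.sub_apply, LinearMap.comp_apply, Polynomial.leval_apply,
      AlgHom.toLinearMap_apply]
    linear_combination this
  have h2 := congrArg egf h
  rw [map_sub, map_sub, egf_comp_shift, egf_leval, egf_leval, expS_zero] at h2
  rw [← h2]
  ring

/-! ### Odd parts, for the hyperbolic generating functions. -/

/-- The odd part of a power series. -/
def oddS : PowerSeries ℂ →ₗ[ℂ] PowerSeries ℂ where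
  toFun E := (1 / 2 : ℂ) • (E - PowerSeries.rescale (-1) E)
  map_add' E E' := by
    rw [map_add, ← smul_add]; congr 1; ring
  map_smul' a E := by
    ext n
    simp [PowerSeries.coeff_rescale]
    ring

theorem oddS_apply (E : PowerSeries ℂ) :
    oddS E = (1 / 2 : ℂ) • (E - PowerSeries.rescale (-1) E) := rfl

theorem rescale_expS (a : ℂ) : PowerSeries.rescale (-1) (expS a) = expS (-a) := by
  ext n
  rw [PowerSeries.coeff_rescale, coeff_expS, coeff_expS, neg_pow]
  ring

theorem oddS_expS (a : ℂ) : oddS (expS a) = sinhS a := by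
  rw [oddS_apply, rescale_expS, sinhS]

/-- The odd part of a polynomial. -/
def oddPart : ℂ[X] →ₗ[ℂ] ℂ[X] := (1 / 2 : ℂ) • (LinearMap.id - (SD.reflect 0).toLinearMap)

theorem egf_comp_oddPart (ℓ : Module.Dual ℂ ℂ[X]) : egf (ℓ ∘ₗ oddPart) = oddS (egf ℓ) := by
  rw [oddPart, LinearMap.comp_smul, LinearMap.comp_sub, map_smul, map_sub, LinearMap.comp_id,
    egf_comp_reflect, oddS_apply]

theorem oddPart_X_pow (n : ℕ) : oddPart (X ^ n) = sinhCoeff X n := by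
  simp [oddPart, sinhCoeff, SD.reflect]

theorem shift_oddPart_X_pow (n : ℕ) :
    SD.shift (1 / 2) (oddPart (X ^ n)) = sinhCoeff (X + C (1 / 2)) n := by
  rw [oddPart_X_pow, map_sinhCoeff]
  simp [SD.shift]

/-- The series of the functional is `-(e^{(s - 1/2)x} - e^{-x/2}) / (2 sinh(x/2))`. The denominator
is odd, so the odd part is obtained from the even part of the numerator, which is a difference of
hyperbolic cosines. -/
theorem oddS_egf_antidiffEval (s : ℂ) : oddS (egf (antidiffEval s)) * sinhS (1 / 2) =
    -((1 / 2 : ℂ) • (coshS (s - 1 / 2) - coshS (1 / 2))) := by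
  have h1 := egf_antidiffEval s
  have h2 := congrArg (PowerSeries.rescale (-1)) h1
  rw [map_mul, map_sub, map_sub, map_one, rescale_expS, rescale_expS] at h2
  have e1 : expS 1 = expS (1 / 2) * expS (1 / 2) := by rw [← expS_add]; norm_num
  have e2 : expS (-1) = expS (-(1 / 2)) * expS (-(1 / 2)) := by rw [← expS_add]; norm_num
  have e3 : expS (1 / 2) * expS (-(1 / 2)) = 1 := by rw [← expS_add, add_neg_cancel, expS_zero]
  have e4 : expS (s - 1 / 2) = expS s * expS (-(1 / 2)) := by rw [← expS_add]; rfl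
  have e5 : expS (-(s - 1 / 2)) = expS (-s) * expS (1 / 2) := by
    rw [← expS_add]; congr 1; ring
  rw [e1] at h1
  rw [e2] at h2
  simp only [oddS_apply, sinhS, coshS, e4, e5, PowerSeries.smul_eq_C_mul]
  -- What is left is an algebraic identity in `u = e^{x/2}`, `u' = e^{-x/2}` and the series `E`,
  -- `E'`, `e^{sx}` and `e^{-sx}`, modulo `u u' = 1` and the two functional equations.
  generalize PowerSeries.C (1 / 2 : ℂ) = k at *
  generalize egf (antidiffEval s) = E at *
  generalize PowerSeries.rescale (-1) E = E' at *
  generalize expS (1 / 2) = u at *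
  generalize expS (-(1 / 2)) = u' at *
  linear_combination -k * k * u' * h1 - k * k * u * h2 -
    (k * k * u * E + k * k * u' * E') * e3

/-- The factor `e^{x/2}` recentres the numerator to `e^{sx} - 1`, whose even part is `cosh(sx) - 1`.
-/
theorem oddS_expS_mul_egf_antidiffEval (s : ℂ) :
    oddS (expS (1 / 2) * egf (antidiffEval s)) * sinhS (1 / 2) =
      -((1 / 2 : ℂ) • (coshS s - 1)) := by
  have h1 := egf_antidiffEval s
  have h2 := congrArg (PowerSeries.rescale (-1)) h1
  rw [map_mul, map_sub, map_sub, map_one, rescale_expS, rescale_expS] at h2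
  have e1 : expS 1 = expS (1 / 2) * expS (1 / 2) := by rw [← expS_add]; norm_num
  have e2 : expS (-1) = expS (-(1 / 2)) * expS (-(1 / 2)) := by rw [← expS_add]; norm_num
  have e3 : expS (1 / 2) * expS (-(1 / 2)) = 1 := by rw [← expS_add, add_neg_cancel, expS_zero]
  rw [e1] at h1
  rw [e2] at h2
  simp only [oddS_apply, sinhS, coshS, PowerSeries.smul_eq_C_mul, map_mul, rescale_expS]
  have hh : (PowerSeries.C (1 / 2 : ℂ)) * 2 = 1 := by
    rw [show (2 : PowerSeries ℂ) = PowerSeries.C 2 from (map_ofNat _ 2).symm, ← map_mul]; norm_num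
  generalize PowerSeries.C (1 / 2 : ℂ) = k at *
  generalize egf (antidiffEval s) = E at *
  generalize PowerSeries.rescale (-1) E = E' at *
  generalize expS (1 / 2) = u at *
  generalize expS (-(1 / 2)) = u' at *
  linear_combination -k * k * h1 - k * k * h2 + k * hh - k * k * (E + E') * e3

/-! ## Reindexing sums over weights -/

/-- Labels are finitely supported on doubled indices, while the formulas run over integers or over
half-integers only. Along an injection whose range contains every relevant index the two sums agree.
-/
theorem finsuppSum_smul_eq_finsum {ι κ M : Type*} [AddCommGroup M] [Module ℂ M] (l : κ →₀ ℂ)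
    (F : κ → M) {e : ι → κ} (he : Function.Injective e) (hF : ∀ n, n ∉ Set.range e → F n = 0) :
    (l.sum fun n b => b • F n) = ∑ᶠ i, l (e i) • F (e i) := by
  rw [← finsum_mem_range (f := fun n => l n • F n) he, finsum_mem_def, Set.indicator_eq_self.2]
  · rw [finsum_eq_sum_of_support_subset (s := l.support)]
    · rfl
    · intro n hn
      rw [Finset.mem_coe, Finsupp.mem_support_iff]
      intro h
      exact hn (by simp [h])
  · intro n hn
    by_contra h
    exact hn (by simp [hF n h])

/-- Summation by parts: shifting the label index by one multiplies the sum of exponentials by `e^x`,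
and the Kronecker term contributes `c e^{sx}`. -/
theorem finsum_sub_shift_smul_expS {a : ℤ → ℂ} (ha : (Function.support a).Finite) (c s : ℂ) :
    ∑ᶠ i : ℤ, (a i - a (i + 1) + if i = 0 then c else 0) • expS (-i + s) =
      (1 - expS 1) * ∑ᶠ i : ℤ, a i • expS (-i + s) + c • expS s := by
  have f1 : (Function.support fun i : ℤ => a i • expS (-i + s)).Finite :=
    ha.subset fun i hi h => hi (by simp [h])
  have f2 : (Function.support fun i : ℤ => a (i + 1) • expS (-i + s)).Finite :=
    (ha.preimage (f := fun i : ℤ => i + 1) (add_left_injective 1).injOn).subset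
      fun i hi h => hi (by simp [h])
  have f3 : (Function.support fun i : ℤ => (if i = 0 then c else 0) • expS (-i + s)).Finite :=
    (Set.finite_singleton 0).subset fun i hi => by
      by_contra h
      exact hi (by
        have h' : i ≠ 0 := h
        simp [h'])
  have s2 : ∑ᶠ i : ℤ, a (i + 1) • expS (-i + s) = expS 1 * ∑ᶠ i : ℤ, a i • expS (-i + s) := by
    rw [mul_finsum, ← finsum_comp_equiv (Equiv.addRight (1 : ℤ))
      (f := fun i : ℤ => expS 1 * a i • expS (-i + s))]
    refine finsum_congr fun i => ?_
    rw [Equiv.coe_addRight, mul_smul_comm, ← expS_add]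
    congr 2
    push_cast
    ring
  have s3 : ∑ᶠ i : ℤ, (if i = 0 then c else 0) • expS (-i + s) = c • expS s := by
    rw [finsum_eq_single _ 0 fun i hi => by simp [hi]]
    simp
  simp only [add_smul, sub_smul]
  rw [finsum_add_distrib ((f1.union f2).subset (Function.support_sub _ _)) f3,
    finsum_sub_distrib f1 f2, s2, s3]
  ring

/-! ## The degree zero components -/

/-- The map `f ↦ f(D) M_{aa}`, linear in `f`. -/
def sdDiagLin (a : Fin 2) : ℂ[X] →ₗ[ℂ] SDHat where
  toFun := sdDiag a
  map_add' f g := CentralExt.ext _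
    (by simp only [sdDiag, CentralExt.base_mk, Matrix.single_add, map_add])
    (by simp [sdDiag])
  map_smul' z f := CentralExt.ext _
    (by simp only [sdDiag, CentralExt.base_mk, ← Matrix.smul_single, map_smul, RingHom.id_apply])
    (by simp [sdDiag])

theorem sdDiagLin_apply (a : Fin 2) (f : ℂ[X]) : sdDiagLin a f = sdDiag a f := rfl

/-- Degree zero means `2k + a - b = 0` with `a, b ∈ {0, 1}`, which forces `k = 0` and `a = b`. -/
theorem eq_sdDiag_add {x : SDHat} (hx : x ∈ gr SDHat 0) :
    x = sdDiag 0 (SD.coeff 0 (CentralExt.base SD.cocycle x) 0 0) +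
      sdDiag 1 (SD.coeff 0 (CentralExt.base SD.cocycle x) 1 1) +
      CentralExt.coeff SD.cocycle x • sdC := by
  rw [CentralExt.mem_gr, SD.mem_gr] at hx
  refine CentralExt.ext _ (SD.ext fun k a b => ?_) (by simp [sdDiag, sdC])
  simp only [map_add, map_smul, sdDiag, sdC, CentralExt.base_mk, smul_zero, add_zero, SD.coeff_term,
    Matrix.add_apply]
  by_cases hk : k = 0
  · subst hk
    by_cases hab : a = b
    · subst hab
      fin_cases a <;> simp
    · rw [hx.1 0 a b (by fin_cases a <;> fin_cases b <;> simp_all)]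
      fin_cases a <;> fin_cases b <;> simp_all
  · rw [hx.1 k a b (by have := a.2; have := b.2; omega), if_neg (Ne.symm hk), if_neg (Ne.symm hk)]
    simp

/-- The map `f ↦ f(D) M_{aa}` to the component of degree zero. -/
def sdDiagGr (a : Fin 2) : ℂ[X] →ₗ[ℂ] gr SDHat 0 :=
  (sdDiagLin a).codRestrict _ (sdDiag_mem a)

theorem sdDelta_eq (ξ : Module.Dual ℂ (gr SDHat 0)) (a : Fin 2) :
    sdDelta ξ a = -egf (ξ ∘ₗ sdDiagGr a) := by
  ext n
  rw [sdDelta, PowerSeries.coeff_mk, map_neg, coeff_egf]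
  rfl

theorem dual_gr_sdHat_ext {ξ ξ' : Module.Dual ℂ (gr SDHat 0)} (hC : ξ sdC₀ = ξ' sdC₀)
    (h : ∀ a, sdDelta ξ a = sdDelta ξ' a) : ξ = ξ' := by
  have hd : ∀ a, ξ ∘ₗ sdDiagGr a = ξ' ∘ₗ sdDiagGr a := fun a => egf_injective (by
    have := h a
    rwa [sdDelta_eq, sdDelta_eq, neg_inj] at this)
  refine LinearMap.ext fun x => ?_
  have hx : x = sdDiagGr 0 (SD.coeff 0 (CentralExt.base SD.cocycle (x : SDHat)) 0 0) +
      sdDiagGr 1 (SD.coeff 0 (CentralExt.base SD.cocycle (x : SDHat)) 1 1) +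
      CentralExt.coeff SD.cocycle (x : SDHat) • sdC₀ := Subtype.ext (eq_sdDiag_add x.2)
  rw [hx, map_add, map_add, map_add, map_add, map_smul, map_smul, hC]
  have h0 := fun f => congrArg (fun g : Module.Dual ℂ ℂ[X] => g f) (hd 0)
  have h1 := fun f => congrArg (fun g : Module.Dual ℂ ℂ[X] => g f) (hd 1)
  simp only [LinearMap.comp_apply] at h0 h1
  rw [h0, h1]

theorem reflect_zero_reflect_zero (f : ℂ[X]) : SD.reflect 0 (SD.reflect 0 f) = f :=
  Polynomial.funext fun z => by simp [SD.eval_reflect]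

theorem reflect_zero_oddPart (f : ℂ[X]) : SD.reflect 0 (oddPart f) = -oddPart f := by
  simp only [oddPart, LinearMap.smul_apply, LinearMap.sub_apply, LinearMap.id_apply, map_smul,
    map_sub, AlgHom.toLinearMap_apply, reflect_zero_reflect_zero]
  rw [← smul_neg, neg_sub]

/-- A shift by one half conjugates the reflection about `-1/2`, under which `σ` acts on the `θ ∂_θ`
part, into the reflection about `0`. This is why the second generating function uses `D + 1/2`. -/
theorem reflect_shift (f : ℂ[X]) :
    SD.reflect (-1) (SD.shift (1 / 2) f) = SD.shift (1 / 2) (SD.reflect 0 f) :=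
  Polynomial.funext fun z => by
    simp only [SD.eval_reflect, SD.eval_shift]
    congr 1; ring

theorem oddPart_eq_self {f : ℂ[X]} (h : SD.reflect 0 f = -f) : oddPart f = f := by
  rw [oddPart, LinearMap.smul_apply, LinearMap.sub_apply, AlgHom.toLinearMap_apply, h,
    LinearMap.id_apply, sub_neg_eq_add, ← two_smul ℂ f, smul_smul]
  norm_num

/-- The projection of `f(D) ∂_θ θ` to the fixed points. -/
def zeroDiag₀ : ℂ[X] →ₗ[ℂ] gr ZeroSDHat 0 :=
  ((sdDiagLin 0 ∘ₗ oddPart).codRestrict zeroSDHat.carrier fun f =>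
    sdDiag_mem_of_reflect (reflect_zero_oddPart f)).codRestrict _ fun f =>
      mem_gr_zeroSDHat _ (sdDiag_mem 0 (oddPart f))

/-- The projection of `f(D + 1/2) θ ∂_θ` to the fixed points. -/
def zeroDiag₁ : ℂ[X] →ₗ[ℂ] gr ZeroSDHat 0 :=
  ((sdDiagLin 1 ∘ₗ (SD.shift (1 / 2)).toLinearMap ∘ₗ oddPart).codRestrict zeroSDHat.carrier
    fun f => sdDiag_mem_of_reflect' (f := SD.shift (1 / 2) (oddPart f))
      (by rw [reflect_shift, reflect_zero_oddPart, map_neg])).codRestrict _ fun f =>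
      mem_gr_zeroSDHat _ (sdDiag_mem 1 (SD.shift (1 / 2) (oddPart f)))

theorem zeroDelta₀_eq (ξ : Module.Dual ℂ (gr ZeroSDHat 0)) :
    zeroDelta₀ ξ = -egf (ξ ∘ₗ zeroDiag₀) := by
  ext n
  rw [zeroDelta₀, PowerSeries.coeff_mk, map_neg, coeff_egf, LinearMap.comp_apply]
  congr 3
  refine Subtype.ext (Subtype.ext ?_)
  change sdDiag 0 _ = sdDiag 0 (oddPart (X ^ n))
  rw [oddPart_X_pow]

theorem zeroDelta₁_eq (ξ : Module.Dual ℂ (gr ZeroSDHat 0)) :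
    zeroDelta₁ ξ = -egf (ξ ∘ₗ zeroDiag₁) := by
  ext n
  rw [zeroDelta₁, PowerSeries.coeff_mk, map_neg, coeff_egf, LinearMap.comp_apply]
  congr 3
  refine Subtype.ext (Subtype.ext ?_)
  change sdDiag 1 _ = sdDiag 1 (SD.shift (1 / 2) (oddPart (X ^ n)))
  rw [shift_oddPart_X_pow]

/-- In degree zero `σ` acts on each diagonal coefficient by its own reflection, since off-diagonal
coefficients are sent to off-diagonal ones. -/
theorem reflect_coeff_of_mem {x : SDHat} (hx : x ∈ zeroSDHat.carrier) :
    SD.reflect 0 (SD.coeff 0 (CentralExt.base SD.cocycle x) 0 0) =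
        -SD.coeff 0 (CentralExt.base SD.cocycle x) 0 0 ∧
      SD.reflect (-1) (SD.coeff 0 (CentralExt.base SD.cocycle x) 1 1) =
        -SD.coeff 0 (CentralExt.base SD.cocycle x) 1 1 := by
  rw [mem_zeroSDHat] at hx
  generalize CentralExt.base SD.cocycle x = y at hx
  have key : ∀ y : SD, SD.coeff 0 (SD.sigma y) 0 0 = SD.reflect 0 (SD.coeff 0 y 0 0) ∧
      SD.coeff 0 (SD.sigma y) 1 1 = SD.reflect (-1) (SD.coeff 0 y 1 1) := by
    intro y
    refine SD.induction (p := fun y => SD.coeff 0 (SD.sigma y) 0 0 =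
      SD.reflect 0 (SD.coeff 0 y 0 0) ∧
      SD.coeff 0 (SD.sigma y) 1 1 = SD.reflect (-1) (SD.coeff 0 y 1 1)) y (by simp) ?_ ?_
    · intro y z hy hz
      simp only [map_add, Matrix.add_apply, hy.1, hy.2, hz.1, hz.2, and_self]
    · intro k F
      rw [SD.sigma_term]
      simp only [map_smul, map_add, map_sub, SD.coeff_term, Matrix.smul_apply, Matrix.add_apply,
        Matrix.sub_apply]
      by_cases hk : k = 0
      · subst hk
        simp [parSign]
      · simp only [if_neg hk]
        split_ifs <;> simp
  rw [← (key y).1, ← (key y).2, hx, map_neg]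
  exact ⟨rfl, rfl⟩

theorem dual_gr_zeroSDHat_ext {ξ ξ' : Module.Dual ℂ (gr ZeroSDHat 0)} (hC : ξ zeroC₀ = ξ' zeroC₀)
    (h₀ : zeroDelta₀ ξ = zeroDelta₀ ξ') (h₁ : zeroDelta₁ ξ = zeroDelta₁ ξ') : ξ = ξ' := by
  rw [zeroDelta₀_eq, zeroDelta₀_eq, neg_inj] at h₀
  rw [zeroDelta₁_eq, zeroDelta₁_eq, neg_inj] at h₁
  refine LinearMap.ext fun x => ?_
  set y : SDHat := ((x : ZeroSDHat) : SDHat) with hy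
  have hg : y ∈ gr SDHat 0 := (mem_gr_sub_iff zeroSDHat.carrier (fun _ _ => rfl)).1 x.2
  obtain ⟨hr₀, hr₁⟩ := reflect_coeff_of_mem (x : ZeroSDHat).2
  set f := SD.coeff 0 (CentralExt.base SD.cocycle y) 0 0 with hf
  set g := SD.coeff 0 (CentralExt.base SD.cocycle y) 1 1 with hgg
  have hs : SD.shift (1 / 2) (SD.shift (-(1 / 2)) g) = g := Polynomial.funext fun z => by
    rw [SD.eval_shift, SD.eval_shift, add_neg_cancel_right]
  have hr₂ : SD.reflect 0 (SD.shift (-(1 / 2)) g) = -SD.shift (-(1 / 2)) g := by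
    refine Polynomial.funext fun z => ?_
    have := congrArg (Polynomial.eval (z - 1 / 2)) hr₁
    rw [SD.eval_reflect, eval_neg] at this
    rw [SD.eval_reflect, eval_neg, SD.eval_shift, SD.eval_shift]
    refine Eq.trans ?_ this
    congr 1; ring
  -- Both coefficients are odd about their centres, so the projections to odd parts leave them
  -- unchanged, and `x` is a combination of elements seen by the generating functions and of `C`.
  have hx : x = zeroDiag₀ f + zeroDiag₁ (SD.shift (-(1 / 2)) g) +
      CentralExt.coeff SD.cocycle y • zeroC₀ := by
    refine Subtype.ext (Subtype.ext ?_)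
    change y = sdDiag 0 (oddPart f) + sdDiag 1 (SD.shift (1 / 2) (oddPart (SD.shift (-(1 / 2)) g))) +
      CentralExt.coeff SD.cocycle y • sdC
    rw [oddPart_eq_self hr₀, oddPart_eq_self hr₂, hs]
    exact eq_sdDiag_add hg
  have e0 := congrArg (fun φ : Module.Dual ℂ ℂ[X] => φ f) (egf_injective h₀)
  have e1 := congrArg (fun φ : Module.Dual ℂ ℂ[X] => φ (SD.shift (-(1 / 2)) g)) (egf_injective h₁)
  simp only [LinearMap.comp_apply] at e0 e1
  rw [hx, map_add, map_add, map_add, map_add, map_smul, map_smul, hC, e0, e1]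

/-! ## The generating functions of the pulled back weights -/

/-- The linear form `∑_n l_n (·)_{nn} + c · coeff` on `GlHat`. -/
def weightForm {κ : Type*} (j : κ → ℤ) (l : κ →₀ ℂ) (c : ℂ) : Module.Dual ℂ GlHat :=
  l.sum (fun n a => a • diagEntry (j n)) + c • CentralExt.coeff Gl.cocycle

theorem coeff_phiHat_sdDiag (s : ℂ) (f : ℂ[X]) :
    CentralExt.coeff Gl.cocycle (phiHat s (sdDiag 0 f)) = antidiffEval s f ∧
    CentralExt.coeff Gl.cocycle (phiHat s (sdDiag 1 f)) = -antidiffEval s f := by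
  rw [coeff_phiHat, coeff_phiHat, SD.chi_apply, SD.chi_apply]
  constructor
  · simp [sdDiag, SD.coeff_term, antidiffEval]
  · simp [sdDiag, SD.coeff_term, antidiffEval]
    ring

theorem diagEntry_phiHat_sdDiag (s : ℂ) (a : Fin 2) (f : ℂ[X]) (n : ℤ) :
    diagEntry n (phiHat s (sdDiag a f)) =
      if SD.par n = a then f.eval (-(SD.idx n : ℂ) + s) else 0 := by
  change (SD.phi s (SD.term 0 (Matrix.single a a f))).1 n n = _
  rw [SD.phi_apply, SD.coeff_term, sub_self, if_pos rfl, Matrix.single_apply]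
  by_cases h : SD.par n = a
  · simp [h]
  · rw [if_neg h, if_neg (fun h' => h h'.1.symm), eval_zero]

/-- Diagonal entries of parity `a` evaluate `D` at `-idx + s` and so contribute exponentials; the
central part contributes with the sign of the supertrace. The index map `j` allows one computation
for labels over all doubled indices and over the positive ones. -/
theorem egf_weightForm {κ : Type*} (j : κ → ℤ) (l : κ →₀ ℂ) (c s : ℂ) (a : Fin 2) :
    egf (weightForm j l c ∘ₗ phiHat s ∘ₗ sdDiagLin a) =
      (l.sum fun n b => b • if SD.par (j n) = a then expS (-(SD.idx (j n) : ℂ) + s) else 0) +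
        (if a = 0 then c else -c) • egf (antidiffEval s) := by
  have h : weightForm j l c ∘ₗ phiHat s ∘ₗ sdDiagLin a =
      (l.sum fun n b => b • if SD.par (j n) = a then
        Polynomial.leval (-(SD.idx (j n) : ℂ) + s) else 0) +
        (if a = 0 then c else -c) • antidiffEval s := by
    refine LinearMap.ext fun f => ?_
    rw [LinearMap.comp_apply, LinearMap.comp_apply, sdDiagLin_apply, weightForm,
      LinearMap.add_apply, LinearMap.add_apply]
    congr 1
    · rw [Finsupp.sum, Finsupp.sum, LinearMap.sum_apply, LinearMap.sum_apply]
      refine Finset.sum_congr rfl fun n _ => ?_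
      rw [LinearMap.smul_apply, LinearMap.smul_apply, diagEntry_phiHat_sdDiag]
      split_ifs <;> rfl
    · rw [LinearMap.smul_apply, LinearMap.smul_apply]
      have hc := coeff_phiHat_sdDiag s f
      fin_cases a
      · simp [hc.1]
      · simp [hc.2]
  rw [h, map_add, map_smul, map_finsuppSum]
  congr 1
  rw [Finsupp.sum, Finsupp.sum]
  refine Finset.sum_congr rfl fun n _ => ?_
  rw [map_smul]
  split_ifs
  · rw [egf_leval]
  · rw [map_zero]

theorem expS_one_sub_one_ne_zero : expS 1 - 1 ≠ 0 := by
  intro h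
  have := congrArg (PowerSeries.coeff 1) h
  rw [map_sub, coeff_expS, PowerSeries.coeff_one] at this
  simp at this

theorem sinhS_half_ne_zero : sinhS (1 / 2) ≠ 0 := by
  intro h
  have := congrArg (PowerSeries.coeff 1) h
  rw [sinhS, PowerSeries.coeff_smul, map_sub, coeff_expS, coeff_expS] at this
  norm_num at this

/-- The denominators in the formulas have zero constant term and are not invertible as power series.
Identities are proved with the denominator cleared and divided in the field of Laurent series. -/
theorem coe_eq_add_div {A P Q D : PowerSeries ℂ} (hD : D ≠ 0) (h : A * D = P * D + Q) :
    (A : LaurentSeries ℂ) = (P : LaurentSeries ℂ) + (Q : LaurentSeries ℂ) / (D : LaurentSeries ℂ) := by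
  have hD' : (D : LaurentSeries ℂ) ≠ 0 := fun h0 =>
    hD (HahnSeries.ofPowerSeries_injective (by rw [h0, map_zero]))
  rw [← sub_eq_iff_eq_add', eq_div_iff hD', sub_mul, sub_eq_iff_eq_add', ← map_mul, ← map_mul,
    ← map_add, h]

theorem coe_eq_sub_div {A P Q D : PowerSeries ℂ} (hD : D ≠ 0) (h : A * D = P * D - Q) :
    (A : LaurentSeries ℂ) = (P : LaurentSeries ℂ) - (Q : LaurentSeries ℂ) / (D : LaurentSeries ℂ) :=
  eq_sub_of_add_eq (coe_eq_add_div hD (by rw [h, sub_add_cancel])).symm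

theorem coe_eq_div {A Q D : PowerSeries ℂ} (hD : D ≠ 0) (h : A * D = Q) :
    (A : LaurentSeries ℂ) = (Q : LaurentSeries ℂ) / (D : LaurentSeries ℂ) := by
  have := coe_eq_add_div (P := 0) hD (by rw [h]; ring)
  rwa [map_zero, zero_add] at this

/-- The linear map `G` is a parameter so that one reindexing serves the plain series and its odd
part. -/
theorem finsum_even (l : ℤ →₀ ℂ) (s : ℂ) (G : PowerSeries ℂ →ₗ[ℂ] PowerSeries ℂ) :
    (l.sum fun n b => b • G (if SD.par n = 0 then expS (-(SD.idx n : ℂ) + s) else 0)) =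
      ∑ᶠ i : ℤ, l (2 * i) • G (expS (-i + s)) := by
  rw [finsuppSum_smul_eq_finsum l _ (e := fun i : ℤ => 2 * i) (fun a b h => by simpa using h)]
  · simp only [SD.par_two_mul, SD.idx_two_mul, if_true]
  · intro n hn
    rw [if_neg, map_zero]
    intro h
    have := SD.exists_idx n
    rw [h] at this
    exact hn ⟨SD.idx n, by simpa using this.symm⟩

theorem finsum_odd (l : ℤ →₀ ℂ) (s : ℂ) (G : PowerSeries ℂ →ₗ[ℂ] PowerSeries ℂ) :
    (l.sum fun n b => b • G (if SD.par n = 1 then expS (-(SD.idx n : ℂ) + s) else 0)) =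
      ∑ᶠ i : ℤ, l (2 * i - 1) • G (expS (-i + s)) := by
  rw [finsuppSum_smul_eq_finsum l _ (e := fun i : ℤ => 2 * i - 1) (fun a b h => by simpa using h)]
  · simp only [SD.par_two_mul_sub, SD.idx_two_mul_sub, if_true]
  · intro n hn
    rw [if_neg, map_zero]
    intro h
    have := SD.exists_idx n
    rw [h] at this
    exact hn ⟨SD.idx n, by simpa using this.symm⟩

theorem finsum_even_pnat (l : ℕ+ →₀ ℂ) (G : PowerSeries ℂ →ₗ[ℂ] PowerSeries ℂ) :
    (l.sum fun n b => b • G (if SD.par n = 0 then expS (-(SD.idx n : ℂ) + 0) else 0)) =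
      ∑ᶠ i : ℕ+, l (2 * i) • G (expS (-(i : ℂ))) := by
  rw [finsuppSum_smul_eq_finsum l _ (e := fun i : ℕ+ => 2 * i) (fun a b h => by simpa using h)]
  · refine finsum_congr fun i => ?_
    rw [show (((2 * i : ℕ+) : ℕ) : ℤ) = 2 * ((i : ℕ) : ℤ) by push_cast; rfl, SD.par_two_mul,
      SD.idx_two_mul, if_pos rfl, add_zero, Int.cast_natCast]
  · intro n hn
    rw [if_neg, map_zero]
    intro h
    have h1 := SD.exists_idx n
    rw [h] at h1
    simp only [Fin.val_zero, Nat.cast_zero, sub_zero] at h1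
    have hpos := n.pos
    let q : ℕ+ := ⟨(SD.idx n).toNat, by omega⟩
    exact hn ⟨q, PNat.eq (by
      change 2 * (SD.idx n).toNat = n
      omega)⟩

/-- The label at `r = i + 1/2` has doubled index `2i + 1`, which is the successor of `2i`; its `idx`
is `i + 1`. -/
theorem finsum_odd_pnat (l : ℕ+ →₀ ℂ) (G : PowerSeries ℂ →ₗ[ℂ] PowerSeries ℂ) :
    (l.sum fun n b => b • G (if SD.par n = 1 then expS (-(SD.idx n : ℂ) + 0) else 0)) =
      ∑ᶠ i : ℕ, l (Nat.succPNat (2 * i)) • G (expS (-((i : ℂ) + 1))) := by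
  rw [finsuppSum_smul_eq_finsum l _ (e := fun i : ℕ => Nat.succPNat (2 * i))
    (fun a b h => by simpa using h)]
  · refine finsum_congr fun i => ?_
    rw [show ((Nat.succPNat (2 * i) : ℕ) : ℤ) = 2 * ((i : ℤ) + 1) - 1 by
      rw [Nat.succPNat_coe]; push_cast; ring, SD.par_two_mul_sub, SD.idx_two_mul_sub, if_pos rfl,
      add_zero]
    push_cast
    rfl
  · intro n hn
    rw [if_neg, map_zero]
    intro h
    have h1 := SD.exists_idx n
    rw [h] at h1
    simp only [Fin.val_one, Nat.cast_one] at h1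
    have hpos := n.pos
    exact hn ⟨(SD.idx n - 1).toNat, PNat.eq (by
      rw [Nat.succPNat_coe]
      omega)⟩

/-- Multiplication of `e^{x/2}` followed by the odd part. -/
def oddShiftS : PowerSeries ℂ →ₗ[ℂ] PowerSeries ℂ := oddS ∘ₗ LinearMap.mulLeft ℂ (expS (1 / 2))

theorem oddShiftS_apply (E : PowerSeries ℂ) : oddShiftS E = oddS (expS (1 / 2) * E) := rfl

theorem oddShiftS_expS (a : ℂ) : oddShiftS (expS a) = sinhS (a + 1 / 2) := by
  rw [oddShiftS_apply, ← expS_add, oddS_expS, add_comm]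

theorem egf_weightForm_oddPart {κ : Type*} (j : κ → ℤ) (l : κ →₀ ℂ) (c s : ℂ) :
    egf (weightForm j l c ∘ₗ phiHat s ∘ₗ sdDiagLin 0 ∘ₗ oddPart) =
      (l.sum fun n b => b • oddS (if SD.par (j n) = 0 then
        expS (-(SD.idx (j n) : ℂ) + s) else 0)) + c • oddS (egf (antidiffEval s)) := by
  have := egf_comp_oddPart (weightForm j l c ∘ₗ phiHat s ∘ₗ sdDiagLin 0)
  rw [egf_weightForm, if_pos rfl, map_add, map_smul, map_finsuppSum] at this
  simpa only [map_smul, LinearMap.comp_assoc] using this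

theorem egf_weightForm_shift_oddPart {κ : Type*} (j : κ → ℤ) (l : κ →₀ ℂ) (c s : ℂ) :
    egf (weightForm j l c ∘ₗ phiHat s ∘ₗ sdDiagLin 1 ∘ₗ (SD.shift (1 / 2)).toLinearMap ∘ₗ oddPart) =
      (l.sum fun n b => b • oddShiftS (if SD.par (j n) = 1 then
        expS (-(SD.idx (j n) : ℂ) + s) else 0)) - c • oddShiftS (egf (antidiffEval s)) := by
  have := egf_comp_oddPart
    ((weightForm j l c ∘ₗ phiHat s ∘ₗ sdDiagLin 1) ∘ₗ (SD.shift (1 / 2)).toLinearMap)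
  rw [egf_comp_shift, ← oddShiftS_apply, egf_weightForm, if_neg (by decide), map_add, map_smul,
    map_finsuppSum, neg_smul, ← sub_eq_add_neg] at this
  simpa only [map_smul, LinearMap.comp_assoc] using this

theorem weightForm_phiHat_sdC {κ : Type*} (j : κ → ℤ) (l : κ →₀ ℂ) (c s : ℂ) :
    weightForm j l c (phiHat s sdC) = c := by
  have h1 : ∀ n, diagEntry n (phiHat s sdC) = 0 := by
    intro n
    change (SD.phi s (CentralExt.base SD.cocycle sdC)).1 n n = 0
    rw [sdC, CentralExt.base_mk, map_zero]
    rfl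
  rw [weightForm, LinearMap.add_apply, LinearMap.smul_apply, coeff_phiHat, Finsupp.sum,
    LinearMap.sum_apply, Finset.sum_eq_zero, sdC, CentralExt.base_mk, map_zero,
    CentralExt.coeff_mk]
  · simp
  · intro n _
    rw [LinearMap.smul_apply, h1, smul_zero]

/-! ### Generating functions of the three pulled back weights. -/

/-- The weight of `SDHat` obtained from the weight `Λ` of `GlHat`. -/
def pullWeight (s : ℂ) (Λ : Module.Dual ℂ (gr GlHat 0)) : Module.Dual ℂ (gr SDHat 0) :=
  Λ ∘ₗ (phiHat s).restrict (phiHat_mem_gr s 0)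

theorem pullWeight_comp_sdDiagGr (s c : ℂ) (l : ℤ →₀ ℂ) (a : Fin 2) :
    pullWeight s (glWeight l c) ∘ₗ sdDiagGr a = weightForm id l c ∘ₗ phiHat s ∘ₗ sdDiagLin a := rfl

theorem sdDelta_pullWeight_zero (s c : ℂ) (l : ℤ →₀ ℂ) :
    sdDelta (pullWeight s (glWeight l c)) 0 * (expS 1 - 1) =
      ∑ᶠ i : ℤ, (l (2 * i) - l (2 * i + 2) + if i = 0 then c else 0) • expS (-i + s) -
        PowerSeries.C c := by
  have h := finsum_even l s LinearMap.id
  have hd := finsum_sub_shift_smul_expS (a := fun i : ℤ => l (2 * i))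
    (l.hasFiniteSupport.preimage (f := fun i : ℤ => 2 * i) (fun a _ b _ h => by simpa using h)) c s
  simp only [mul_add, mul_one] at hd
  simp only [LinearMap.id_apply] at h
  rw [sdDelta_eq, pullWeight_comp_sdDiagGr, egf_weightForm, if_pos rfl]
  simp only [id_eq]
  rw [h, hd, PowerSeries.smul_eq_C_mul, PowerSeries.smul_eq_C_mul]
  -- The central contribution is `c(e^{sx} - 1)`: its exponential is the Kronecker term already
  -- absorbed in the sum, and the rest is `-c`.
  linear_combination PowerSeries.C c * egf_antidiffEval s

theorem sdDelta_pullWeight_one (s c : ℂ) (l : ℤ →₀ ℂ) :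
    sdDelta (pullWeight s (glWeight l c)) 1 * (expS 1 - 1) =
      ∑ᶠ i : ℤ, (l (2 * i - 1) - l (2 * i + 1) - if i = 0 then c else 0) • expS (-i + s) +
        PowerSeries.C c := by
  have h := finsum_odd l s LinearMap.id
  have hd := finsum_sub_shift_smul_expS (a := fun i : ℤ => l (2 * i - 1))
    (l.hasFiniteSupport.preimage (f := fun i : ℤ => 2 * i - 1) (fun a _ b _ h => by simpa using h))
    (-c) s
  have hsum : ∑ᶠ i : ℤ, (l (2 * i - 1) - l (2 * i + 1) - if i = 0 then c else 0) •
      expS (-i + s) = ∑ᶠ i : ℤ, (l (2 * i - 1) - l (2 * (i + 1) - 1) + if i = 0 then -c else 0) •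
      expS (-i + s) := by
    refine finsum_congr fun i => ?_
    rw [show 2 * (i + 1) - 1 = 2 * i + 1 by ring]
    congr 1
    split_ifs <;> ring
  simp only [LinearMap.id_apply] at h
  rw [sdDelta_eq, pullWeight_comp_sdDiagGr, egf_weightForm, if_neg (by decide)]
  simp only [id_eq]
  rw [h, hsum, hd, PowerSeries.smul_eq_C_mul, PowerSeries.smul_eq_C_mul, map_neg]
  linear_combination -PowerSeries.C c * egf_antidiffEval s

/-- The weight of `ZeroSDHat` obtained from the weight `Λ` of `GlHat`. -/
def pullWeightZero (s : ℂ) (Λ : Module.Dual ℂ (gr GlHat 0)) : Module.Dual ℂ (gr ZeroSDHat 0) :=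
  Λ ∘ₗ (phiHatZero s).restrict (phiHatZero_mem_gr s 0)

/-- The weight of `ZeroSDHat` obtained from the weight `Λ` of `BHat`. -/
def pullWeightB (Λ : Module.Dual ℂ (gr BHat 0)) : Module.Dual ℂ (gr ZeroSDHat 0) :=
  Λ ∘ₗ phiHatB.restrict (phiHatB_mem_gr 0)

theorem zeroDelta₀_pullWeightZero (s c : ℂ) (l : ℤ →₀ ℂ) :
    zeroDelta₀ (pullWeightZero s (glWeight l c)) * sinhS (1 / 2) =
      (-∑ᶠ i : ℤ, l (2 * i) • sinhS (-i + s)) * sinhS (1 / 2) +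
        (c / 2) • (coshS (s - 1 / 2) - coshS (1 / 2)) := by
  have h := finsum_even l s oddS
  simp only [oddS_expS] at h
  have hc : pullWeightZero s (glWeight l c) ∘ₗ zeroDiag₀ =
    weightForm id l c ∘ₗ phiHat s ∘ₗ sdDiagLin 0 ∘ₗ oddPart := rfl
  have he := oddS_egf_antidiffEval s
  rw [zeroDelta₀_eq, hc, egf_weightForm_oddPart]
  simp only [id_eq]
  rw [h, show c / 2 = c * (1 / 2) by ring, mul_smul, PowerSeries.smul_eq_C_mul _ c,
    PowerSeries.smul_eq_C_mul _ c]
  linear_combination -PowerSeries.C c * he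

theorem zeroDelta₁_pullWeightZero (s c : ℂ) (l : ℤ →₀ ℂ) :
    zeroDelta₁ (pullWeightZero s (glWeight l c)) * sinhS (1 / 2) =
      (-∑ᶠ i : ℤ, l (2 * i - 1) • sinhS (-((i : ℂ) - 1 / 2) + s)) * sinhS (1 / 2) -
        (c / 2) • (coshS s - 1) := by
  have h := finsum_odd l s oddShiftS
  -- The factor `e^{x/2}` turns the exponent `-i + s` into `-r + s` with `r = i - 1/2`.
  have harg : ∀ i : ℤ, -((i : ℂ) - 1 / 2) + s = -i + s + 1 / 2 := fun i => by ring
  simp only [oddShiftS_expS, ← harg] at h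
  have hc : pullWeightZero s (glWeight l c) ∘ₗ zeroDiag₁ = weightForm id l c ∘ₗ phiHat s ∘ₗ
    sdDiagLin 1 ∘ₗ (SD.shift (1 / 2)).toLinearMap ∘ₗ oddPart := rfl
  have he := oddS_expS_mul_egf_antidiffEval s
  rw [zeroDelta₁_eq, hc, egf_weightForm_shift_oddPart]
  simp only [id_eq]
  rw [h, show c / 2 = c * (1 / 2) by ring, mul_smul, PowerSeries.smul_eq_C_mul _ c,
    PowerSeries.smul_eq_C_mul _ c, oddShiftS_apply]
  linear_combination PowerSeries.C c * he

/-- At `s = 0` there is no central correction, so the central charge is absent from the formulas for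
`BHat`. -/
theorem antidiffEval_zero : antidiffEval 0 = 0 := by
  rw [antidiffEval, sub_self, LinearMap.zero_comp]

theorem zeroDelta₀_pullWeightB (c : ℂ) (l : ℕ+ →₀ ℂ) :
    zeroDelta₀ (pullWeightB (bWeight l c)) = -∑ᶠ i : ℕ+, l (2 * i) • sinhS (-(i : ℂ)) := by
  have h := finsum_even_pnat l oddS
  simp only [oddS_expS] at h
  have hc : pullWeightB (bWeight l c) ∘ₗ zeroDiag₀ =
    weightForm (fun n : ℕ+ => (n : ℤ)) l c ∘ₗ phiHat 0 ∘ₗ sdDiagLin 0 ∘ₗ oddPart := rfl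
  rw [zeroDelta₀_eq, hc, egf_weightForm_oddPart, h, antidiffEval_zero, map_zero, map_zero,
    smul_zero, add_zero]

theorem zeroDelta₁_pullWeightB (c : ℂ) (l : ℕ+ →₀ ℂ) :
    zeroDelta₁ (pullWeightB (bWeight l c)) =
      -∑ᶠ i : ℕ, l (Nat.succPNat (2 * i)) • sinhS (-((i : ℂ) + 1 / 2)) := by
  have h := finsum_odd_pnat l oddShiftS
  have harg : ∀ i : ℕ, -((i : ℂ) + 1) + 1 / 2 = -((i : ℂ) + 1 / 2) := fun i => by ring
  simp only [oddShiftS_expS, harg] at h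
  have hc : pullWeightB (bWeight l c) ∘ₗ zeroDiag₁ =
    weightForm (fun n : ℕ+ => (n : ℤ)) l c ∘ₗ phiHat 0 ∘ₗ sdDiagLin 1 ∘ₗ
      (SD.shift (1 / 2)).toLinearMap ∘ₗ oddPart := rfl
  rw [zeroDelta₁_eq, hc, egf_weightForm_shift_oddPart, h, antidiffEval_zero, map_zero, map_zero,
    smul_zero, sub_zero]

end SuperCircle

end

/-! ### Assembly of the three cases. -/

open SuperCircle
theorem mainTheorem9 {V : Type*} [AddCommGroup V] [Module ℂ V] :
    -- modules over the central extension of `gl_{∞|∞}`, pulled back to `SDHat`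
    (∀ (s c : ℂ) (l : ℤ →₀ ℂ) (ρ : GlHat →ₗ[ℂ] Module.End ℂ V),
      IsIrreducibleHighestWeight ρ (glWeight l c) →
      ∃ ξ : Module.Dual ℂ (gr SDHat 0),
        IsIrreducibleHighestWeight (ρ ∘ₗ phiHat s) ξ ∧
        (∀ ξ' : Module.Dual ℂ (gr SDHat 0), ξ' = ξ ↔
          ξ' sdC₀ = c ∧
          (sdDelta ξ' 0 : LaurentSeries ℂ) =
            ((∑ᶠ i : ℤ, (l (2 * i) - l (2 * i + 2) + if i = 0 then c else 0) • expS (-i + s)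
              - PowerSeries.C c : PowerSeries ℂ) : LaurentSeries ℂ) /
            ((expS 1 - 1 : PowerSeries ℂ) : LaurentSeries ℂ) ∧
          (sdDelta ξ' 1 : LaurentSeries ℂ) =
            ((∑ᶠ i : ℤ, (l (2 * i - 1) - l (2 * i + 1) - if i = 0 then c else 0) • expS (-i + s)
              + PowerSeries.C c : PowerSeries ℂ) : LaurentSeries ℂ) /
            ((expS 1 - 1 : PowerSeries ℂ) : LaurentSeries ℂ))) ∧
    -- modules over `BHat`, pulled back to `ZeroSDHat`
    (∀ (c : ℂ) (l : ℕ+ →₀ ℂ) (ρ : BHat →ₗ[ℂ] Module.End ℂ V),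
      IsIrreducibleHighestWeight ρ (bWeight l c) →
      ∃ ξ : Module.Dual ℂ (gr ZeroSDHat 0),
        IsIrreducibleHighestWeight (ρ ∘ₗ phiHatB) ξ ∧
        (∀ ξ' : Module.Dual ℂ (gr ZeroSDHat 0), ξ' = ξ ↔
          ξ' zeroC₀ = c ∧
          zeroDelta₀ ξ' = -∑ᶠ i : ℕ+, l (2 * i) • sinhS (-(i : ℂ)) ∧
          zeroDelta₁ ξ' = -∑ᶠ i : ℕ, l (Nat.succPNat (2 * i)) • sinhS (-((i : ℂ) + 1 / 2)))) ∧
    -- modules over the central extension of `gl_{∞|∞}`, pulled back to `ZeroSDHat`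
    (∀ (s c : ℂ) (l : ℤ →₀ ℂ) (ρ : GlHat →ₗ[ℂ] Module.End ℂ V),
      (∀ k : ℤ, s ≠ k / 2) →
      IsIrreducibleHighestWeight ρ (glWeight l c) →
      ∃ ξ : Module.Dual ℂ (gr ZeroSDHat 0),
        IsIrreducibleHighestWeight (ρ ∘ₗ phiHatZero s) ξ ∧
        (∀ ξ' : Module.Dual ℂ (gr ZeroSDHat 0), ξ' = ξ ↔
          ξ' zeroC₀ = c ∧
          (zeroDelta₀ ξ' : LaurentSeries ℂ) =
            ((-∑ᶠ i : ℤ, l (2 * i) • sinhS (-i + s) : PowerSeries ℂ) : LaurentSeries ℂ) +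
            (((c / 2) • (coshS (s - 1 / 2) - coshS (1 / 2)) : PowerSeries ℂ) :
              LaurentSeries ℂ) / ((sinhS (1 / 2) : PowerSeries ℂ) : LaurentSeries ℂ) ∧
          (zeroDelta₁ ξ' : LaurentSeries ℂ) =
            ((-∑ᶠ i : ℤ, l (2 * i - 1) • sinhS (-((i : ℂ) - 1 / 2) + s) : PowerSeries ℂ) :
              LaurentSeries ℂ) -
            (((c / 2) • (coshS s - 1) : PowerSeries ℂ) : LaurentSeries ℂ) /
              ((sinhS (1 / 2) : PowerSeries ℂ) : LaurentSeries ℂ))) := by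

  refine ⟨fun s c l ρ h => ?_, fun c l ρ h => ?_, fun s c l ρ hs h => ?_⟩
  · refine ⟨pullWeight s (glWeight l c), h.comp (phiHat s) (phiHat_mem_gr s) (phiHat_bracket s)
      (phiHat_dense s c l h), fun ξ' => ?_⟩
    have hC : pullWeight s (glWeight l c) sdC₀ = c := weightForm_phiHat_sdC id l c s
    have h0 := coe_eq_div expS_one_sub_one_ne_zero (sdDelta_pullWeight_zero s c l)
    have h1 := coe_eq_div expS_one_sub_one_ne_zero (sdDelta_pullWeight_one s c l)
    constructor
    · rintro rfl
      exact ⟨hC, h0, h1⟩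
    -- Uniqueness: power series embed in Laurent series, and the series together with the value at
    -- `C` determine the weight.
    · rintro ⟨hC', h0', h1'⟩
      refine dual_gr_sdHat_ext (hC'.trans hC.symm) fun a => ?_
      fin_cases a
      · exact HahnSeries.ofPowerSeries_injective (h0'.trans h0.symm)
      · exact HahnSeries.ofPowerSeries_injective (h1'.trans h1.symm)
  · refine ⟨pullWeightB (bWeight l c), h.comp phiHatB phiHatB_mem_gr phiHatB_bracket
      (phiHatB_dense c l h), fun ξ' => ?_⟩
    have hC : pullWeightB (bWeight l c) zeroC₀ = c :=
      weightForm_phiHat_sdC (fun n : ℕ+ => (n : ℤ)) l c 0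
    have h0 := zeroDelta₀_pullWeightB c l
    have h1 := zeroDelta₁_pullWeightB c l
    constructor
    · rintro rfl
      exact ⟨hC, h0, h1⟩
    · rintro ⟨hC', h0', h1'⟩
      exact dual_gr_zeroSDHat_ext (hC'.trans hC.symm) (h0'.trans h0.symm) (h1'.trans h1.symm)
  · refine ⟨pullWeightZero s (glWeight l c), h.comp (phiHatZero s) (phiHatZero_mem_gr s)
      (phiHatZero_bracket s) (phiHatZero_dense s c hs l h), fun ξ' => ?_⟩
    have hC : pullWeightZero s (glWeight l c) zeroC₀ = c := weightForm_phiHat_sdC id l c s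
    have h0 := coe_eq_add_div sinhS_half_ne_zero (zeroDelta₀_pullWeightZero s c l)
    have h1 := coe_eq_sub_div sinhS_half_ne_zero (zeroDelta₁_pullWeightZero s c l)
    constructor
    · rintro rfl
      exact ⟨hC, h0, h1⟩
    · rintro ⟨hC', h0', h1'⟩
      exact dual_gr_zeroSDHat_ext (hC'.trans hC.symm)
        (HahnSeries.ofPowerSeries_injective (h0'.trans h0.symm))
        (HahnSeries.ofPowerSeries_injective (h1'.trans h1.symm))
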